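/- Let $1\le N\le\infty$, let $E=\{n\in\mathbb Z_{\ge0}: n\le N\}$ (all nonnegative integers if $N=\infty$) and $\tilde E=\{k\in\mathbb Z_{\ge 0}:k<N\}$. Let $\lambda_n>0$ for $n<N$, $\mu_n>0$ for $1\le n\le N$, $\mu_0=0$; if $N=\infty$, assume $\lambda_n\to\lambda>0$ and $\mu_n\to\mu>0$; if $N<\infty$, put $\lambda_N=0$, $\lambda:=\lambda_{N-1}$, $\mu:=\mu_N$. Put $\lambda_{-1}:=0$. Let $a,b:[0,\infty)\to[0,\infty)$ be locally integrable and asymptotically periodic: $a=a_1+a_2$, $b=b_1+b_2$, where $a_1,b_1$ are periodic on $[0,\infty)$ with periods $T_1,T_2>0$ and $a_2(t),b_2(t)\to0$ as $t\to\infty$. Put $a_m=\frac1{T_1}\int_0^{T_1}a_1$ and $b_m=\frac1{T_2}\int_0^{T_2}b_1$. Consider the birth-death process on $E$ with birth intensities $\lambda_na(t)$ and death intensities $\mu_nb(t)$. Its vectors of state probabilities are the solutions $p(t)=(p_n(t))_{n\in E}$, with values in the set $\Omega$ of probability vectors on $E$, of the forward Kolmogorov system (understood in integrated form) $$p_n'=\lambda_{n-1}a(t)p_{n-1}-(\lambda_na(t)+\mu_nb(t))p_n+\mu_{n+1}b(t)p_{n+1},\qquad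 n\in E,$$ where $p_{-1}=0$ and, if $N<\infty$, $p_{N+1}=0$. Let $\|\cdot\|$ be the $\ell_1$-norm. The process is weakly ergodic if $\|p^{1}(t)-p^{2}(t)\|\to0$ as $t\to\infty$ for any two such solutions on $[0,\infty)$, and quasi-ergodic if there is $\tilde\pi\in\Omega$ with $\big\|\frac1t\int_0^tp(\tau)\,d\tau-\tilde\pi\big\|\to0$ for every such solution on $[0,\infty)$. For a sequence $\delta=(\delta_k)_{k\in\tilde E}$ of positive numbers put $d_0=1$, $d_k=\delta_1\cdots\delta_k$ ($k\in\tilde E$), $q_i=\sum_{m=0}^{i-1}d_m$, $g=\min\{2,\inf_{0<k<N}d_k\}$ (with $\inf\emptyset=+\infty$), and for $k\in\tilde E$ $$\alpha_k(t)=\lambda_ka(t)+\mu_{k+1}b(t)-\delta_{k+1}\lambda_{k+1}a(t)-\delta_k^{-1}\mu_kb(t)$$ (the third term is $0$ for $k=N-1$, the fourth is $0$ for $k=0$). For a difference $x$ of two elements of $\Omega$ put $\|x\|_{1D}=\sum_{k\in\tilde E}d_k\big|\sum_{i>k}x_i\big|\in[0,\infty]$. **Theorem 1.** Suppose that for some $\Delta>1$: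 a) $\lambda_{k-1}\mu_{k+1}-\lambda_k\mu_k\ge0$ for all $k\in\tilde E$; b) $\mu b_m-\Delta\lambda a_m>0$; c) $\inf_{k\in\tilde E}f_k=:f>0$, where $$f_k=\frac{\Delta\lambda\mu_{k+1}-\lambda_{k-1}\mu+\sqrt{(\Delta\lambda\mu_{k+1}-\lambda_{k-1}\mu)^2+4\Delta\lambda\mu(\lambda_{k-1}\mu_{k+1}-\lambda_k\mu_k)}}{2\Delta\lambda\mu}.$$ Let $c\in(0,1)$ be any number with $c<\mu_{k+1}/\mu$ for all $k\in\tilde E$ and $c\le f$. Put $l(t)=c\,(\mu b(t)-\Delta\lambda a(t))$. Then there is a sequence $\delta=(\delta_k)_{k\in\tilde E}$ of positive numbers, with $\liminf_k\delta_k>1$ if $N=\infty$, such that $g>0$ and: (i) $\alpha_k(t)\ge l(t)$ for all $k\in\tilde E$ and $t\ge0$; (ii) the process is weakly ergodic, and for all $s\ge0$, all state probability vectors $p^1,p^2$ of the process on $[s,\infty)$, and all $t\ge s$, $$\|p^1(t)-p^2(t)\|_{1D}\le e^{-\int_s^tl(u)\,du}\,\|p^1(s)-p^2(s)\|_{1D},$$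 $$\|p^1(t)-p^2(t)\|\le\frac4g\,e^{-\int_s^tl(u)\,du}\sum_{i\ge1}q_i\,|p^1_i(s)-p^2_i(s)|$$ (the right-hand sides may be $+\infty$); (iii) the process is quasi-ergodic. -/

import Mathlib

open Filter Topology MeasureTheory
open scoped ENNReal

noncomputable section

/-! The state space is `{n : ℕ | n ≤ N}` with `N : ℕ∞` (so `N = ⊤` is the infinite case).
A vector indexed by the state space is a sequence `ℕ → ℝ` that vanishes beyond `N`. -/

/-- The set of probability vectors on `{0, …, N}`. -/
def probVectors (N : ℕ∞) : Set (ℕ → ℝ) :=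
  {x | (∀ n, 0 ≤ x n) ∧ HasSum x 1 ∧ ∀ n : ℕ, N < (n : ℕ∞) → x n = 0}

/-- The `ℓ¹` norm, with values in `[0, ∞]`. -/
def l1Norm (x : ℕ → ℝ) : ℝ≥0∞ := ∑' n, ENNReal.ofReal |x n|

/-- The index-shifted sequence `k ↦ r (k - 1)` with the convention `r (-1) = 0`. -/
def shiftDown (r : ℕ → ℝ) : ℕ → ℝ
  | 0 => 0
  | k + 1 => r k

/-- Time-dependent intensities of the product form `r n * a t`. -/
def productRate (r : ℕ → ℝ) (a : ℝ → ℝ) (n : ℕ) (t : ℝ) : ℝ := r n * a t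

/-- The `n`-th coordinate of `A x`, where `A` is the (transposed) intensity matrix of the
birth-death process with birth rates `L` and death rates `M`. -/
def forwardRHS (L M : ℕ → ℝ) (x : ℕ → ℝ) (n : ℕ) : ℝ :=
  shiftDown (fun k => L k * x k) n - (L n + M n) * x n + M (n + 1) * x (n + 1)

/-- `p` is, on the time interval `[s, ∞)`, a family of state probabilities of the birth-death
process on `{0, …, N}` with birth intensities `L n t` and death intensities `M n t`: a solution,
with values in the probability vectors, of the forward Kolmogorov system `dp/dt = A(t) p`.
As the intensities are only locally integrable in time, solutions are understood in the
(Carathéodory) sense of the integrated system. -/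
def IsForwardSolution (N : ℕ∞) (L M : ℕ → ℝ → ℝ) (s : ℝ) (p : ℝ → ℕ → ℝ) : Prop :=
  (∀ t, s ≤ t → p t ∈ probVectors N) ∧
  ∀ n : ℕ, (n : ℕ∞) ≤ N → ∀ t, s ≤ t →
    IntervalIntegrable (fun u => forwardRHS (fun k => L k u) (fun k => M k u) (p u) n)
      volume s t ∧
    p t n = p s n + ∫ u in s..t, forwardRHS (fun k => L k u) (fun k => M k u) (p u) n

/-- Weak ergodicity: any two families of state probabilities merge in `ℓ¹` as time grows. -/
def BDWeaklyErgodic (N : ℕ∞) (L M : ℕ → ℝ → ℝ) : Prop :=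
  ∀ p q : ℝ → ℕ → ℝ, IsForwardSolution N L M 0 p → IsForwardSolution N L M 0 q →
    Tendsto (fun t => l1Norm (p t - q t)) atTop (𝓝 0)

/-- Quasi-ergodicity: the time averages of all families of state probabilities converge in `ℓ¹`
to one and the same probability vector. -/
def BDQuasiErgodic (N : ℕ∞) (L M : ℕ → ℝ → ℝ) : Prop :=
  ∃ ϖ ∈ probVectors N, ∀ p : ℝ → ℕ → ℝ, IsForwardSolution N L M 0 p →
    Tendsto (fun t : ℝ => l1Norm (fun n => (1 / t) * (∫ τ in (0 : ℝ)..t, p τ n) - ϖ n))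
      atTop (𝓝 0)

/-- `a = a₁ + a₂` on `[0, ∞)`, with `a₁` periodic of period `T > 0` and `a₂` vanishing at
infinity. -/
structure IsAsymptoticallyPeriodic (a a₁ a₂ : ℝ → ℝ) (T : ℝ) : Prop where
  period_pos : 0 < T
  decomp : ∀ t, 0 ≤ t → a t = a₁ t + a₂ t
  periodic : ∀ t, 0 ≤ t → a₁ (t + T) = a₁ t
  vanishing : Tendsto a₂ atTop (𝓝 0)

/-- The mean over one period. -/
def periodMean (a₁ : ℝ → ℝ) (T : ℝ) : ℝ := (1 / T) * ∫ u in (0 : ℝ)..T, a₁ u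

/-- The standing assumptions on the coefficients `λ_n`, `μ_n` and on the two numbers `λ`, `μ`
attached to them: limits if the state space is infinite, last coefficients if it is finite. -/
structure IsBirthDeathCoeffs (N : ℕ∞) (lam mu : ℕ → ℝ) (lamLim muLim : ℝ) : Prop where
  one_le : 1 ≤ N
  lam_pos : ∀ n : ℕ, (n : ℕ∞) < N → 0 < lam n
  mu_pos : ∀ n : ℕ, 1 ≤ n → (n : ℕ∞) ≤ N → 0 < mu n
  mu_zero : mu 0 = 0
  lamLim_pos : 0 < lamLim
  muLim_pos : 0 < muLim
  infinite : N = ⊤ → Tendsto lam atTop (𝓝 lamLim) ∧ Tendsto mu atTop (𝓝 muLim)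
  finite : ∀ n : ℕ, N = (n : ℕ∞) → lam n = 0 ∧ lamLim = lam (n - 1) ∧ muLim = mu n

/-- The numbers `f_k` (with `λ_{-1} = 0`). -/
def fCoeff (lam mu : ℕ → ℝ) (lamLim muLim Δ : ℝ) (k : ℕ) : ℝ :=
  (Δ * lamLim * mu (k + 1) - shiftDown lam k * muLim +
    √((Δ * lamLim * mu (k + 1) - shiftDown lam k * muLim) ^ 2 +
      4 * Δ * lamLim * muLim * (shiftDown lam k * mu (k + 1) - lam k * mu k))) /
  (2 * Δ * lamLim * muLim)

/-- `α_k(t)`; the last term is absent for `k = 0` because `M 0 t = 0`, and the third one is absent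
for `k = N - 1` because `L N t = 0`. -/
def alphaCoeff (L M : ℕ → ℝ → ℝ) (δ : ℕ → ℝ) (k : ℕ) (t : ℝ) : ℝ :=
  L k t + M (k + 1) t - δ (k + 1) * L (k + 1) t - (δ k)⁻¹ * M k t

/-- `d_k = δ_1 ⋯ δ_k`, so `d_0 = 1` and `d_{k+1} / d_k = δ_{k+1}`. -/
def dWeight (δ : ℕ → ℝ) (k : ℕ) : ℝ := ∏ i ∈ Finset.range k, δ (i + 1)

/-- `q_i = d_0 + ⋯ + d_{i-1}`. -/
def qWeight (δ : ℕ → ℝ) (i : ℕ) : ℝ := ∑ m ∈ Finset.range i, dWeight δ m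

/-- The constant `g = min (2, inf {d_k : 0 < k < N})`. -/
def gConst (N : ℕ∞) (δ : ℕ → ℝ) : ℝ :=
  sInf (insert 2 {r : ℝ | ∃ k : ℕ, 0 < k ∧ (k : ℕ∞) < N ∧ r = dWeight δ k})

/-- The norm `‖z‖_{1D} = ‖D z‖` in `[0, ∞]` of `z = (x_1, x_2, …)`, where `D` is the upper
triangular matrix whose `k`-th row is `d_k` on and above the diagonal; that is,
`∑_k d_k |x_{k+1} + x_{k+2} + ⋯|`. For `x` vanishing beyond `N` only the rows `k < N` matter. -/
def norm1D (δ : ℕ → ℝ) (x : ℕ → ℝ) : ℝ≥0∞ :=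
  ∑' k, ENNReal.ofReal |dWeight δ k * ∑' i, x (k + 1 + i)|

end

theorem AbsolutelyContinuousOnInterval.of_dist_le {X Y : Type*} [PseudoMetricSpace X]
    [PseudoMetricSpace Y] {f : ℝ → X} {g : ℝ → Y} {s t K : ℝ}
    (hf : AbsolutelyContinuousOnInterval f s t)
    (h : ∀ x ∈ Set.uIcc s t, ∀ y ∈ Set.uIcc s t, dist (g x) (g y) ≤ K * dist (f x) (f y)) :
    AbsolutelyContinuousOnInterval g s t := by
  unfold AbsolutelyContinuousOnInterval at hf ⊢
  have hK : Tendsto (fun E : ℕ × (ℕ → ℝ × ℝ) =>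
      K * ∑ i ∈ Finset.range E.1, dist (f (E.2 i).1) (f (E.2 i).2))
      (AbsolutelyContinuousOnInterval.totalLengthFilter ⊓
        𝓟 (AbsolutelyContinuousOnInterval.disjWithin s t)) (𝓝 0) := by
    simpa using hf.const_mul K
  refine squeeze_zero' (Eventually.of_forall fun E => Finset.sum_nonneg fun i _ => dist_nonneg)
    ?_ hK
  filter_upwards [mem_inf_of_right (mem_principal_self _)] with E hE
  rw [Finset.mul_sum]
  exact Finset.sum_le_sum fun i hi => h _ (hE.1 i hi).1 _ (hE.1 i hi).2

theorem AbsolutelyContinuousOnInterval.abs' {f : ℝ → ℝ} {s t : ℝ}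
    (hf : AbsolutelyContinuousOnInterval f s t) :
    AbsolutelyContinuousOnInterval (fun x => |f x|) s t :=
  hf.of_dist_le (K := 1) fun x _ y _ => by
    simpa [Real.dist_eq] using abs_abs_sub_abs_le_abs_sub (f x) (f y)

theorem AbsolutelyContinuousOnInterval.exp {f : ℝ → ℝ} {s t : ℝ}
    (hf : AbsolutelyContinuousOnInterval f s t) :
    AbsolutelyContinuousOnInterval (fun x => Real.exp (f x)) s t := by
  obtain ⟨C, hC⟩ := hf.exists_bound
  refine hf.of_dist_le (K := Real.exp C) fun x hx y hy => ?_
  have key : ∀ u v : ℝ, u ≤ C → v ≤ C → Real.exp u - Real.exp v ≤ Real.exp C * |u - v| := by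
    intro u v hu _
    have h1 : Real.exp u - Real.exp v = Real.exp u * (1 - Real.exp (v - u)) := by
      rw [mul_sub, ← Real.exp_add]; ring_nf
    have h2 : 1 - Real.exp (v - u) ≤ |u - v| := by
      have := Real.add_one_le_exp (v - u)
      have := le_abs_self (u - v)
      linarith
    rw [h1]
    calc Real.exp u * (1 - Real.exp (v - u)) ≤ Real.exp u * |u - v| := by gcongr
      _ ≤ _ := by gcongr
  have hx' := (abs_le.1 (hC x hx)).2
  have hy' := (abs_le.1 (hC y hy)).2
  rw [Real.dist_eq, Real.dist_eq]
  refine abs_le.2 ⟨?_, key _ _ hx' hy'⟩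
  have := key _ _ hy' hx'
  rw [abs_sub_comm] at this
  linarith

theorem AbsolutelyContinuousOnInterval.const (c s t : ℝ) :
    AbsolutelyContinuousOnInterval (fun _ : ℝ => c) s t := by
  simpa [AbsolutelyContinuousOnInterval] using tendsto_const_nhds

theorem AbsolutelyContinuousOnInterval.finset_sum {ι : Type*} (S : Finset ι) {f : ι → ℝ → ℝ}
    {s t : ℝ} (hf : ∀ i ∈ S, AbsolutelyContinuousOnInterval (f i) s t) :
    AbsolutelyContinuousOnInterval (fun x => ∑ i ∈ S, f i x) s t := by
  classical
  induction S using Finset.induction_on with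
  | empty => simpa using AbsolutelyContinuousOnInterval.const 0 s t
  | insert i S hi ih =>
    simp only [Finset.sum_insert hi]
    exact (hf i (by simp)).fun_add (ih fun j hj => hf j (by simp [hj]))

theorem absolutelyContinuousOnInterval_of_integral_eq {z F : ℝ → ℝ} {s t : ℝ} (hst : s ≤ t)
    (hF : IntervalIntegrable F volume s t)
    (hz : ∀ u ∈ Set.Icc s t, z u = z s + ∫ v in s..u, F v) :
    AbsolutelyContinuousOnInterval z s t := by
  refine (hF.absolutelyContinuousOnInterval_intervalIntegral (c := s) (by simp)).of_dist_le
    (K := 1) fun x hx y hy => ?_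
  rw [Set.uIcc_of_le hst] at hx hy
  rw [hz x hx, hz y hy]
  simp

theorem ae_hasDerivAt_of_integral_eq {z F : ℝ → ℝ} {s t : ℝ} (hst : s ≤ t)
    (hF : IntervalIntegrable F volume s t)
    (hz : ∀ u ∈ Set.Icc s t, z u = z s + ∫ v in s..u, F v) :
    ∀ᵐ u, u ∈ Set.uIoc s t → HasDerivAt z (F u) u := by
  have h1 := hF.ae_hasDerivAt_integral
  have h2 : ∀ᵐ u : ℝ, u ≠ t := by simp [ae_iff]
  filter_upwards [h1, h2] with u hu hut hmem
  rw [Set.uIoc_of_le hst] at hmem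
  have hd := hu (by rw [Set.uIcc_of_le hst]; exact ⟨hmem.1.le, hmem.2⟩) s (by simp)
  refine (hd.const_add (z s)).congr_of_eventuallyEq ?_
  filter_upwards [Ioo_mem_nhds hmem.1 (lt_of_le_of_ne hmem.2 hut)] with v hv
  exact hz v ⟨hv.1.le, hv.2.le⟩

theorem deriv_abs_of_hasDerivAt {z : ℝ → ℝ} {z' u : ℝ} (hz : HasDerivAt z z' u)
    (hd : DifferentiableAt ℝ (fun v => |z v|) u) :
    HasDerivAt (fun v => |z v|) (SignType.sign (z u) * z') u := by
  rcases eq_or_ne (z u) 0 with h0 | h0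
  · have hmin : IsLocalMin (fun v => |z v|) u :=
      Eventually.of_forall fun v => by simp [h0]
    have := hd.hasDerivAt
    rw [hmin.deriv_eq_zero] at this
    simpa [h0] using this
  · exact (hasDerivAt_abs h0).comp u hz

/-- Gronwall's inequality for a finite weighted sum of absolute values of primitives. -/
theorem exp_mul_sum_abs_le {ι : Type*} (S : Finset ι) {z F : ι → ℝ → ℝ} {w : ι → ℝ} {l ρ : ℝ → ℝ}
    {s t : ℝ} (hst : s ≤ t)
    (hF : ∀ k ∈ S, IntervalIntegrable (F k) volume s t)
    (hz : ∀ k ∈ S, ∀ u ∈ Set.Icc s t, z k u = z k s + ∫ v in s..u, F k v)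
    (hl : IntervalIntegrable l volume s t) (hρ : IntervalIntegrable ρ volume s t)
    (hineq : ∀ u ∈ Set.Icc s t, ∑ k ∈ S, w k * (SignType.sign (z k u) * F k u) ≤
      -l u * ∑ k ∈ S, w k * |z k u| + ρ u) :
    Real.exp (∫ v in s..t, l v) * ∑ k ∈ S, w k * |z k t| ≤
      ∑ k ∈ S, w k * |z k s| + ∫ u in s..t, Real.exp (∫ v in s..u, l v) * ρ u := by
  have hE := hl.absolutelyContinuousOnInterval_intervalIntegral (c := s) (by simp)
  have hEexp := hE.exp
  have hzabs : ∀ k ∈ S, AbsolutelyContinuousOnInterval (fun x => |z k x|) s t := fun k hk =>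
    (absolutelyContinuousOnInterval_of_integral_eq hst (hF k hk) (hz k hk)).abs'
  have hW : AbsolutelyContinuousOnInterval (fun x => ∑ k ∈ S, w k * |z k x|) s t :=
    AbsolutelyContinuousOnInterval.finset_sum S fun k hk => (hzabs k hk).const_mul (w k)
  have hprod := hEexp.fun_mul hW
  have hint := hprod.integral_deriv_eq_sub
  have hle : ∫ u in s..t, deriv (fun x => Real.exp (∫ v in s..x, l v) *
      ∑ k ∈ S, w k * |z k x|) u ≤ ∫ u in s..t, Real.exp (∫ v in s..u, l v) * ρ u := by
    refine intervalIntegral.integral_mono_ae_restrict hst hprod.intervalIntegrable_deriv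
      (hρ.continuousOn_mul hEexp.continuousOn) ?_
    have hall : ∀ᵐ u : ℝ, ∀ k ∈ S, u ∈ Set.uIoc s t →
        HasDerivAt (fun x => |z k x|) (SignType.sign (z k u) * F k u) u := by
      refine (ae_ball_iff S.countable_toSet).2 fun k hk => ?_
      filter_upwards [ae_hasDerivAt_of_integral_eq hst (hF k hk) (hz k hk),
        (hzabs k hk).ae_differentiableAt] with u h1 h2 hu
      exact deriv_abs_of_hasDerivAt (h1 hu) (h2 (Set.uIoc_subset_uIcc hu))
    have hne : ∀ᵐ u : ℝ, u ≠ s := by simp [ae_iff]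
    have hEd := ae_hasDerivAt_of_integral_eq (z := fun u => ∫ v in s..u, l v) hst hl (by simp)
    refine (ae_restrict_iff' measurableSet_Icc).2 ?_
    filter_upwards [hall, hEd, hne] with u h1 h2 h3 hu
    have hu' : u ∈ Set.uIoc s t := by
      rw [Set.uIoc_of_le hst]; exact ⟨lt_of_le_of_ne hu.1 h3.symm, hu.2⟩
    have hd := ((h2 hu').exp).fun_mul (HasDerivAt.fun_sum fun k hk => ((h1 k hk hu').const_mul (w k)))
    rw [hd.deriv]
    have := mul_le_mul_of_nonneg_left (hineq u hu) (Real.exp_pos (∫ v in s..u, l v)).le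
    nlinarith
  rw [hint] at hle
  simp only [intervalIntegral.integral_same, Real.exp_zero, one_mul] at hle
  linarith

/-- `z` solves, on `[s, t]`, the integrated tridiagonal system
`z_k' = A_k z_{k-1} - D_k z_k + B_k z_{k+1} + r_k`, whose coefficients are dominated by the
integrable function `h`. -/
structure IsTridiagonalOn (A D B r : ℕ → ℝ → ℝ) (h : ℝ → ℝ) (z : ℕ → ℝ → ℝ) (s t : ℝ) : Prop where
  le : s ≤ t
  h_int : IntervalIntegrable h volume s t
  A_nonneg : ∀ k, ∀ u ∈ Set.Icc s t, 0 ≤ A k u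
  A_le : ∀ k, ∀ u ∈ Set.Icc s t, A k u ≤ h u
  B_nonneg : ∀ k, ∀ u ∈ Set.Icc s t, 0 ≤ B k u
  B_le : ∀ k, ∀ u ∈ Set.Icc s t, B k u ≤ h u
  D_nonneg : ∀ k, ∀ u ∈ Set.Icc s t, 0 ≤ D k u
  rhs_int : ∀ k, IntervalIntegrable (fun u => A k u * shiftDown (fun j => z j u) k - D k u * z k u +
    B k u * z (k + 1) u + r k u) volume s t
  eq : ∀ k, ∀ u ∈ Set.Icc s t, z k u = z k s + ∫ v in s..u,
    (A k v * shiftDown (fun j => z j v) k - D k v * z k v + B k v * z (k + 1) v + r k v)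

theorem IsTridiagonalOn.mono {A D B r : ℕ → ℝ → ℝ} {h : ℝ → ℝ} {z : ℕ → ℝ → ℝ} {s t t' : ℝ}
    (H : IsTridiagonalOn A D B r h z s t) (hs : s ≤ t') (ht : t' ≤ t) :
    IsTridiagonalOn A D B r h z s t' := by
  have hsub : Set.Icc s t' ⊆ Set.Icc s t := Set.Icc_subset_Icc_right ht
  have hsub' : Set.uIcc s t' ⊆ Set.uIcc s t := by
    rwa [Set.uIcc_of_le hs, Set.uIcc_of_le (hs.trans ht)]
  exact ⟨hs, H.h_int.mono_set hsub', fun k u hu => H.A_nonneg k u (hsub hu),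
    fun k u hu => H.A_le k u (hsub hu), fun k u hu => H.B_nonneg k u (hsub hu),
    fun k u hu => H.B_le k u (hsub hu), fun k u hu => H.D_nonneg k u (hsub hu),
    fun k => (H.rhs_int k).mono_set hsub', fun k u hu => H.eq k u (hsub hu)⟩

theorem IsTridiagonalOn.continuousOn {A D B r : ℕ → ℝ → ℝ} {h : ℝ → ℝ} {z : ℕ → ℝ → ℝ} {s t : ℝ}
    (H : IsTridiagonalOn A D B r h z s t) (k : ℕ) : ContinuousOn (z k) (Set.uIcc s t) :=
  (absolutelyContinuousOnInterval_of_integral_eq H.le (H.rhs_int k) (H.eq k)).continuousOn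

theorem sum_tridiagonal_eq (A D B w : ℕ → ℝ) (y : ℕ → ℝ) (n : ℕ) :
    ∑ k ∈ Finset.range n, w k * (A k * shiftDown y k - D k * y k + B k * y (k + 1)) =
      ∑ k ∈ Finset.range n, (A (k + 1) * w (k + 1) + shiftDown (fun j => B j * w j) k -
        D k * w k) * y k + shiftDown (fun j => B j * w j) n * y n -
      A n * w n * shiftDown y n := by
  induction n with
  | zero => simp [shiftDown]
  | succ n ih =>
    rw [Finset.sum_range_succ, Finset.sum_range_succ, ih]
    simp only [shiftDown]
    ring

theorem sign_mul_tridiagonal_le {A D B r x y z : ℝ} (hA : 0 ≤ A) (hB : 0 ≤ B) :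
    (SignType.sign y : ℝ) * (A * x - D * y + B * z + r) ≤ A * |x| - D * |y| + B * |z| + |r| := by
  have h1 : ∀ c : ℝ, (SignType.sign y : ℝ) * c ≤ |c| := by
    intro c
    rcases lt_trichotomy y 0 with h | h | h
    · simpa [sign_neg h] using neg_le_abs c
    · simp [h]
    · simpa [sign_pos h] using le_abs_self c
  have h2 : (SignType.sign y : ℝ) * y = |y| := sign_mul_self y
  calc _ = A * (SignType.sign y * x) - D * (SignType.sign y * y) + B * (SignType.sign y * z) +
        SignType.sign y * r := by ring
    _ ≤ _ := by
      rw [h2]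
      have := mul_le_mul_of_nonneg_left (h1 x) hA
      have := mul_le_mul_of_nonneg_left (h1 z) hB
      have := h1 r
      linarith

theorem abs_shiftDown (y : ℕ → ℝ) (k : ℕ) : |shiftDown y k| = shiftDown (fun j => |y j|) k := by
  cases k <;> simp [shiftDown]

section Weighted

variable {A D B r : ℕ → ℝ → ℝ} {h l ρ : ℝ → ℝ} {z : ℕ → ℝ → ℝ} {s t κ : ℝ} {w : ℕ → ℝ}

theorem IsTridiagonalOn.trunc_le (H : IsTridiagonalOn A D B r h z s t)
    (hw : ∀ k, 0 ≤ w k) (hwd : ∀ k, w k ≤ κ * w (k + 1))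
    (hl : IntervalIntegrable l volume s t) (hρ : IntervalIntegrable ρ volume s t)
    (hr : ∀ u ∈ Set.Icc s t, ∀ n, ∑ k ∈ Finset.range n, w k * |r k u| ≤ ρ u)
    (hcol : ∀ u ∈ Set.Icc s t, ∀ k, A (k + 1) u * w (k + 1) +
      shiftDown (fun j => B j u * w j) k - D k u * w k ≤ -l u * w k ∨ z k u = 0) (n : ℕ) :
    Real.exp (∫ v in s..t, l v) * ∑ k ∈ Finset.range n, w k * |z k t| ≤
      ∑ k ∈ Finset.range n, w k * |z k s| +
      ∫ u in s..t, Real.exp (∫ v in s..u, l v) * (ρ u + h u * (κ * (w n * |z n u|))) := by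
  have hb : IntervalIntegrable (fun u => h u * (κ * (w n * |z n u|))) volume s t :=
    H.h_int.mul_continuousOn
      (continuousOn_const.mul (continuousOn_const.mul (H.continuousOn n).abs))
  refine exp_mul_sum_abs_le (Finset.range n) H.le (fun k _ => H.rhs_int k) (fun k _ => H.eq k) hl
    (hρ.add hb) fun u hu => ?_
  have h0 : 0 ≤ h u := (H.A_nonneg 0 u hu).trans (H.A_le 0 u hu)
  calc ∑ k ∈ Finset.range n, w k * (SignType.sign (z k u) * (A k u * shiftDown (fun j => z j u) k -
          D k u * z k u + B k u * z (k + 1) u + r k u))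
      ≤ ∑ k ∈ Finset.range n, (w k * (A k u * shiftDown (fun j => |z j u|) k -
          D k u * |z k u| + B k u * |z (k + 1) u|) + w k * |r k u|) := by
        refine Finset.sum_le_sum fun k _ => ?_
        rw [← mul_add]
        refine mul_le_mul_of_nonneg_left ?_ (hw k)
        rw [← abs_shiftDown]
        exact sign_mul_tridiagonal_le (H.A_nonneg k u hu) (H.B_nonneg k u hu)
    _ = ∑ k ∈ Finset.range n, (A (k + 1) u * w (k + 1) + shiftDown (fun j => B j u * w j) k -
          D k u * w k) * |z k u| + shiftDown (fun j => B j u * w j) n * |z n u| -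
          A n u * w n * shiftDown (fun j => |z j u|) n +
          ∑ k ∈ Finset.range n, w k * |r k u| := by
        rw [Finset.sum_add_distrib, sum_tridiagonal_eq (fun k => A k u) (fun k => D k u)
          (fun k => B k u) w (fun k => |z k u|) n]
    _ ≤ -l u * ∑ k ∈ Finset.range n, w k * |z k u| + (ρ u + h u * (κ * (w n * |z n u|))) := by
        have h1 : ∑ k ∈ Finset.range n, (A (k + 1) u * w (k + 1) +
            shiftDown (fun j => B j u * w j) k - D k u * w k) * |z k u| ≤
            -l u * ∑ k ∈ Finset.range n, w k * |z k u| := by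
          rw [Finset.mul_sum]
          refine Finset.sum_le_sum fun k _ => ?_
          rcases hcol u hu k with hc | hc
          · calc _ ≤ (-l u * w k) * |z k u| := by gcongr
              _ = _ := by ring
          · simp [hc]
        have h2 : shiftDown (fun j => B j u * w j) n * |z n u| ≤ h u * (κ * (w n * |z n u|)) := by
          have : shiftDown (fun j => B j u * w j) n ≤ h u * (κ * w n) ∨ n = 0 := by
            cases n with
            | zero => right; rfl
            | succ m =>
              left
              exact mul_le_mul (H.B_le m u hu) (hwd m) (hw m) h0
          rcases this with h3 | rfl
          · calc _ ≤ (h u * (κ * w n)) * |z n u| := by gcongr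
              _ = _ := by ring
          · have hκ : 0 ≤ κ * (w 0 * |z 0 u|) := by
              have h5 := hwd 0
              have h6 := hw 0
              rcases le_or_gt 0 κ with h7 | h7
              · exact mul_nonneg h7 (mul_nonneg h6 (abs_nonneg _))
              · have h8 : w 0 = 0 := le_antisymm
                  (h5.trans (mul_nonpos_of_nonpos_of_nonneg h7.le (hw 1))) h6
                simp [h8]
            simpa [shiftDown] using mul_nonneg h0 hκ
        have h3 : 0 ≤ A n u * w n * shiftDown (fun j => |z j u|) n := by
          refine mul_nonneg (mul_nonneg (H.A_nonneg n u hu) (hw n)) ?_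
          rw [← abs_shiftDown]
          positivity
        have := hr u hu n
        linarith

theorem IsTridiagonalOn.weighted_le_of_tendsto_zero (H : IsTridiagonalOn A D B r h z s t)
    (hw : ∀ k, 0 ≤ w k) (hwd : ∀ k, w k ≤ κ * w (k + 1))
    (hl : IntervalIntegrable l volume s t) (hρ : IntervalIntegrable ρ volume s t)
    (hr : ∀ u ∈ Set.Icc s t, ∀ n, ∑ k ∈ Finset.range n, w k * |r k u| ≤ ρ u)
    (hcol : ∀ u ∈ Set.Icc s t, ∀ k, A (k + 1) u * w (k + 1) +
      shiftDown (fun j => B j u * w j) k - D k u * w k ≤ -l u * w k ∨ z k u = 0)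
    {V₀ M : ℝ} (hV : ∀ n, ∑ k ∈ Finset.range n, w k * |z k s| ≤ V₀)
    (hM : ∀ u ∈ Set.Icc s t, ∀ k, w k * |z k u| ≤ M)
    (hlim : ∀ u ∈ Set.Icc s t, Tendsto (fun k => w k * |z k u|) atTop (𝓝 0)) (n : ℕ) :
    Real.exp (∫ v in s..t, l v) * ∑ k ∈ Finset.range n, w k * |z k t| ≤
      V₀ + ∫ u in s..t, Real.exp (∫ v in s..u, l v) * ρ u := by
  have hEc : ContinuousOn (fun u => Real.exp (∫ v in s..u, l v)) (Set.uIcc s t) :=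
    (hl.absolutelyContinuousOnInterval_intervalIntegral (c := s) (by simp)).exp.continuousOn
  have hbi : ∀ n, IntervalIntegrable (fun u => Real.exp (∫ v in s..u, l v) *
      (h u * (κ * (w n * |z n u|)))) volume s t := fun n =>
    (H.h_int.mul_continuousOn (continuousOn_const.mul
      (continuousOn_const.mul (H.continuousOn n).abs))).continuousOn_mul hEc
  have hIoc : ∀ u ∈ Set.uIoc s t, u ∈ Set.Icc s t := fun u hu => by
    rw [Set.uIoc_of_le H.le] at hu; exact ⟨hu.1.le, hu.2⟩
  have hT : Tendsto (fun n => ∫ u in s..t, Real.exp (∫ v in s..u, l v) *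
      (h u * (κ * (w n * |z n u|)))) atTop (𝓝 (∫ u in s..t, (0 : ℝ))) := by
    refine intervalIntegral.tendsto_integral_filter_of_dominated_convergence
      (fun u => Real.exp (∫ v in s..u, l v) * (h u * (|κ| * M))) ?_ ?_ ?_ ?_
    · exact Eventually.of_forall fun n => (hbi n).def'.aestronglyMeasurable
    · refine Eventually.of_forall fun n => Eventually.of_forall fun u hu => ?_
      have hu' := hIoc u hu
      have h0 : 0 ≤ h u := (H.A_nonneg 0 u hu').trans (H.A_le 0 u hu')
      rw [Real.norm_eq_abs, abs_mul, abs_mul, abs_mul, Real.abs_exp, abs_of_nonneg h0,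
        abs_of_nonneg (mul_nonneg (hw n) (abs_nonneg _))]
      gcongr
      exact hM u hu' n
    · exact (H.h_int.mul_const _).continuousOn_mul hEc
    · refine Eventually.of_forall fun u hu => ?_
      simpa using (((hlim u (hIoc u hu)).const_mul κ).const_mul (h u)).const_mul
        (Real.exp (∫ v in s..u, l v))
  rw [intervalIntegral.integral_zero] at hT
  have hlim' := hT.const_add (V₀ + ∫ u in s..t, Real.exp (∫ v in s..u, l v) * ρ u)
  rw [add_zero] at hlim'
  refine ge_of_tendsto hlim' ?_
  filter_upwards [eventually_ge_atTop n] with m hm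
  calc Real.exp (∫ v in s..t, l v) * ∑ k ∈ Finset.range n, w k * |z k t|
      ≤ Real.exp (∫ v in s..t, l v) * ∑ k ∈ Finset.range m, w k * |z k t| := by
        refine mul_le_mul_of_nonneg_left ?_ (Real.exp_pos _).le
        exact Finset.sum_le_sum_of_subset_of_nonneg (Finset.range_mono hm)
          fun k _ _ => mul_nonneg (hw k) (abs_nonneg _)
    _ ≤ _ := H.trunc_le hw hwd hl hρ hr hcol m
    _ = ∑ k ∈ Finset.range m, w k * |z k s| +
        ((∫ u in s..t, Real.exp (∫ v in s..u, l v) * ρ u) +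
        ∫ u in s..t, Real.exp (∫ v in s..u, l v) * (h u * (κ * (w m * |z m u|)))) := by
        rw [← intervalIntegral.integral_add (hρ.continuousOn_mul hEc) (hbi m)]
        simp only [mul_add]
    _ ≤ _ := by linarith [hV m]

theorem min_geometric_le {κ d d' c c' : ℝ} (hκ : 0 ≤ κ) (hd : d' ≤ κ * d) (hc : c' ≤ κ * c) :
    min d' c' ≤ κ * min d c := by
  rw [mul_min_of_nonneg _ _ hκ]
  exact min_le_min hd hc

theorem IsTridiagonalOn.weighted_bound (H : IsTridiagonalOn A D B r h z s t)
    {d : ℕ → ℝ} (hd : ∀ k, 0 < d k) (hdu : ∀ k, d (k + 1) ≤ κ * d k)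
    (hdd : ∀ k, d k ≤ κ * d (k + 1)) (hρ : IntervalIntegrable ρ volume s t)
    (hr : ∀ u ∈ Set.Icc s t, ∀ n, ∑ k ∈ Finset.range n, d k * |r k u| ≤ ρ u)
    {V₀ C : ℝ} (hV : ∀ n, ∑ k ∈ Finset.range n, d k * |z k s| ≤ V₀)
    (hC : ∀ u ∈ Set.Icc s t, ∀ k, |z k u| ≤ C) (n : ℕ) :
    ∑ k ∈ Finset.range n, d k * |z k t| ≤
      Real.exp (∫ u in s..t, (2 * max κ 2 + 1) * h u) * (V₀ + ∫ u in s..t, ρ u) := by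
  set K := max κ 2 with hKdef
  have hK2 : 2 ≤ K := le_max_right _ _
  have hKκ : κ ≤ K := le_max_left _ _
  have hK0 : 0 ≤ K := by linarith
  set m := ∑ k ∈ Finset.range n, d k * 2 ^ k with hm
  have hm0 : 0 ≤ m := Finset.sum_nonneg fun k _ => by have := hd k; positivity
  set w : ℕ → ℝ := fun k => min (d k) (m * (1 / 2) ^ k) with hwdef
  have hw : ∀ k, 0 ≤ w k := fun k => le_min (hd k).le (by positivity)
  have hwd_le : ∀ k, w k ≤ d k := fun k => min_le_left _ _
  have hwu : ∀ k, w (k + 1) ≤ K * w k := fun k => by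
    refine min_geometric_le hK0 ((hdu k).trans (by gcongr; exact (hd k).le)) ?_
    rw [pow_succ]
    have : 0 ≤ m * (1 / 2) ^ k := by positivity
    nlinarith
  have hwd : ∀ k, w k ≤ K * w (k + 1) := fun k => by
    refine min_geometric_le hK0 ((hdd k).trans (by gcongr; exact (hd (k + 1)).le)) ?_
    rw [pow_succ]
    have : 0 ≤ m * (1 / 2) ^ k := by positivity
    nlinarith
  have hh0 : ∀ u ∈ Set.Icc s t, 0 ≤ h u := fun u hu => (H.A_nonneg 0 u hu).trans (H.A_le 0 u hu)
  have hρ0 : ∀ u ∈ Set.Icc s t, 0 ≤ ρ u := fun u hu => by simpa using hr u hu 0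
  have hl : IntervalIntegrable (fun u => -((2 * K + 1) * h u)) volume s t :=
    (H.h_int.const_mul _).neg
  have hC0 : 0 ≤ C := (abs_nonneg _).trans (hC s (Set.left_mem_Icc.2 H.le) 0)
  have key := H.weighted_le_of_tendsto_zero (κ := K) (w := w) (ρ := ρ) (V₀ := V₀) (M := m * C)
    hw hwd hl hρ ?_ ?_ ?_ ?_ ?_ n
  · have e1 : ∑ k ∈ Finset.range n, w k * |z k t| = ∑ k ∈ Finset.range n, d k * |z k t| := by
      refine Finset.sum_congr rfl fun k hk => ?_
      have : d k ≤ m * (1 / 2) ^ k := by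
        have h1 : d k * 2 ^ k ≤ m := Finset.single_le_sum
          (f := fun k => d k * 2 ^ k) (fun j _ => by have := hd j; positivity) hk
        calc d k = d k * 2 ^ k * (1 / 2) ^ k := by
              rw [mul_assoc, ← mul_pow]; norm_num
          _ ≤ _ := by gcongr
      rw [hwdef]
      simp only [min_eq_left this]
    rw [e1, intervalIntegral.integral_neg, Real.exp_neg] at key
    have h2 : ∫ u in s..t, Real.exp (∫ v in s..u, -((2 * K + 1) * h v)) * ρ u ≤
        ∫ u in s..t, ρ u := by
      refine intervalIntegral.integral_mono_on H.le ?_ hρ fun u hu => ?_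
      · exact hρ.continuousOn_mul (hl.absolutelyContinuousOnInterval_intervalIntegral
          (c := s) (by simp)).exp.continuousOn
      · refine mul_le_of_le_one_left (hρ0 u hu) (Real.exp_le_one_iff.2 ?_)
        rw [intervalIntegral.integral_neg]
        have := intervalIntegral.integral_nonneg hu.1 (μ := volume)
          (f := fun v => (2 * K + 1) * h v) fun v hv =>
          mul_nonneg (by linarith) (hh0 v ⟨hv.1, hv.2.trans hu.2⟩)
        linarith
    rw [inv_mul_le_iff₀ (Real.exp_pos _)] at key
    refine key.trans ?_
    gcongr
  · intro u hu n
    refine le_trans (Finset.sum_le_sum fun k _ => ?_) (hr u hu n)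
    gcongr
    exact hwd_le k
  · intro u hu k
    left
    have h0 := hh0 u hu
    have h1 : A (k + 1) u * w (k + 1) ≤ h u * (K * w k) :=
      mul_le_mul (H.A_le _ u hu) (hwu k) (hw _) h0
    have h2 : shiftDown (fun j => B j u * w j) k ≤ h u * (K * w k) := by
      cases k with
      | zero => simpa [shiftDown] using mul_nonneg h0 (mul_nonneg hK0 (hw 0))
      | succ j => exact mul_le_mul (H.B_le _ u hu) (hwd j) (hw _) h0
    have h3 : 0 ≤ D k u * w k := mul_nonneg (H.D_nonneg k u hu) (hw k)
    have h4 : 0 ≤ h u * w k := mul_nonneg h0 (hw k)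
    nlinarith
  · intro n
    refine le_trans (Finset.sum_le_sum fun k _ => ?_) (hV n)
    gcongr
    exact hwd_le k
  · intro u hu k
    refine mul_le_mul ((min_le_right _ _).trans ?_) (hC u hu k) (abs_nonneg _) hm0
    exact mul_le_of_le_one_right hm0 (pow_le_one₀ (by norm_num) (by norm_num))
  · intro u hu
    have hg : Tendsto (fun k : ℕ => m * (1 / 2 : ℝ) ^ k * C) atTop (𝓝 (m * 0 * C)) :=
      ((tendsto_pow_atTop_nhds_zero_of_lt_one (by norm_num) (by norm_num)).const_mul m).mul_const C
    rw [mul_zero, zero_mul] at hg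
    refine squeeze_zero (fun k => mul_nonneg (hw k) (abs_nonneg _)) (fun k => ?_) hg
    exact mul_le_mul (min_le_right _ _) (hC u hu k) (abs_nonneg _) (by positivity)

/-- Weighted `ℓ¹` Gronwall estimate for bounded solutions of a tridiagonal system: the logarithmic
norm is controlled by the weighted column sums. -/
theorem IsTridiagonalOn.weighted_le (H : IsTridiagonalOn A D B r h z s t)
    {d : ℕ → ℝ} (hd : ∀ k, 0 < d k) (hdu : ∀ k, d (k + 1) ≤ κ * d k)
    (hdd : ∀ k, d k ≤ κ * d (k + 1))
    (hl : IntervalIntegrable l volume s t) (hρ : IntervalIntegrable ρ volume s t)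
    (hr : ∀ u ∈ Set.Icc s t, ∀ n, ∑ k ∈ Finset.range n, d k * |r k u| ≤ ρ u)
    (hcol : ∀ u ∈ Set.Icc s t, ∀ k, A (k + 1) u * d (k + 1) +
      shiftDown (fun j => B j u * d j) k - D k u * d k ≤ -l u * d k ∨ z k u = 0)
    {V₀ C : ℝ} (hV : ∀ n, ∑ k ∈ Finset.range n, d k * |z k s| ≤ V₀)
    (hC : ∀ u ∈ Set.Icc s t, ∀ k, |z k u| ≤ C) (n : ℕ) :
    Real.exp (∫ v in s..t, l v) * ∑ k ∈ Finset.range n, d k * |z k t| ≤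
      V₀ + ∫ u in s..t, Real.exp (∫ v in s..u, l v) * ρ u := by
  have hh0 : ∀ u ∈ Set.Icc s t, 0 ≤ h u := fun u hu => (H.A_nonneg 0 u hu).trans (H.A_le 0 u hu)
  have hρ0 : ∀ u ∈ Set.Icc s t, 0 ≤ ρ u := fun u hu => by simpa using hr u hu 0
  have hV0 : 0 ≤ V₀ := by simpa using hV 0
  set M := Real.exp (∫ u in s..t, (2 * max κ 2 + 1) * h u) * (V₀ + ∫ u in s..t, ρ u)
  have hbd : ∀ u ∈ Set.Icc s t, ∀ n, ∑ k ∈ Finset.range n, d k * |z k u| ≤ M := by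
    intro u hu n
    have hsub : Set.uIcc s u ⊆ Set.uIcc s t := by
      rw [Set.uIcc_of_le hu.1, Set.uIcc_of_le H.le]; exact Set.Icc_subset_Icc_right hu.2
    have hIcc : ∀ v ∈ Set.Icc s u, v ∈ Set.Icc s t := fun v hv => ⟨hv.1, hv.2.trans hu.2⟩
    refine ((H.mono hu.1 hu.2).weighted_bound hd hdu hdd (hρ.mono_set hsub)
      (fun v hv => hr v (hIcc v hv)) hV (fun v hv => hC v (hIcc v hv)) n).trans ?_
    have hmono : ∀ f : ℝ → ℝ, IntervalIntegrable f volume s t → (∀ v ∈ Set.Icc s t, 0 ≤ f v) →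
        ∫ v in s..u, f v ≤ ∫ v in s..t, f v := fun f hf hf0 => by
      refine intervalIntegral.integral_mono_interval le_rfl hu.1 hu.2 ?_ hf
      exact (ae_restrict_iff' measurableSet_Ioc).2
        (Eventually.of_forall fun v hv => hf0 v ⟨hv.1.le, hv.2⟩)
    have hpos : 0 ≤ ∫ v in s..u, ρ v :=
      intervalIntegral.integral_nonneg hu.1 fun v hv => hρ0 v (hIcc v hv)
    have h1 := hmono ρ hρ hρ0
    have h2 := hmono (fun v => (2 * max κ 2 + 1) * h v) (H.h_int.const_mul _) fun v hv =>
      mul_nonneg (by have := le_max_right κ 2; linarith) (hh0 v hv)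
    exact mul_le_mul (Real.exp_le_exp.2 h2) (by linarith) (by linarith) (Real.exp_pos _).le
  refine H.weighted_le_of_tendsto_zero (κ := κ) (M := M) (fun k => (hd k).le) hdd hl hρ hr hcol hV
    ?_ ?_ n
  · intro u hu k
    refine le_trans ?_ (hbd u hu (k + 1))
    exact Finset.single_le_sum (f := fun k => d k * |z k u|)
      (fun j _ => mul_nonneg (hd j).le (abs_nonneg _)) (Finset.self_mem_range_succ k)
  · intro u hu
    exact (summable_of_sum_range_le (fun k => mul_nonneg (hd k).le (abs_nonneg _))
      (hbd u hu)).tendsto_atTop_zero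

end Weighted

theorem MeasureTheory.LocallyIntegrableOn.intervalIntegrable_of_nonneg {f : ℝ → ℝ}
    (hf : LocallyIntegrableOn f (Set.Ici 0)) {s t : ℝ} (hs : 0 ≤ s) (ht : 0 ≤ t) :
    IntervalIntegrable f volume s t := by
  refine IntegrableOn.intervalIntegrable (hf.integrableOn_compact_subset ?_ isCompact_uIcc)
  intro u hu
  exact (le_min hs ht).trans hu.1

/-- `x` solves the forward system of the birth-death process on `ℕ` with intensities `λ_n a(t)`
and `μ_n b(t)` on `[s, ∞)`. -/
def IsIntegralSolution (lam mu : ℕ → ℝ) (a b : ℝ → ℝ) (s : ℝ) (x : ℝ → ℕ → ℝ) : Prop :=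
  ∀ n : ℕ, ∀ t, s ≤ t →
    IntervalIntegrable (fun u => forwardRHS (fun k => productRate lam a k u)
      (fun k => productRate mu b k u) (x u) n) volume s t ∧
    x t n = x s n + ∫ u in s..t, forwardRHS (fun k => productRate lam a k u)
      (fun k => productRate mu b k u) (x u) n

/-- Nonnegative bounded rates with locally integrable nonnegative time factors. -/
structure IsBoundedRate (lam mu : ℕ → ℝ) (a b : ℝ → ℝ) (K : ℝ) : Prop where
  lam_nonneg : ∀ k, 0 ≤ lam k
  lam_le : ∀ k, lam k ≤ K
  mu_nonneg : ∀ k, 0 ≤ mu k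
  mu_le : ∀ k, mu k ≤ K
  mu_zero : mu 0 = 0
  a_nonneg : ∀ t, 0 ≤ t → 0 ≤ a t
  b_nonneg : ∀ t, 0 ≤ t → 0 ≤ b t
  a_int : LocallyIntegrableOn a (Set.Ici 0)
  b_int : LocallyIntegrableOn b (Set.Ici 0)

theorem forwardRHS_sub (L M x y : ℕ → ℝ) (n : ℕ) :
    forwardRHS L M (x - y) n = forwardRHS L M x n - forwardRHS L M y n := by
  cases n <;> simp [forwardRHS, shiftDown] <;> ring

theorem IsIntegralSolution.sub {lam mu : ℕ → ℝ} {a b : ℝ → ℝ} {s : ℝ} {x y : ℝ → ℕ → ℝ}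
    (hx : IsIntegralSolution lam mu a b s x) (hy : IsIntegralSolution lam mu a b s y) :
    IsIntegralSolution lam mu a b s (fun t => x t - y t) := by
  intro n t ht
  obtain ⟨h1, h2⟩ := hx n t ht
  obtain ⟨h3, h4⟩ := hy n t ht
  simp only [forwardRHS_sub]
  refine ⟨h1.sub h3, ?_⟩
  rw [intervalIntegral.integral_sub h1 h3, Pi.sub_apply, Pi.sub_apply, h2, h4]
  ring

theorem sum_forwardRHS (L M x : ℕ → ℝ) (hM : M 0 = 0) (k : ℕ) :
    ∑ i ∈ Finset.range (k + 1), forwardRHS L M x i = M (k + 1) * x (k + 1) - L k * x k := by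
  induction k with
  | zero => simp [forwardRHS, shiftDown, hM]; ring
  | succ k ih => rw [Finset.sum_range_succ, ih]; simp [forwardRHS, shiftDown]; ring

/-- `∑_{i ≤ k} x_i`. -/
noncomputable def partialSum (x : ℕ → ℝ) (k : ℕ) : ℝ := ∑ i ∈ Finset.range (k + 1), x i

theorem partialSum_succ (x : ℕ → ℝ) (k : ℕ) : partialSum x (k + 1) = partialSum x k + x (k + 1) :=
  Finset.sum_range_succ _ _

theorem shiftDown_partialSum (x : ℕ → ℝ) (k : ℕ) :
    shiftDown (partialSum x) k = partialSum x k - x k := by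
  cases k with
  | zero => simp [shiftDown, partialSum]
  | succ k => rw [partialSum_succ]; simp [shiftDown]

theorem partialSum_sub (x y : ℕ → ℝ) (k : ℕ) :
    partialSum (x - y) k = partialSum x k - partialSum y k := by
  simp [partialSum]

/-- The probability flux from `k + 1` to `k`. -/
noncomputable def flux (lam mu : ℕ → ℝ) (a b : ℝ → ℝ) (x : ℝ → ℕ → ℝ) (k : ℕ) (u : ℝ) : ℝ :=
  mu (k + 1) * b u * x u (k + 1) - lam k * a u * x u k

section

variable {lam mu : ℕ → ℝ} {a b : ℝ → ℝ} {K : ℝ} {s : ℝ} {x : ℝ → ℕ → ℝ}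

theorem IsIntegralSolution.flux_integrable (hx : IsIntegralSolution lam mu a b s x)
    (hmu : mu 0 = 0) (k : ℕ) {t : ℝ} (ht : s ≤ t) :
    IntervalIntegrable (flux lam mu a b x k) volume s t := by
  have h := IntervalIntegrable.sum (Finset.range (k + 1)) fun i _ => (hx i t ht).1
  refine h.congr fun u _ => ?_
  simp only [Finset.sum_apply]
  rw [sum_forwardRHS _ _ _ (by simp [productRate, hmu])]
  simp [productRate, flux]

theorem IsIntegralSolution.partialSum_eq (hx : IsIntegralSolution lam mu a b s x)
    (hmu : mu 0 = 0) (k : ℕ) {t : ℝ} (ht : s ≤ t) :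
    partialSum (x t) k = partialSum (x s) k + ∫ u in s..t, flux lam mu a b x k u := by
  have h : ∫ u in s..t, flux lam mu a b x k u = ∑ i ∈ Finset.range (k + 1),
      ∫ u in s..t, forwardRHS (fun k => productRate lam a k u)
      (fun k => productRate mu b k u) (x u) i := by
    rw [← intervalIntegral.integral_finsetSum fun i _ => (hx i t ht).1]
    refine intervalIntegral.integral_congr fun u _ => ?_
    rw [sum_forwardRHS _ _ _ (by simp [productRate, hmu])]
    simp [productRate, flux]
  rw [h, partialSum, partialSum, ← Finset.sum_add_distrib]
  exact Finset.sum_congr rfl fun i _ => (hx i t ht).2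

theorem IsBoundedRate.h_int (hR : IsBoundedRate lam mu a b K) {s t : ℝ} (hs : 0 ≤ s)
    (ht : 0 ≤ t) : IntervalIntegrable (fun u => K * (a u + b u)) volume s t :=
  ((hR.a_int.intervalIntegrable_of_nonneg hs ht).add
    (hR.b_int.intervalIntegrable_of_nonneg hs ht)).const_mul K

theorem IsBoundedRate.K_nonneg (hR : IsBoundedRate lam mu a b K) : 0 ≤ K :=
  (hR.lam_nonneg 0).trans (hR.lam_le 0)

theorem IsBoundedRate.mul_a_le (hR : IsBoundedRate lam mu a b K) {c u : ℝ} (hc : c ≤ K)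
    (hu : 0 ≤ u) : c * a u ≤ K * (a u + b u) := by
  have := mul_le_mul_of_nonneg_right hc (hR.a_nonneg u hu)
  have := mul_nonneg hR.K_nonneg (hR.b_nonneg u hu)
  linarith

theorem IsBoundedRate.mul_b_le (hR : IsBoundedRate lam mu a b K) {c u : ℝ} (hc : c ≤ K)
    (hu : 0 ≤ u) : c * b u ≤ K * (a u + b u) := by
  have := mul_le_mul_of_nonneg_right hc (hR.b_nonneg u hu)
  have := mul_nonneg hR.K_nonneg (hR.a_nonneg u hu)
  linarith

theorem shiftDown_nonneg {r : ℕ → ℝ} (hr : ∀ k, 0 ≤ r k) (k : ℕ) : 0 ≤ shiftDown r k := by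
  cases k with
  | zero => exact le_rfl
  | succ k => exact hr k

theorem IsIntegralSolution.isTridiagonalOn (hR : IsBoundedRate lam mu a b K)
    (hx : IsIntegralSolution lam mu a b s x) (hs : 0 ≤ s) {t : ℝ} (ht : s ≤ t) :
    IsTridiagonalOn (fun k u => shiftDown lam k * a u) (fun k u => lam k * a u + mu k * b u)
      (fun k u => mu (k + 1) * b u) (fun _ _ => 0) (fun u => K * (a u + b u))
      (fun k u => x u k) s t := by
  have h0 : ∀ u ∈ Set.Icc s t, 0 ≤ u := fun u hu => hs.trans hu.1
  have hrhs : ∀ k u, shiftDown lam k * a u * shiftDown (fun j => x u j) k -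
      (lam k * a u + mu k * b u) * x u k + mu (k + 1) * b u * x u (k + 1) + 0 =
      forwardRHS (fun k => productRate lam a k u) (fun k => productRate mu b k u) (x u) k := by
    intro k u
    cases k <;> simp [forwardRHS, shiftDown, productRate]
  have hle : ∀ k, shiftDown lam k ≤ K := fun k => by
    cases k with
    | zero => exact hR.K_nonneg
    | succ k => exact hR.lam_le k
  exact
  { le := ht
    h_int := hR.h_int hs (hs.trans ht)
    A_nonneg := fun k u hu => mul_nonneg (shiftDown_nonneg hR.lam_nonneg k) (hR.a_nonneg u (h0 u hu))
    A_le := fun k u hu => hR.mul_a_le (hle k) (h0 u hu)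
    B_nonneg := fun k u hu => mul_nonneg (hR.mu_nonneg _) (hR.b_nonneg u (h0 u hu))
    B_le := fun k u hu => hR.mul_b_le (hR.mu_le _) (h0 u hu)
    D_nonneg := fun k u hu => add_nonneg (mul_nonneg (hR.lam_nonneg _) (hR.a_nonneg u (h0 u hu)))
      (mul_nonneg (hR.mu_nonneg _) (hR.b_nonneg u (h0 u hu)))
    rhs_int := fun k => by simpa only [hrhs] using (hx k t ht).1
    eq := fun k u hu => by simpa only [hrhs] using (hx k u hu.1).2 }

/-- The forward flow does not increase the `ℓ¹` norm. -/
theorem IsIntegralSolution.sum_abs_le (hR : IsBoundedRate lam mu a b K)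
    (hx : IsIntegralSolution lam mu a b s x) (hs : 0 ≤ s) {t : ℝ} (ht : s ≤ t)
    {V₀ C : ℝ} (hV : ∀ n, ∑ k ∈ Finset.range n, |x s k| ≤ V₀)
    (hC : ∀ u ∈ Set.Icc s t, ∀ k, |x u k| ≤ C) (n : ℕ) :
    ∑ k ∈ Finset.range n, |x t k| ≤ V₀ := by
  have := (hx.isTridiagonalOn hR hs ht).weighted_le (κ := 1) (d := fun _ => 1) (l := fun _ => 0)
    (ρ := fun _ => 0) (V₀ := V₀) (C := C) (by simp) (by simp) (by simp) (by simp) (by simp)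
    (by simp) (fun u _ k => Or.inl ?_) (by simpa using hV) hC n
  · simpa using this
  · cases k with
    | zero => simp [shiftDown, hR.mu_zero]
    | succ k => simp [shiftDown]

/-- The coefficients of the system for partial sums: any `z` whose increments are integrals of
`λ_k a (z_{k-1} - z_k) + μ_{k+1} b (z_{k+1} - z_k) + r_k`. -/
theorem IsBoundedRate.isTridiagonalOn (hR : IsBoundedRate lam mu a b K) {z r : ℕ → ℝ → ℝ}
    {F : ℕ → ℝ → ℝ} {t τ : ℝ} (hs : 0 ≤ s) (hst : s ≤ t) (hτ : 0 ≤ τ)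
    (hF : ∀ k, IntervalIntegrable (F k) volume s t)
    (hz : ∀ k, ∀ u ∈ Set.Icc s t, z k u = z k s + ∫ v in s..u, F k v)
    (hFr : ∀ k u, F k u = lam k * a (τ + u) * (shiftDown (fun j => z j u) k - z k u) +
      mu (k + 1) * b (τ + u) * (z (k + 1) u - z k u) + r k u) :
    IsTridiagonalOn (fun k u => lam k * a (τ + u))
      (fun k u => lam k * a (τ + u) + mu (k + 1) * b (τ + u))
      (fun k u => mu (k + 1) * b (τ + u)) r (fun u => K * (a (τ + u) + b (τ + u))) z s t := by
  have h0 : ∀ u ∈ Set.Icc s t, 0 ≤ τ + u := fun u hu => add_nonneg hτ (hs.trans hu.1)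
  have hrhs : ∀ k u, lam k * a (τ + u) * shiftDown (fun j => z j u) k -
      (lam k * a (τ + u) + mu (k + 1) * b (τ + u)) * z k u +
      mu (k + 1) * b (τ + u) * z (k + 1) u + r k u = F k u := by
    intro k u; rw [hFr]; ring
  exact
  { le := hst
    h_int := by
      have := (hR.h_int (add_nonneg hτ hs) (add_nonneg hτ (hs.trans hst))).comp_add_left τ
      simpa using this
    A_nonneg := fun k u hu => mul_nonneg (hR.lam_nonneg k) (hR.a_nonneg _ (h0 u hu))
    A_le := fun k u hu => hR.mul_a_le (hR.lam_le k) (h0 u hu)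
    B_nonneg := fun k u hu => mul_nonneg (hR.mu_nonneg _) (hR.b_nonneg _ (h0 u hu))
    B_le := fun k u hu => hR.mul_b_le (hR.mu_le _) (h0 u hu)
    D_nonneg := fun k u hu => add_nonneg (mul_nonneg (hR.lam_nonneg _) (hR.a_nonneg _ (h0 u hu)))
      (mul_nonneg (hR.mu_nonneg _) (hR.b_nonneg _ (h0 u hu)))
    rhs_int := fun k => by simpa only [hrhs] using hF k
    eq := fun k u hu => by simpa only [hrhs] using hz k u hu }

end

/-- A weight sequence `d` with bounded ratios for which the partial-sum system of the birth-death
process contracts at rate `l` in the weighted `ℓ¹` norm over the indices `k < N`. -/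
structure IsContractionWeight (N : ℕ∞) (lam mu : ℕ → ℝ) (a b l : ℝ → ℝ) (d : ℕ → ℝ)
    (κ m₀ : ℝ) : Prop where
  m_pos : 0 < m₀
  m_le : ∀ k, m₀ ≤ d k
  succ_le : ∀ k, d (k + 1) ≤ κ * d k
  le_succ : ∀ k, d k ≤ κ * d (k + 1)
  l_int : LocallyIntegrableOn l (Set.Ici 0)
  column : ∀ k : ℕ, (k : ℕ∞) < N → ∀ u, 0 ≤ u → lam (k + 1) * a u * d (k + 1) +
    shiftDown (fun j => mu (j + 1) * b u * d j) k - (lam k * a u + mu (k + 1) * b u) * d k ≤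
    -l u * d k

theorem IsContractionWeight.pos {N : ℕ∞} {lam mu : ℕ → ℝ} {a b l : ℝ → ℝ} {d : ℕ → ℝ} {κ m₀ : ℝ}
    (hd : IsContractionWeight N lam mu a b l d κ m₀) (k : ℕ) : 0 < d k :=
  hd.m_pos.trans_le (hd.m_le k)

/-- Contraction of differences of partial sums in the weighted `ℓ¹` norm, with sources and a time
shift `τ` in the coefficients. -/
theorem IsContractionWeight.weighted_le {N : ℕ∞} {lam mu : ℕ → ℝ} {a b l : ℝ → ℝ} {d : ℕ → ℝ}
    {κ m₀ K s t τ : ℝ} (hd : IsContractionWeight N lam mu a b l d κ m₀)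
    (hR : IsBoundedRate lam mu a b K) {z r F : ℕ → ℝ → ℝ} {ρ : ℝ → ℝ}
    (hs : 0 ≤ s) (hst : s ≤ t) (hτ : 0 ≤ τ)
    (hF : ∀ k, IntervalIntegrable (F k) volume s t)
    (hz : ∀ k, ∀ u ∈ Set.Icc s t, z k u = z k s + ∫ v in s..u, F k v)
    (hFr : ∀ k u, F k u = lam k * a (τ + u) * (shiftDown (fun j => z j u) k - z k u) +
      mu (k + 1) * b (τ + u) * (z (k + 1) u - z k u) + r k u)
    (hρ : IntervalIntegrable ρ volume s t)
    (hr : ∀ u ∈ Set.Icc s t, ∀ n, ∑ k ∈ Finset.range n, d k * |r k u| ≤ ρ u)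
    (hz0 : ∀ u ∈ Set.Icc s t, ∀ k : ℕ, N ≤ k → z k u = 0)
    {V₀ C : ℝ} (hV : ∀ n, ∑ k ∈ Finset.range n, d k * |z k s| ≤ V₀)
    (hC : ∀ u ∈ Set.Icc s t, ∀ k, |z k u| ≤ C) (n : ℕ) :
    Real.exp (∫ v in s..t, l (τ + v)) * ∑ k ∈ Finset.range n, d k * |z k t| ≤
      V₀ + ∫ u in s..t, Real.exp (∫ v in s..u, l (τ + v)) * ρ u := by
  refine (hR.isTridiagonalOn hs hst hτ hF hz hFr).weighted_le hd.pos hd.succ_le hd.le_succ ?_ hρ hr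
    ?_ hV hC n
  · have := (hd.l_int.intervalIntegrable_of_nonneg (add_nonneg hτ hs)
      (add_nonneg hτ (hs.trans hst))).comp_add_left τ
    simpa using this
  · intro u hu k
    rcases lt_or_ge (k : ℕ∞) N with h | h
    · exact Or.inl (hd.column k h _ (add_nonneg hτ (hs.trans hu.1)))
    · exact Or.inr (hz0 u hu k h)

theorem flux_eq (lam mu : ℕ → ℝ) (a b : ℝ → ℝ) (x : ℝ → ℕ → ℝ) (k : ℕ) (u : ℝ) :
    flux lam mu a b x k u =
      lam k * a u * (shiftDown (partialSum (x u)) k - partialSum (x u) k) +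
      mu (k + 1) * b u * (partialSum (x u) (k + 1) - partialSum (x u) k) := by
  rw [shiftDown_partialSum, partialSum_succ, flux]
  ring

theorem IsContractionWeight.partialSum_le {N : ℕ∞} {lam mu : ℕ → ℝ} {a b l : ℝ → ℝ} {d : ℕ → ℝ}
    {κ m₀ K s t : ℝ} (hd : IsContractionWeight N lam mu a b l d κ m₀)
    (hR : IsBoundedRate lam mu a b K) {x : ℝ → ℕ → ℝ} (hx : IsIntegralSolution lam mu a b s x)
    (hs : 0 ≤ s) (hst : s ≤ t)
    (hz0 : ∀ u ∈ Set.Icc s t, ∀ k : ℕ, N ≤ k → partialSum (x u) k = 0)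
    {V₀ C : ℝ} (hV : ∀ n, ∑ k ∈ Finset.range n, d k * |partialSum (x s) k| ≤ V₀)
    (hC : ∀ u ∈ Set.Icc s t, ∀ k, |partialSum (x u) k| ≤ C) (n : ℕ) :
    ∑ k ∈ Finset.range n, d k * |partialSum (x t) k| ≤ Real.exp (-∫ v in s..t, l v) * V₀ := by
  have := hd.weighted_le (τ := 0) (z := fun k u => partialSum (x u) k)
    (F := flux lam mu a b x) (r := fun _ _ => 0) (ρ := fun _ => 0) hR hs hst le_rfl
    (fun k => hx.flux_integrable hR.mu_zero k hst)
    (fun k u hu => hx.partialSum_eq hR.mu_zero k hu.1)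
    (fun k u => by rw [flux_eq]; simp) (by simp) (by simp) hz0 hV hC n
  simp only [zero_add, mul_zero, intervalIntegral.integral_zero, add_zero] at this
  rwa [Real.exp_neg, le_inv_mul_iff₀ (Real.exp_pos _)]

theorem AbsolutelyContinuousOnInterval.fun_pow {f : ℝ → ℝ} {s t : ℝ}
    (hf : AbsolutelyContinuousOnInterval f s t) (m : ℕ) :
    AbsolutelyContinuousOnInterval (fun x => f x ^ m) s t := by
  induction m with
  | zero => simpa using AbsolutelyContinuousOnInterval.const 1 s t
  | succ m ih => simpa only [pow_succ] using ih.fun_mul hf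

theorem integral_mul_integral_pow {h : ℝ → ℝ} {s t : ℝ} (hst : s ≤ t)
    (hh : IntervalIntegrable h volume s t) (m : ℕ) :
    ∫ u in s..t, h u * (∫ v in s..u, h v) ^ m = (∫ v in s..t, h v) ^ (m + 1) / (m + 1) := by
  have hH := hh.absolutelyContinuousOnInterval_intervalIntegral (c := s) (by simp)
  have h1 := (hH.fun_pow (m + 1)).integral_deriv_eq_sub
  simp only [intervalIntegral.integral_same, ne_eq, Nat.succ_ne_zero, not_false_eq_true, zero_pow,
    sub_zero] at h1
  rw [← h1, eq_div_iff (by positivity), ← intervalIntegral.integral_mul_const]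
  refine intervalIntegral.integral_congr_ae ?_
  filter_upwards [ae_hasDerivAt_of_integral_eq (z := fun u => ∫ v in s..u, h v) hst hh (by simp)]
    with u hu hmem
  rw [((hu hmem).fun_pow (m + 1)).deriv]
  push_cast
  ring

theorem forwardRHS_hasSum {L M : ℕ → ℝ} {y : ℕ → ℕ → ℝ} {x : ℕ → ℝ}
    (h : ∀ n, HasSum (fun m => y m n) (x n)) (n : ℕ) :
    HasSum (fun m => forwardRHS L M (y m) n) (forwardRHS L M x n) := by
  have h1 : HasSum (fun m => shiftDown (fun k => L k * y m k) n)
      (shiftDown (fun k => L k * x k) n) := by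
    cases n with
    | zero => exact hasSum_zero
    | succ n => exact (h n).mul_left _
  exact (h1.sub ((h n).mul_left _)).add ((h (n + 1)).mul_left _)

section

variable {lam mu : ℕ → ℝ} {a b : ℝ → ℝ} {K : ℝ}

theorem IsBoundedRate.abs_forwardRHS_le (hR : IsBoundedRate lam mu a b K) {u : ℝ} (hu : 0 ≤ u)
    {y : ℕ → ℝ} {X : ℝ} (hy : ∀ n, |y n| ≤ X) (n : ℕ) :
    |forwardRHS (fun k => productRate lam a k u) (fun k => productRate mu b k u) y n| ≤
      2 * (K * (a u + b u)) * X := by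
  have ha := hR.a_nonneg u hu
  have hb := hR.b_nonneg u hu
  have hl : ∀ k, |lam k * a u * y n| ≤ K * a u * X := fun k => by
    rw [abs_mul, abs_of_nonneg (mul_nonneg (hR.lam_nonneg k) ha)]
    exact mul_le_mul (mul_le_mul_of_nonneg_right (hR.lam_le k) ha) (hy n) (abs_nonneg _)
      (mul_nonneg hR.K_nonneg ha)
  have hm : ∀ k j, |mu k * b u * y j| ≤ K * b u * X := fun k j => by
    rw [abs_mul, abs_of_nonneg (mul_nonneg (hR.mu_nonneg k) hb)]
    exact mul_le_mul (mul_le_mul_of_nonneg_right (hR.mu_le k) hb) (hy j) (abs_nonneg _)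
      (mul_nonneg hR.K_nonneg hb)
  have hs : |shiftDown (fun k => lam k * a u * y k) n| ≤ K * a u * X := by
    cases n with
    | zero =>
      simpa [shiftDown] using mul_nonneg (mul_nonneg hR.K_nonneg ha) ((abs_nonneg _).trans (hy 0))
    | succ n =>
      simp only [shiftDown]
      rw [abs_mul, abs_of_nonneg (mul_nonneg (hR.lam_nonneg _) ha)]
      exact mul_le_mul (mul_le_mul_of_nonneg_right (hR.lam_le _) ha) (hy _) (abs_nonneg _)
        (mul_nonneg hR.K_nonneg ha)
  have e1 := abs_le.1 hs
  have e2 := abs_le.1 (hl n)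
  have e3 := abs_le.1 (hm n n)
  have e4 := abs_le.1 (hm (n + 1) (n + 1))
  simp only [forwardRHS, productRate]
  rw [abs_le]
  constructor <;> nlinarith

theorem IsBoundedRate.forwardRHS_integrable (hR : IsBoundedRate lam mu a b K) {s t : ℝ}
    (hs : 0 ≤ s) (ht : 0 ≤ t) {y : ℝ → ℕ → ℝ}
    (hy : ∀ n, ContinuousOn (fun u => y u n) (Set.uIcc s t)) (n : ℕ) :
    IntervalIntegrable (fun u => forwardRHS (fun k => productRate lam a k u)
      (fun k => productRate mu b k u) (y u) n) volume s t := by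
  have ha := hR.a_int.intervalIntegrable_of_nonneg hs ht
  have hb := hR.b_int.intervalIntegrable_of_nonneg hs ht
  have h1 : IntervalIntegrable (fun u => shiftDown (fun k => productRate lam a k u * y u k) n)
      volume s t := by
    cases n with
    | zero => simp [shiftDown]
    | succ n => exact (ha.const_mul _).mul_continuousOn (hy n)
  exact (h1.sub (((ha.const_mul (lam n)).add (hb.const_mul (mu n))).mul_continuousOn (hy n))).add
    ((hb.const_mul (mu (n + 1))).mul_continuousOn (hy (n + 1)))

/-- The terms of the Picard series of the forward system started at time `0`. -/
noncomputable def picardTerm (lam mu : ℕ → ℝ) (a b : ℝ → ℝ) (x₀ : ℕ → ℝ) : ℕ → ℝ → ℕ → ℝ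
  | 0 => fun _ => x₀
  | m + 1 => fun t n => ∫ u in (0 : ℝ)..t, forwardRHS (fun k => productRate lam a k u)
      (fun k => productRate mu b k u) (picardTerm lam mu a b x₀ m u) n

theorem IsBoundedRate.picardTerm_continuousOn (hR : IsBoundedRate lam mu a b K) (x₀ : ℕ → ℝ)
    (m : ℕ) {t : ℝ} (ht : 0 ≤ t) (n : ℕ) :
    ContinuousOn (fun u => picardTerm lam mu a b x₀ m u n) (Set.uIcc 0 t) := by
  induction m generalizing n with
  | zero => exact continuousOn_const
  | succ m ih =>
    exact ((hR.forwardRHS_integrable le_rfl ht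
      ih n).absolutelyContinuousOnInterval_intervalIntegral (c := 0) (by simp)).continuousOn

theorem IsBoundedRate.abs_picardTerm_le (hR : IsBoundedRate lam mu a b K) {x₀ : ℕ → ℝ} {X : ℝ}
    (hX : ∀ n, |x₀ n| ≤ X) (m : ℕ) {t : ℝ} (ht : 0 ≤ t) (n : ℕ) :
    |picardTerm lam mu a b x₀ m t n| ≤
      X * ((∫ u in (0 : ℝ)..t, 2 * (K * (a u + b u))) ^ m / m.factorial) := by
  induction m generalizing t n with
  | zero => simpa [picardTerm] using hX n
  | succ m ih =>
    have hh := (hR.h_int le_rfl ht).const_mul 2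
    have hc := hR.forwardRHS_integrable le_rfl ht
      (fun n => hR.picardTerm_continuousOn x₀ m ht n) n
    have hHc := (hh.absolutelyContinuousOnInterval_intervalIntegral (c := 0) (by simp)).continuousOn
    simp only [picardTerm]
    calc |∫ u in (0 : ℝ)..t, forwardRHS (fun k => productRate lam a k u)
          (fun k => productRate mu b k u) (picardTerm lam mu a b x₀ m u) n|
        ≤ ∫ u in (0 : ℝ)..t, |forwardRHS (fun k => productRate lam a k u)
          (fun k => productRate mu b k u) (picardTerm lam mu a b x₀ m u) n| :=
          intervalIntegral.abs_integral_le_integral_abs ht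
      _ ≤ ∫ u in (0 : ℝ)..t, X / m.factorial * (2 * (K * (a u + b u)) *
          (∫ v in (0 : ℝ)..u, 2 * (K * (a v + b v))) ^ m) := by
          refine intervalIntegral.integral_mono_on ht hc.abs
            ((hh.mul_continuousOn (hHc.pow m)).const_mul _) fun u hu => ?_
          refine (hR.abs_forwardRHS_le hu.1 (fun n => ih hu.1 n) n).trans_eq ?_
          ring
      _ = _ := by
          rw [intervalIntegral.integral_const_mul, integral_mul_integral_pow ht hh,
            Nat.factorial_succ]
          push_cast
          field_simp

/-- Existence of a locally bounded solution of the forward system, by the Picard series. -/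
theorem IsBoundedRate.exists_integralSolution (hR : IsBoundedRate lam mu a b K) {x₀ : ℕ → ℝ}
    {X : ℝ} (hX : ∀ n, |x₀ n| ≤ X) :
    ∃ x : ℝ → ℕ → ℝ, IsIntegralSolution lam mu a b 0 x ∧ x 0 = x₀ ∧
      ∀ T, 0 ≤ T → ∃ C, ∀ u ∈ Set.Icc 0 T, ∀ k, |x u k| ≤ C := by
  set H : ℝ → ℝ := fun t => ∫ u in (0 : ℝ)..t, 2 * (K * (a u + b u)) with hHdef
  have hX0 : 0 ≤ X := (abs_nonneg _).trans (hX 0)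
  have hh0 : ∀ u, 0 ≤ u → 0 ≤ 2 * (K * (a u + b u)) := fun u hu =>
    mul_nonneg (by norm_num) (mul_nonneg hR.K_nonneg (add_nonneg (hR.a_nonneg u hu)
      (hR.b_nonneg u hu)))
  have hHmono : ∀ u t, 0 ≤ u → u ≤ t → H u ≤ H t := fun u t hu hut => by
    refine intervalIntegral.integral_mono_interval le_rfl hu hut ?_
      ((hR.h_int le_rfl (hu.trans hut)).const_mul 2)
    exact (ae_restrict_iff' measurableSet_Ioc).2
      (Eventually.of_forall fun v hv => hh0 v hv.1.le)
  have hH0 : ∀ u, 0 ≤ u → 0 ≤ H u := fun u hu =>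
    intervalIntegral.integral_nonneg hu fun v hv => hh0 v hv.1
  set P := picardTerm lam mu a b x₀
  have hPle : ∀ T u, 0 ≤ u → u ≤ T → ∀ n m, |P m u n| ≤ X * (H T ^ m / m.factorial) :=
    fun T u hu huT n m => (hR.abs_picardTerm_le hX m hu n).trans (by
      have h1 := hHmono u T hu huT
      have h2 := hH0 u hu
      gcongr)
  have hsumm : ∀ T, Summable fun m : ℕ => X * (H T ^ m / m.factorial) := fun T =>
    (Real.summable_pow_div_factorial (H T)).mul_left X
  have hsum : ∀ u, 0 ≤ u → ∀ n, HasSum (fun m => P m u n) (∑' m, P m u n) := fun u hu n =>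
    (Summable.of_norm_bounded (hsumm u) fun m => by
      simpa [Real.norm_eq_abs] using hPle u u hu le_rfl n m).hasSum
  set x : ℝ → ℕ → ℝ := fun t n => ∑' m, P m t n with hxdef
  have hmain : ∀ t, 0 ≤ t → ∀ n, IntervalIntegrable (fun u => forwardRHS
      (fun k => productRate lam a k u) (fun k => productRate mu b k u) (x u) n) volume 0 t ∧
      x t n = x₀ n + ∫ u in (0 : ℝ)..t, forwardRHS (fun k => productRate lam a k u)
      (fun k => productRate mu b k u) (x u) n := by
    intro t ht n
    have hIoc : ∀ u ∈ Set.uIoc 0 t, 0 ≤ u ∧ u ≤ t := fun u hu => by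
      rw [Set.uIoc_of_le ht] at hu; exact ⟨hu.1.le, hu.2⟩
    have hrhs : ∀ m, IntervalIntegrable (fun u => forwardRHS (fun k => productRate lam a k u)
        (fun k => productRate mu b k u) (P m u) n) volume 0 t := fun m =>
      hR.forwardRHS_integrable le_rfl ht (fun n => hR.picardTerm_continuousOn x₀ m ht n) n
    have hI := intervalIntegral.hasSum_integral_of_dominated_convergence (a := 0) (b := t)
      (μ := volume) (F := fun m u => forwardRHS (fun k => productRate lam a k u)
        (fun k => productRate mu b k u) (P m u) n)
      (f := fun u => forwardRHS (fun k => productRate lam a k u)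
        (fun k => productRate mu b k u) (x u) n)
      (fun m u => 2 * (K * (a u + b u)) * (X * (H t ^ m / m.factorial)))
      (fun m => (hrhs m).def'.aestronglyMeasurable)
      (fun m => Eventually.of_forall fun u hu => by
        rw [Real.norm_eq_abs]
        exact hR.abs_forwardRHS_le (hIoc u hu).1
          (fun k => hPle t u (hIoc u hu).1 (hIoc u hu).2 k m) n)
      (Eventually.of_forall fun u _ => (hsumm t).mul_left _)
      (by
        simp only [tsum_mul_left]
        exact ((hR.h_int le_rfl ht).const_mul 2).mul_const _)
      (Eventually.of_forall fun u hu => forwardRHS_hasSum (hsum u (hIoc u hu).1) n)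
    constructor
    · have hc : ∀ k, ContinuousOn (fun u => x u k) (Set.uIcc 0 t) := fun k => by
        refine continuousOn_tsum (fun m => hR.picardTerm_continuousOn x₀ m ht k) (hsumm t) ?_
        intro m u hu
        rw [Set.uIcc_of_le ht] at hu
        simpa [Real.norm_eq_abs] using hPle t u hu.1 hu.2 k m
      exact hR.forwardRHS_integrable le_rfl ht hc n
    · have h1 := (hasSum_nat_add_iff' (f := fun m => P m t n) 1).2 (hsum t ht n)
      have h2 : (fun m => P (m + 1) t n) = fun m => ∫ u in (0 : ℝ)..t, forwardRHS
          (fun k => productRate lam a k u) (fun k => productRate mu b k u) (P m u) n := rfl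
      rw [h2] at h1
      have h3 := h1.unique hI
      rw [← h3]
      simp [P, picardTerm, x]
  have hx0 : x 0 = x₀ := by
    funext n
    simpa using (hmain 0 le_rfl n).2
  refine ⟨x, fun n t ht => ?_, hx0, fun T hT => ⟨∑' m : ℕ, X * (H T ^ m / m.factorial), ?_⟩⟩
  · rw [hx0]; exact hmain t ht n
  · intro u hu k
    have := tsum_of_norm_bounded (hsumm T).hasSum (f := fun m => P m u k) fun m => by
      simpa [Real.norm_eq_abs] using hPle T u hu.1 hu.2 k m
    simpa [Real.norm_eq_abs] using this

theorem IsIntegralSolution.tendsto_partialSum {s : ℝ} {x : ℝ → ℕ → ℝ}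
    (hR : IsBoundedRate lam mu a b K) (hx : IsIntegralSolution lam mu a b s x) (hs : 0 ≤ s)
    {t V S : ℝ} (ht : s ≤ t) (hV : ∀ u ∈ Set.Icc s t, ∀ n, ∑ k ∈ Finset.range n, |x u k| ≤ V)
    (hS : Tendsto (partialSum (x s)) atTop (𝓝 S)) :
    Tendsto (partialSum (x t)) atTop (𝓝 S) := by
  have hIoc : ∀ u ∈ Set.uIoc s t, u ∈ Set.Icc s t := fun u hu => by
    rw [Set.uIoc_of_le ht] at hu; exact ⟨hu.1.le, hu.2⟩
  have hxle : ∀ u ∈ Set.Icc s t, ∀ k, |x u k| ≤ V := fun u hu k =>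
    (Finset.single_le_sum (f := fun k => |x u k|) (fun j _ => abs_nonneg _)
      (Finset.self_mem_range_succ k)).trans (hV u hu (k + 1))
  have hx0 : ∀ u ∈ Set.Icc s t, Tendsto (x u) atTop (𝓝 0) := fun u hu =>
    (summable_of_sum_range_le (fun k => abs_nonneg (x u k))
      (hV u hu)).of_abs.tendsto_atTop_zero
  have hfl : ∀ u ∈ Set.Icc s t, ∀ k,
      |flux lam mu a b x k u| ≤ K * b u * |x u (k + 1)| + K * a u * |x u k| := by
    intro u hu k
    have ha := hR.a_nonneg u (hs.trans hu.1)
    have hb := hR.b_nonneg u (hs.trans hu.1)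
    refine (abs_sub _ _).trans ?_
    rw [abs_mul (_ * _) (x u (k + 1)), abs_mul (_ * _) (x u k),
      abs_of_nonneg (mul_nonneg (hR.mu_nonneg _) hb),
      abs_of_nonneg (mul_nonneg (hR.lam_nonneg _) ha)]
    gcongr
    · exact hR.mu_le _
    · exact hR.lam_le _
  have hT : Tendsto (fun k => ∫ u in s..t, flux lam mu a b x k u) atTop
      (𝓝 (∫ u in s..t, (0 : ℝ))) := by
    refine intervalIntegral.tendsto_integral_filter_of_dominated_convergence
      (fun u => K * (a u + b u) * V) ?_ ?_ ?_ ?_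
    · exact Eventually.of_forall fun k =>
        (hx.flux_integrable hR.mu_zero k ht).def'.aestronglyMeasurable
    · refine Eventually.of_forall fun k => Eventually.of_forall fun u hu => ?_
      have hu' := hIoc u hu
      have ha := hR.a_nonneg u (hs.trans hu'.1)
      have hb := hR.b_nonneg u (hs.trans hu'.1)
      have h1 := mul_le_mul_of_nonneg_left (hxle u hu' (k + 1)) (mul_nonneg hR.K_nonneg hb)
      have h2 := mul_le_mul_of_nonneg_left (hxle u hu' k) (mul_nonneg hR.K_nonneg ha)
      rw [Real.norm_eq_abs]
      linarith [hfl u hu' k]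
    · exact (hR.h_int hs (hs.trans ht)).mul_const V
    · refine Eventually.of_forall fun u hu => ?_
      have hu' := hIoc u hu
      have h0 := (hx0 u hu').abs
      have h2 : Tendsto (fun k => K * b u * |x u (k + 1)| + K * a u * |x u k|) atTop
          (𝓝 (K * b u * |0| + K * a u * |0|)) :=
        ((h0.comp (tendsto_add_atTop_nat 1)).const_mul _).add (h0.const_mul _)
      simp only [abs_zero, mul_zero, add_zero] at h2
      exact squeeze_zero_norm (fun k => by simpa using hfl u hu' k) h2
  have h2 := hS.add hT
  rw [intervalIntegral.integral_zero, add_zero] at h2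
  refine h2.congr fun k => ?_
  exact (hx.partialSum_eq hR.mu_zero k ht).symm

theorem nonneg_and_hasSum_of_sum_abs_le {x : ℕ → ℝ}
    (hV : ∀ n, ∑ k ∈ Finset.range n, |x k| ≤ 1)
    (hS : Tendsto (partialSum x) atTop (𝓝 1)) : (∀ n, 0 ≤ x n) ∧ HasSum x 1 := by
  have hsa : Summable fun k => |x k| := summable_of_sum_range_le (fun k => abs_nonneg (x k)) hV
  have hs : HasSum x 1 := by
    have h1 := hsa.of_abs.hasSum
    have h2 := (h1.tendsto_sum_nat.comp (tendsto_add_atTop_nat 1))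
    rwa [tendsto_nhds_unique h2 hS] at h1
  refine ⟨fun n => ?_, hs⟩
  have h3 : ∑' k, |x k| ≤ 1 := hsa.tsum_le_of_sum_range_le hV
  have h4 := hsa.hasSum.sub hs
  have h5 : |x n| - x n ≤ ∑' k, |x k| - 1 :=
    le_hasSum h4 n fun j _ => sub_nonneg.2 (le_abs_self _)
  have h6 := abs_nonneg (x n)
  linarith

/-- Existence of state probabilities with a prescribed initial distribution. -/
theorem IsBoundedRate.exists_forwardSolution (hR : IsBoundedRate lam mu a b K) {x₀ : ℕ → ℝ}
    {N : ℕ∞} (hx₀ : x₀ ∈ probVectors N) (hlam : ∀ k : ℕ, N ≤ k → lam k = 0)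
    (hmu : ∀ k : ℕ, N < k → mu k = 0) :
    ∃ x : ℝ → ℕ → ℝ, (∀ t, 0 ≤ t → x t ∈ probVectors N) ∧ IsIntegralSolution lam mu a b 0 x ∧
      x 0 = x₀ := by
  obtain ⟨h0, h1, h2⟩ := hx₀
  have hle : ∀ n, |x₀ n| ≤ 1 := fun n => by
    rw [abs_of_nonneg (h0 n)]
    exact le_hasSum h1 n fun j _ => h0 j
  obtain ⟨x, hx, hx0, hbd⟩ := hR.exists_integralSolution hle
  have hV0 : ∀ n, ∑ k ∈ Finset.range n, |x 0 k| ≤ 1 := fun n => by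
    rw [hx0]
    simp only [abs_of_nonneg (h0 _)]
    exact sum_le_hasSum _ (fun j _ => h0 j) h1
  have hV : ∀ t, 0 ≤ t → ∀ n, ∑ k ∈ Finset.range n, |x t k| ≤ 1 := fun t ht n => by
    obtain ⟨C, hC⟩ := hbd t ht
    exact hx.sum_abs_le hR le_rfl ht hV0 hC n
  have hS : ∀ t, 0 ≤ t → Tendsto (partialSum (x t)) atTop (𝓝 1) := fun t ht => by
    refine hx.tendsto_partialSum hR le_rfl ht (fun u hu => hV u hu.1) ?_
    rw [hx0]
    exact h1.tendsto_sum_nat.comp (tendsto_add_atTop_nat 1)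
  refine ⟨x, fun t ht => ?_, hx, hx0⟩
  obtain ⟨h3, h4⟩ := nonneg_and_hasSum_of_sum_abs_le (hV t ht) (hS t ht)
  refine ⟨h3, h4, fun n hn => ?_⟩
  have hz : ∀ u, forwardRHS (fun k => productRate lam a k u) (fun k => productRate mu b k u)
      (x u) n = 0 := fun u => by
    have hm1 : mu n = 0 := hmu n hn
    have hm2 : mu (n + 1) = 0 := hmu _ (hn.trans (by exact_mod_cast Nat.lt_succ_self n))
    have hl1 : lam n = 0 := hlam n hn.le
    cases n with
    | zero => simp [forwardRHS, shiftDown, productRate, hl1, hm2, hm1]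
    | succ n =>
      have hl2 : lam n = 0 := hlam n (by
        rw [Nat.cast_succ] at hn
        exact Order.le_of_lt_add_one hn)
      simp [forwardRHS, shiftDown, productRate, hl1, hm2, hm1, hl2]
  rw [(hx n t ht).2, hx0, h2 n hn]
  simp [hz]

end

/-- Translation is continuous in `L¹`. -/
theorem tendsto_integral_abs_translate_sub {B : ℝ → ℝ} (hB : Integrable B) :
    Tendsto (fun ζ : ℝ => ∫ w, |B (w + ζ) - B w|) (𝓝 0) (𝓝 0) := by
  have hmp : ∀ ζ : ℝ, MeasurePreserving (fun w : ℝ => w + ζ) volume volume :=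
    fun ζ => measurePreserving_add_right volume ζ
  let g : ℝ → C(ℝ, ℝ) := fun ζ => (ContinuousMap.mk (fun p : ℝ × ℝ => p.2 + p.1)
    (by fun_prop)).curry ζ
  have hg : Continuous g := ContinuousMap.continuous _
  have hm : ∀ ζ, MeasurePreserving (g ζ) volume volume := hmp
  let f := hB.toL1 B
  have hc : Continuous fun ζ => Lp.compMeasurePreserving (g ζ) (hm ζ) f :=
    continuous_const.compMeasurePreservingLp hg hm ENNReal.one_ne_top
  have h1 := (hc.tendsto 0).dist (tendsto_const_nhds (x := f))
  have h0 : Lp.compMeasurePreserving (g 0) (hm 0) f = f := by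
    apply Lp.ext
    filter_upwards [Lp.coeFn_compMeasurePreserving f (hm 0)] with w hw
    rw [hw]; simp [g]
  rw [h0, dist_self] at h1
  refine h1.congr fun ζ => ?_
  rw [dist_eq_norm, L1.norm_eq_integral_norm]
  refine integral_congr_ae ?_
  have e1 := hB.coeFn_toL1
  have e2 := (hm ζ).quasiMeasurePreserving.ae_eq_comp e1
  filter_upwards [Lp.coeFn_sub (Lp.compMeasurePreserving (g ζ) (hm ζ) f) f,
    Lp.coeFn_compMeasurePreserving f (hm ζ), e1, e2] with w h1 h2 h3 h4
  rw [h1, Pi.sub_apply, h2, Real.norm_eq_abs]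
  have h4' : (f : ℝ → ℝ) (g ζ w) = B (w + ζ) := h4
  rw [Function.comp_apply, h4', h3]

theorem IsAsymptoticallyPeriodic.exists_periodic {a a₁ a₂ : ℝ → ℝ} {T : ℝ}
    (h : IsAsymptoticallyPeriodic a a₁ a₂ T) (ha : LocallyIntegrableOn a (Set.Ici 0)) :
    ∃ α : ℝ → ℝ, Function.Periodic α T ∧ (∀ s t, IntervalIntegrable α volume s t) ∧
      Tendsto (fun t => a t - α t) atTop (𝓝 0) ∧ periodMean a₁ T = (1 / T) * ∫ u in (0 : ℝ)..T, α u := by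
  have hT := h.period_pos
  have hper : ∀ (n : ℕ) t, 0 ≤ t → a₁ (t + n * T) = a₁ t := by
    intro n
    induction n with
    | zero => simp
    | succ n ih =>
      intro t ht
      have := h.periodic (t + n * T) (by positivity)
      rw [ih t ht] at this
      rw [← this]; push_cast; ring_nf
  set α : ℝ → ℝ := fun t => a₁ (Int.fract (t / T) * T) with hα
  have hαa : ∀ t, 0 ≤ t → α t = a₁ t := by
    intro t ht
    have h1 := hper ⌊t / T⌋₊ (Int.fract (t / T) * T) (mul_nonneg (Int.fract_nonneg _) hT.le)
    rw [hα]
    simp only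
    rw [← h1, ← add_mul]
    congr 1
    have h2 : ((⌊t / T⌋₊ : ℕ) : ℝ) = (⌊t / T⌋ : ℝ) := by
      rw [← natCast_floor_eq_intCast_floor (div_nonneg ht hT.le)]
    rw [h2, Int.fract_add_floor, div_mul_cancel₀ _ hT.ne']
  have hαper : Function.Periodic α T := fun t => by
    simp only [hα, add_div, div_self hT.ne', Int.fract_add_one]
  have haα : ∀ t, 0 ≤ t → a t - α t = a₂ t := fun t ht => by
    rw [hαa t ht, h.decomp t ht]; ring
  have hlim : Tendsto (fun t => a t - α t) atTop (𝓝 0) := by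
    refine h.vanishing.congr' ?_
    filter_upwards [eventually_ge_atTop 0] with t ht
    exact (haα t ht).symm
  have hshift : ∀ (n : ℕ) t, α (t + n * T) = α t := fun n t => hαper.nat_mul n t
  have hint : IntervalIntegrable α volume 0 T := by
    have hai : ∀ n : ℕ, IntervalIntegrable (fun t => a (t + n * T)) volume 0 T := fun n => by
      have := (ha.intervalIntegrable_of_nonneg (s := n * T) (t := T + n * T) (by positivity)
        (by positivity)).comp_add_right (n * T)
      simpa using this
    rw [intervalIntegrable_iff]
    have hmeas : AEStronglyMeasurable α (volume.restrict (Set.uIoc 0 T)) := by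
      refine aestronglyMeasurable_of_tendsto_ae atTop
        (fun n => (hai n).def'.aestronglyMeasurable) (Eventually.of_forall fun t => ?_)
      have h1 : Tendsto (fun n : ℕ => t + n * T) atTop atTop :=
        tendsto_atTop_add_const_left _ _ (tendsto_natCast_atTop_atTop.atTop_mul_const hT)
      have h2 := (hlim.comp h1).add_const (α t)
      rw [zero_add] at h2
      refine h2.congr fun n => ?_
      simp only [Function.comp_apply, hshift]
      ring
    obtain ⟨W, hW⟩ := eventually_atTop.1 (hlim.eventually (Metric.ball_mem_nhds 0 one_pos))
    obtain ⟨n, hn⟩ := exists_nat_ge (W / T)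
    have hn' : W ≤ n * T := (div_le_iff₀ hT).1 hn
    refine Integrable.mono' ((hai n).def'.norm.add (intervalIntegrable_const (c := (1 : ℝ))).def') hmeas ?_
    refine (ae_restrict_iff' measurableSet_uIoc).2 (Eventually.of_forall fun t ht => ?_)
    rw [Set.uIoc_of_le hT.le] at ht
    have h1 := hW (t + n * T) (by linarith [ht.1])
    rw [dist_zero_right, hshift] at h1
    have h2 := norm_sub_norm_le (α t) (a (t + n * T))
    rw [norm_sub_rev] at h2
    simp only [Pi.add_apply]
    linarith
  refine ⟨α, hαper, fun s t => hαper.intervalIntegrable₀ hT.ne' hint s t, hlim, ?_⟩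
  rw [periodMean]
  congr 1
  refine intervalIntegral.integral_congr fun u hu => ?_
  rw [Set.uIcc_of_le hT.le] at hu
  exact (hαa u hu.1).symm

/-- The means of an asymptotically periodic function over long windows. -/
theorem exists_abs_integral_sub_mean_le {a α : ℝ → ℝ} {T : ℝ} (hT : 0 < T)
    (ha : LocallyIntegrableOn a (Set.Ici 0)) (hα : Function.Periodic α T)
    (hαi : ∀ s t, IntervalIntegrable α volume s t) (hlim : Tendsto (fun t => a t - α t) atTop (𝓝 0))
    {ε : ℝ} (hε : 0 < ε) :
    ∃ C, ∀ v u, 0 ≤ v → v ≤ u →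
      |(∫ w in v..u, a w) - (1 / T * ∫ w in (0 : ℝ)..T, α w) * (u - v)| ≤ ε * (u - v) + C := by
  set m := 1 / T * ∫ w in (0 : ℝ)..T, α w with hm
  set Φ : ℝ → ℝ := fun t => (∫ w in (0 : ℝ)..t, α w) - m * t with hΦ
  have hΦper : Function.Periodic Φ T := fun t => by
    simp only [hΦ]
    rw [← intervalIntegral.integral_add_adjacent_intervals (hαi 0 t) (hαi t (t + T)),
      hα.intervalIntegral_add_eq t 0, zero_add, hm]
    field_simp
    ring
  have hΦc : Continuous Φ :=
    (intervalIntegral.continuous_primitive hαi 0).sub (continuous_const.mul continuous_id)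
  obtain ⟨C₁, hC₁⟩ := (hΦper.isBounded_of_continuous hT.ne' hΦc).exists_norm_le
  have hC₁' : ∀ t, |Φ t| ≤ C₁ := fun t => hC₁ _ (Set.mem_range_self t)
  obtain ⟨W, hW⟩ := eventually_atTop.1 (hlim.eventually (Metric.ball_mem_nhds 0 hε))
  set W' := max W 0
  have hai : ∀ s t, 0 ≤ s → 0 ≤ t → IntervalIntegrable (fun w => |a w - α w|) volume s t :=
    fun s t hs ht => ((ha.intervalIntegrable_of_nonneg hs ht).sub (hαi s t)).abs
  set C₂ := ∫ w in (0 : ℝ)..W', |a w - α w|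
  have hC₂ : 0 ≤ C₂ := intervalIntegral.integral_nonneg (le_max_right _ _) fun w _ => abs_nonneg _
  have hG : ∀ v u, 0 ≤ v → v ≤ u → ∫ w in v..u, |a w - α w| ≤ ε * (u - v) + C₂ := by
    intro v u hv hvu
    have hu : 0 ≤ u := hv.trans hvu
    have hfar : ∀ p q, W' ≤ p → p ≤ q → ∫ w in p..q, |a w - α w| ≤ ε * (q - p) := by
      intro p q hp hpq
      have hp0 : 0 ≤ p := (le_max_right _ _).trans hp
      have := intervalIntegral.integral_mono_on hpq (hai p q hp0 (hp0.trans hpq))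
        (intervalIntegrable_const (c := ε)) fun w hw => by
          have := hW w ((le_max_left _ _).trans (hp.trans hw.1))
          rw [dist_zero_right] at this
          exact this.le
      rw [intervalIntegral.integral_const, smul_eq_mul] at this
      linarith
    have hsub : ∀ p q, 0 ≤ p → p ≤ q → q ≤ W' → ∫ w in p..q, |a w - α w| ≤ C₂ := by
      intro p q hp hpq hq
      exact intervalIntegral.integral_mono_interval hp hpq hq
        (Eventually.of_forall fun w => abs_nonneg _) (hai 0 W' le_rfl (le_max_right _ _))
    rcases le_total W' v with h1 | h1
    · linarith [hfar v u h1 hvu]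
    · rcases le_total u W' with h2 | h2
      · have := hsub v u hv hvu h2
        have : 0 ≤ ε * (u - v) := mul_nonneg hε.le (by linarith)
        linarith
      · rw [← intervalIntegral.integral_add_adjacent_intervals
          (hai v W' hv (le_max_right _ _)) (hai W' u (le_max_right _ _) hu)]
        have e1 := hsub v W' hv h1 le_rfl
        have e2 := hfar W' u le_rfl h2
        have : ε * (u - W') ≤ ε * (u - v) := by gcongr
        linarith
  refine ⟨2 * C₁ + C₂, fun v u hv hvu => ?_⟩
  have h1 : ∫ w in v..u, a w = (∫ w in v..u, (a w - α w)) + ∫ w in v..u, α w := by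
    rw [intervalIntegral.integral_sub (ha.intervalIntegrable_of_nonneg hv (hv.trans hvu)) (hαi v u)]
    ring
  have h2 : ∫ w in v..u, α w = Φ u - Φ v + m * (u - v) := by
    simp only [hΦ]
    rw [← intervalIntegral.integral_interval_sub_left (hαi 0 u) (hαi 0 v)]
    ring
  have h3 := intervalIntegral.abs_integral_le_integral_abs (μ := volume)
    (f := fun w => a w - α w) hvu
  have h4 := hG v u hv hvu
  have h5 := abs_le.1 (hC₁' u)
  have h6 := abs_le.1 (hC₁' v)
  have h7 := abs_le.1 (h3.trans h4)
  rw [h1, h2, abs_le]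
  constructor <;> linarith

theorem exists_uniform_translate {β : ℝ → ℝ} {T : ℝ} (hT : 0 < T) (hβ : Function.Periodic β T)
    (hβi : ∀ s t, IntervalIntegrable β volume s t) {ε : ℝ} (hε : 0 < ε) :
    ∃ η > 0, ∀ ζ, |ζ| < η → ∀ v, ∫ w in v..v + 1, |β (w + ζ) - β w| ≤ ε := by
  obtain ⟨n, hn⟩ := exists_nat_ge (1 / T)
  have hn1 : 1 ≤ n * T := (div_le_iff₀ hT).1 hn
  have hn0 : (0 : ℝ) < n := by
    by_contra h
    have : (n : ℝ) ≤ 0 := not_lt.1 h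
    nlinarith
  set B : ℝ → ℝ := Set.indicator (Set.Ioc (-1) (T + 1)) β with hB
  have hBi : Integrable B := by
    have := (hβi (-1) (T + 1)).1
    exact this.integrable_indicator measurableSet_Ioc
  obtain ⟨η, hη, hηle⟩ := Metric.eventually_nhds_iff.1
    ((tendsto_integral_abs_translate_sub hBi).eventually_lt_const (div_pos hε hn0))
  refine ⟨min η 1, lt_min hη one_pos, fun ζ hζ v => ?_⟩
  have hi : ∀ s t, IntervalIntegrable (fun w => |β (w + ζ) - β w|) volume s t := fun s t => by
    have h1 := (hβi (s + ζ) (t + ζ)).comp_add_right ζ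
    simp only [add_sub_cancel_right] at h1
    exact (h1.sub (hβi s t)).abs
  have hper : Function.Periodic (fun w => |β (w + ζ) - β w|) T := fun w => by
    simp only
    rw [add_right_comm, hβ, hβ]
  have h1 : ∫ w in v..v + 1, |β (w + ζ) - β w| ≤ ∫ w in v..v + n * T, |β (w + ζ) - β w| :=
    intervalIntegral.integral_mono_interval le_rfl (by linarith) (by linarith)
      (Eventually.of_forall fun w => abs_nonneg _) (hi _ _)
  have h2 := hper.intervalIntegral_add_zsmul_eq n v hi
  simp only [zsmul_eq_mul, Int.cast_natCast] at h2
  rw [h2, hper.intervalIntegral_add_eq v 0, zero_add] at h1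
  have h3 : ∫ w in (0 : ℝ)..T, |β (w + ζ) - β w| ≤ ∫ w, |B (w + ζ) - B w| := by
    rw [intervalIntegral.integral_of_le hT.le]
    have e1 : ∫ w in Set.Ioc 0 T, |β (w + ζ) - β w| = ∫ w in Set.Ioc 0 T, |B (w + ζ) - B w| := by
      refine setIntegral_congr_fun measurableSet_Ioc fun w hw => ?_
      have hz := abs_lt.1 (hζ.trans_le (min_le_right _ _))
      simp only [hB]
      rw [Set.indicator_of_mem (show w + ζ ∈ Set.Ioc (-1) (T + 1) from
        ⟨by linarith [hw.1, hz.1], by linarith [hw.2, hz.2]⟩),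
        Set.indicator_of_mem (show w ∈ Set.Ioc (-1) (T + 1) from
        ⟨by linarith [hw.1], by linarith [hw.2]⟩)]
    rw [e1]
    exact setIntegral_le_integral ((hBi.comp_add_right ζ).sub hBi).abs
      (Eventually.of_forall fun w => abs_nonneg _)
  have h4 := hηle (y := ζ) (by simpa using hζ.trans_le (min_le_left _ _))
  calc _ ≤ (n : ℝ) * ∫ w in (0 : ℝ)..T, |β (w + ζ) - β w| := h1
    _ ≤ n * (ε / n) := by gcongr; exact h3.trans h4.le
    _ = ε := by field_simp

/-- Among the multiples of `T₁`, finitely many suffice to represent all of them up to a multiple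
of `T₂` and a small error. -/
theorem exists_bounded_representatives {T₁ T₂ η : ℝ} (hT₂ : 0 < T₂) (hη : 0 < η) :
    ∃ I : ℕ, ∀ j : ℕ, ∃ i ≤ I, ∃ m : ℤ, |((j : ℝ) - i) * T₁ - m * T₂| < η := by
  obtain ⟨M, hM⟩ := exists_nat_gt (T₂ / η)
  have hM0 : (0 : ℝ) < M := (div_pos hT₂ hη).trans hM
  have hMη : T₂ / M < η := by rw [div_lt_comm₀ hM0 hη]; exact hM
  set bin : ℕ → ℤ := fun j => ⌊M * Int.fract (j * T₁ / T₂)⌋ with hbin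
  have hfin : (Set.range bin).Finite := by
    refine (Set.finite_Icc (0 : ℤ) M).subset ?_
    rintro _ ⟨j, rfl⟩
    have h1 := Int.fract_nonneg (j * T₁ / T₂)
    have h2 := (Int.fract_lt_one (j * T₁ / T₂)).le
    refine ⟨Int.floor_nonneg.2 (by positivity), ?_⟩
    have h3 : (⌊M * Int.fract (j * T₁ / T₂)⌋ : ℝ) ≤ M * Int.fract (j * T₁ / T₂) := Int.floor_le _
    have h4 : (M : ℝ) * Int.fract (j * T₁ / T₂) ≤ M := by nlinarith
    exact_mod_cast h3.trans h4
  have hch : ∀ y : Set.range bin, ∃ i, bin i = y := fun y => y.2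
  choose φ hφ using hch
  have : Finite (Set.range bin) := hfin
  obtain ⟨I, hI⟩ := (Set.finite_range φ).bddAbove
  refine ⟨I, fun j => ⟨φ ⟨bin j, j, rfl⟩, hI ⟨_, rfl⟩,
    ⌊j * T₁ / T₂⌋ - ⌊(φ ⟨bin j, j, rfl⟩ : ℝ) * T₁ / T₂⌋, ?_⟩⟩
  have hij := hφ ⟨bin j, j, rfl⟩
  set i := φ ⟨bin j, j, rfl⟩
  have h1 := Int.abs_sub_lt_one_of_floor_eq_floor hij
  have h2 : ((j : ℝ) - i) * T₁ - ((⌊j * T₁ / T₂⌋ - ⌊(i : ℝ) * T₁ / T₂⌋ : ℤ) : ℝ) * T₂ =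
      -((M * Int.fract (i * T₁ / T₂) - M * Int.fract (j * T₁ / T₂)) * (T₂ / M)) := by
    push_cast
    rw [Int.fract, Int.fract]
    field_simp
    ring
  rw [h2, abs_neg, abs_mul, abs_of_pos (div_pos hT₂ hM0)]
  have h3 : 0 < T₂ / M := div_pos hT₂ hM0
  nlinarith

/-- The joint translates of two asymptotically periodic functions are totally bounded in the
uniform local `L¹` sense at infinity. -/
theorem exists_translate_close {a α b β : ℝ → ℝ} {T₁ T₂ : ℝ} (hT₁ : 0 < T₁) (hT₂ : 0 < T₂)
    (ha : LocallyIntegrableOn a (Set.Ici 0)) (hb : LocallyIntegrableOn b (Set.Ici 0))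
    (hα : Function.Periodic α T₁) (hβ : Function.Periodic β T₂)
    (hβi : ∀ s t, IntervalIntegrable β volume s t)
    (hla : Tendsto (fun t => a t - α t) atTop (𝓝 0))
    (hlb : Tendsto (fun t => b t - β t) atTop (𝓝 0)) {ε : ℝ} (hε : 0 < ε) :
    ∃ R ≥ 0, ∃ U ≥ 0, ∀ t ≥ 0, ∃ s ∈ Set.Icc 0 R, ∀ v ≥ U,
      ∫ w in v..v + 1, (|a (t + w) - a (s + w)| + |b (t + w) - b (s + w)|) ≤ ε := by
  obtain ⟨η, hη, hηle⟩ := exists_uniform_translate hT₂ hβ hβi (half_pos hε)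
  obtain ⟨I, hI⟩ := exists_bounded_representatives (T₁ := T₁) hT₂ hη
  have hε8 : 0 < ε / 8 := by linarith
  obtain ⟨W₁, hW₁⟩ := eventually_atTop.1 (hla.eventually (Metric.ball_mem_nhds 0 hε8))
  obtain ⟨W₂, hW₂⟩ := eventually_atTop.1 (hlb.eventually (Metric.ball_mem_nhds 0 hε8))
  refine ⟨(I + 1) * T₁, by positivity, max 0 (max W₁ W₂), le_max_left _ _, fun t ht => ?_⟩
  obtain ⟨i, hiI, m, him⟩ := hI ⌊t / T₁⌋₊
  set j := ⌊t / T₁⌋₊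
  have hj1 : (j : ℝ) * T₁ ≤ t := (le_div_iff₀ hT₁).1 (Nat.floor_le (div_nonneg ht hT₁.le))
  have hj2 : t < (j + 1) * T₁ := (div_lt_iff₀ hT₁).1 (Nat.lt_floor_add_one _)
  set ζ := ((j : ℝ) - i) * T₁ - m * T₂ with hζ
  have hi0 : (i : ℝ) * T₁ ≤ I * T₁ := by gcongr
  have hi1 : 0 ≤ (i : ℝ) * T₁ := by positivity
  refine ⟨t - j * T₁ + i * T₁, ⟨by linarith, by linarith⟩, fun v hv => ?_⟩
  set s := t - j * T₁ + i * T₁ with hs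
  have hs0 : 0 ≤ s := by linarith
  have hv0 : 0 ≤ v := (le_max_left _ _).trans hv
  have hvW₁ : W₁ ≤ v := (le_max_left _ _).trans ((le_max_right _ _).trans hv)
  have hvW₂ : W₂ ≤ v := (le_max_right _ _).trans ((le_max_right _ _).trans hv)
  have hαts : ∀ w, α (t + w) = α (s + w) := fun w => by
    have := hα.int_mul ((j : ℤ) - i) (s + w)
    rw [← this]
    congr 1
    push_cast
    rw [hs]; ring
  have hβts : ∀ w, β (t + w) = β (w + s + ζ) := fun w => by
    have := hβ.int_mul m (w + s + ζ)
    rw [← this]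
    congr 1
    rw [hs, hζ]; ring
  have hpt : ∀ w ∈ Set.Icc v (v + 1), |a (t + w) - a (s + w)| + |b (t + w) - b (s + w)| ≤
      ε / 2 + |β (w + s + ζ) - β (w + s)| := by
    intro w hw
    have e1 := hW₁ (t + w) (by linarith [hw.1])
    have e2 := hW₁ (s + w) (by linarith [hw.1])
    have e3 := hW₂ (t + w) (by linarith [hw.1])
    have e4 := hW₂ (s + w) (by linarith [hw.1])
    rw [dist_zero_right, Real.norm_eq_abs] at e1 e2 e3 e4
    rw [hαts] at e1
    rw [hβts] at e3
    rw [add_comm s w] at *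
    have f1 : |a (t + w) - a (w + s)| ≤ ε / 8 + ε / 8 := by
      have : a (t + w) - a (w + s) = (a (t + w) - α (w + s)) - (a (w + s) - α (w + s)) := by ring
      rw [this]
      exact (abs_sub _ _).trans (add_le_add e1.le e2.le)
    have f2 : |b (t + w) - b (w + s)| ≤ ε / 8 + ε / 8 + |β (w + s + ζ) - β (w + s)| := by
      have : b (t + w) - b (w + s) = (b (t + w) - β (w + s + ζ)) - (b (w + s) - β (w + s)) +
        (β (w + s + ζ) - β (w + s)) := by ring
      rw [this]
      exact (abs_add_le _ _).trans (add_le_add ((abs_sub _ _).trans (add_le_add e3.le e4.le)) le_rfl)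
    linarith
  have hloc : ∀ f : ℝ → ℝ, LocallyIntegrableOn f (Set.Ici 0) → ∀ c, 0 ≤ c →
      IntervalIntegrable (fun w => f (c + w)) volume v (v + 1) := fun f hf c hc => by
    have := (hf.intervalIntegrable_of_nonneg (s := c + v) (t := c + (v + 1)) (by linarith)
      (by linarith)).comp_add_left c
    simpa using this
  have hβloc : IntervalIntegrable (fun w => |β (w + s + ζ) - β (w + s)|) volume v (v + 1) := by
    have h1 := (hβi (v + (s + ζ)) (v + 1 + (s + ζ))).comp_add_right (s + ζ)
    have h2 := (hβi (v + s) (v + 1 + s)).comp_add_right s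
    simp only [add_sub_cancel_right] at h1 h2
    simpa only [add_assoc] using (h1.sub h2).abs
  calc _ ≤ ∫ w in v..v + 1, (ε / 2 + |β (w + s + ζ) - β (w + s)|) := by
        refine intervalIntegral.integral_mono_on (by linarith) ?_ ?_ hpt
        · exact ((hloc a ha t ht).sub (hloc a ha s hs0)).abs.add
            ((hloc b hb t ht).sub (hloc b hb s hs0)).abs
        · exact intervalIntegrable_const.add hβloc
    _ = ε / 2 + ∫ w in v..v + 1, |β (w + s + ζ) - β (w + s)| := by
        rw [intervalIntegral.integral_add intervalIntegrable_const hβloc]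
        simp
    _ ≤ ε / 2 + ε / 2 := by
        gcongr
        have h1 := intervalIntegral.integral_comp_add_right (a := v) (b := v + 1)
          (fun w => |β (w + ζ) - β w|) s
        rw [h1, add_right_comm]
        exact hηle ζ him (v + s)
    _ = ε := by ring

/-- A bounded function whose forward translates are, near infinity, totally bounded in the uniform
norm has a mean value. -/
theorem exists_tendsto_mean {h : ℝ → ℝ} {C : ℝ} (hC : ∀ t, 0 ≤ t → |h t| ≤ C)
    (hi : ∀ s t, 0 ≤ s → 0 ≤ t → IntervalIntegrable h volume s t)
    (hap : ∀ ε > 0, ∃ R ≥ 0, ∃ U ≥ 0, ∀ t ≥ 0, ∃ s ∈ Set.Icc 0 R, ∀ u ≥ U,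
      |h (t + u) - h (s + u)| ≤ ε) :
    ∃ m, Tendsto (fun t : ℝ => (1 / t) * ∫ u in (0 : ℝ)..t, h u) atTop (𝓝 m) := by
  set S : ℝ → ℝ := fun t => ∫ u in (0 : ℝ)..t, h u with hS
  have hC0 : 0 ≤ C := (abs_nonneg _).trans (hC 0 le_rfl)
  have hSsub : ∀ p q, 0 ≤ p → 0 ≤ q → S q - S p = ∫ u in p..q, h u := fun p q hp hq =>
    intervalIntegral.integral_interval_sub_left (hi 0 q le_rfl hq) (hi 0 p le_rfl hp)
  have hlip : ∀ p q, 0 ≤ p → p ≤ q → |S q - S p| ≤ C * (q - p) := fun p q hp hpq => by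
    rw [hSsub p q hp (hp.trans hpq)]
    have := intervalIntegral.norm_integral_le_of_norm_le_const (a := p) (b := q) (f := h) (C := C)
      fun u hu => by
        rw [Set.uIoc_of_le hpq] at hu
        exact hC u (hp.trans hu.1.le)
    rwa [Real.norm_eq_abs, abs_of_nonneg (sub_nonneg.2 hpq)] at this
  have hS0 : S 0 = 0 := by simp [hS]
  have hquasi : ∀ ε > 0, ∃ C₁ ≥ 0, ∀ t T, 0 ≤ t → 0 ≤ T →
      |S (t + T) - S t - S T| ≤ ε * T + C₁ := by
    intro ε hε
    obtain ⟨R, hR, U, hU, hRU⟩ := hap ε hε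
    refine ⟨2 * C * (R + U) + 2 * C * U, by positivity, fun t T ht hT => ?_⟩
    obtain ⟨s, hs, hsu⟩ := hRU t ht
    have hshift : ∀ c, 0 ≤ c → S (c + (U + T)) - S (c + U) = ∫ u in U..U + T, h (c + u) :=
      fun c hc => by
        rw [intervalIntegral.integral_comp_add_left, hSsub _ _ (by linarith) (by linarith)]
    have hii : ∀ c, 0 ≤ c → IntervalIntegrable (fun u => h (c + u)) volume U (U + T) :=
      fun c hc => by
        have := (hi (c + U) (c + (U + T)) (by linarith) (by linarith)).comp_add_left c
        simpa using this
    have h1 : |(S (t + (U + T)) - S (t + U)) - (S (s + (U + T)) - S (s + U))| ≤ ε * T := by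
      rw [hshift t ht, hshift s hs.1, ← intervalIntegral.integral_sub (hii t ht) (hii s hs.1)]
      have := intervalIntegral.norm_integral_le_of_norm_le_const (a := U) (b := U + T)
        (f := fun u => h (t + u) - h (s + u)) (C := ε) fun u hu => by
          rw [Set.uIoc_of_le (by linarith)] at hu
          exact hsu u hu.1.le
      rwa [Real.norm_eq_abs, add_sub_cancel_left, abs_of_nonneg hT] at this
    have h2 := hlip T (s + (U + T)) hT (by linarith [hs.1])
    have h3 := hlip 0 (s + U) le_rfl (by linarith [hs.1])
    have h4 := hlip (t + T) (t + (U + T)) (by linarith) (by linarith)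
    have h5 := hlip t (t + U) ht (by linarith)
    rw [hS0] at h3
    have h6 : C * (s + (U + T) - T) ≤ C * (R + U) := by
      apply mul_le_mul_of_nonneg_left _ hC0; linarith [hs.2]
    have h7 : C * (s + U - 0) ≤ C * (R + U) := by
      apply mul_le_mul_of_nonneg_left _ hC0; linarith [hs.2]
    have h8 : C * (t + (U + T) - (t + T)) = C * U := by ring
    have h9 : C * (t + U - t) = C * U := by ring
    rw [abs_le] at *
    constructor <;> linarith
  have hiter : ∀ ε C₁ T, 0 ≤ T → (∀ t, 0 ≤ t → |S (t + T) - S t - S T| ≤ ε * T + C₁) →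
      ∀ n : ℕ, |S (n * T) - n * S T| ≤ n * (ε * T + C₁) := by
    intro ε C₁ T hT hq n
    induction n with
    | zero => simp [hS0]
    | succ n ih =>
      have := hq (n * T) (by positivity)
      have e : ((n + 1 : ℕ) : ℝ) * T = n * T + T := by push_cast; ring
      rw [e]
      push_cast
      rw [abs_le] at *
      constructor <;> linarith
  refine cauchySeq_tendsto_of_complete (Metric.cauchySeq_iff'.2 fun ε hε => ?_)
  obtain ⟨C₁, hC₁, hq⟩ := hquasi (ε / 12) (by linarith)
  set T := max 1 (12 * C₁ / ε) with hT
  have hT1 : 1 ≤ T := le_max_left _ _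
  have hT0 : 0 < T := by linarith
  have hTC : C₁ / T ≤ ε / 12 := by
    rw [div_le_iff₀ hT0]
    have : 12 * C₁ / ε ≤ T := le_max_right _ _
    rw [div_le_iff₀ hε] at this
    linarith
  set T' := max 1 (12 * (2 * C * T) / ε) with hT'
  have hclose : ∀ t, T' ≤ t → |1 / t * S t - S T / T| ≤ ε / 4 := by
    intro t ht
    have ht1 : 1 ≤ t := (le_max_left _ _).trans ht
    have ht0 : 0 < t := by linarith
    have htC : 2 * C * T ≤ ε / 12 * t := by
      have : 12 * (2 * C * T) / ε ≤ t := (le_max_right _ _).trans ht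
      rw [div_le_iff₀ hε] at this
      linarith
    set n := ⌊t / T⌋₊
    have hn1 : (n : ℝ) ≤ t / T := Nat.floor_le (div_nonneg ht0.le hT0.le)
    have hn2 : t / T < n + 1 := Nat.lt_floor_add_one _
    have hn3 : (n : ℝ) * T ≤ t := (le_div_iff₀ hT0).1 hn1
    have hn4 : t < (n + 1) * T := (div_lt_iff₀ hT0).1 hn2
    have e1 := hlip (n * T) t (by positivity) hn3
    have e2 := hiter (ε / 12) C₁ T hT0.le (fun t ht => hq t T ht hT0.le) n
    have e3 := hlip 0 T le_rfl hT0.le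
    rw [hS0, sub_zero, sub_zero] at e3
    have e4 : |(t / T - n) * S T| ≤ C * T := by
      rw [abs_mul, abs_of_nonneg (by linarith)]
      calc (t / T - n) * |S T| ≤ 1 * |S T| := by gcongr; linarith
        _ ≤ _ := by linarith
    have e5 : C * (t - n * T) ≤ C * T := by apply mul_le_mul_of_nonneg_left _ hC0; linarith
    have e6 : (n : ℝ) * (ε / 12 * T + C₁) ≤ t / T * (ε / 12 * T + C₁) := by gcongr
    have e7 : t / T * (ε / 12 * T + C₁) = ε / 12 * t + C₁ / T * t := by field_simp
    have e8 : C₁ / T * t ≤ ε / 12 * t := by gcongr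
    have e9 : |S t - t / T * S T| ≤ ε / 4 * t := by
      rw [abs_le] at *
      constructor <;> linarith
    have e10 : 1 / t * S t - S T / T = (1 / t) * (S t - t / T * S T) := by field_simp
    rw [e10, abs_mul, abs_of_pos (by positivity), one_div, inv_mul_le_iff₀ ht0]
    linarith
  refine ⟨T', fun t ht => ?_⟩
  have h1 := hclose t ht
  have h2 := hclose T' le_rfl
  rw [Real.dist_eq]
  rw [abs_le] at h1 h2
  rw [abs_lt]
  constructor <;> linarith

/-- Exponential convolution of a function with small integrals over unit windows. -/
theorem integral_exp_mul_le {f : ℝ → ℝ} {κ η U : ℝ} (hκ : 0 < κ) (hf0 : ∀ v, U ≤ v → 0 ≤ f v)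
    (hfi : ∀ p q, U ≤ p → U ≤ q → IntervalIntegrable f volume p q)
    (hη : ∀ v, U ≤ v → ∫ w in v..v + 1, f w ≤ η) {u : ℝ} (hu : U ≤ u) :
    ∫ v in U..u, Real.exp (-(κ * (u - v))) * f v ≤ η / (1 - Real.exp (-κ)) := by
  have hq1 : Real.exp (-κ) < 1 := Real.exp_lt_one_iff.2 (by linarith)
  have hq0 := Real.exp_pos (-κ)
  set q := Real.exp (-κ) with hq
  have hη0 : 0 ≤ η := (intervalIntegral.integral_nonneg (by linarith)
    fun v hv => hf0 v hv.1).trans (hη U le_rfl)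
  have hηq : η ≤ η / (1 - q) := by
    rw [le_div_iff₀ (by linarith)]; nlinarith
  have hei : ∀ u p r, U ≤ p → U ≤ r →
      IntervalIntegrable (fun v => Real.exp (-(κ * (u - v))) * f v) volume p r := fun u p r hp hr =>
    (hfi p r hp hr).continuousOn_mul (by fun_prop)
  have hone : ∀ u p, U ≤ p → p ≤ u → u ≤ p + 1 →
      ∫ v in p..u, Real.exp (-(κ * (u - v))) * f v ≤ η := by
    intro u p hp hpu hup
    refine le_trans ?_ (hη p hp)
    calc _ ≤ ∫ v in p..u, f v := by
          refine intervalIntegral.integral_mono_on hpu (hei u p u hp (hp.trans hpu))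
            (hfi p u hp (hp.trans hpu)) fun v hv => ?_
          refine mul_le_of_le_one_left (hf0 v (hp.trans hv.1)) (Real.exp_le_one_iff.2 ?_)
          have := mul_nonneg hκ.le (sub_nonneg.2 hv.2)
          linarith
      _ ≤ _ := by
          refine intervalIntegral.integral_mono_interval le_rfl hpu hup ?_
            (hfi p (p + 1) hp (by linarith))
          exact (ae_restrict_iff' measurableSet_Ioc).2
            (Eventually.of_forall fun v hv => hf0 v (hp.trans hv.1.le))
  have key : ∀ n : ℕ, ∀ u, U ≤ u → u ≤ U + n + 1 →
      ∫ v in U..u, Real.exp (-(κ * (u - v))) * f v ≤ η / (1 - q) := by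
    intro n
    induction n with
    | zero =>
      intro u hu hu1
      exact (hone u U le_rfl hu (by simpa using hu1)).trans hηq
    | succ n ih =>
      intro u hu hu1
      rcases le_or_gt u (U + 1) with h | h
      · exact (hone u U le_rfl hu h).trans hηq
      · have h1 : U ≤ u - 1 := by linarith
        rw [← intervalIntegral.integral_add_adjacent_intervals (hei u U (u - 1) le_rfl h1)
          (hei u (u - 1) u h1 hu)]
        have h2 := hone u (u - 1) h1 (by linarith) (by linarith)
        have h3 := ih (u - 1) h1 (by push_cast at hu1; linarith)
        have h4 : ∫ v in U..u - 1, Real.exp (-(κ * (u - v))) * f v =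
            q * ∫ v in U..u - 1, Real.exp (-(κ * (u - 1 - v))) * f v := by
          rw [← intervalIntegral.integral_const_mul]
          refine intervalIntegral.integral_congr fun v _ => ?_
          simp only [hq]
          rw [← mul_assoc, ← Real.exp_add]
          ring_nf
        rw [h4]
        calc _ ≤ q * (η / (1 - q)) + η := by gcongr
          _ = η / (1 - q) := by
            have : 1 - q ≠ 0 := by linarith
            field_simp; ring
  obtain ⟨n, hn⟩ := exists_nat_ge (u - U)
  exact key n u hu (by linarith)

theorem le_exp_mul_of_exp_integral_mul_le {l ρ : ℝ → ℝ} {U u κ C₀ V₀ X : ℝ} (hu : U ≤ u)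
    (hl : IntervalIntegrable l volume U u) (hρ : IntervalIntegrable ρ volume U u)
    (hρ0 : ∀ v ∈ Set.Icc U u, 0 ≤ ρ v) (hV : 0 ≤ V₀)
    (hlow : ∀ v ∈ Set.Icc U u, κ * (u - v) - C₀ ≤ ∫ w in v..u, l w)
    (h : Real.exp (∫ v in U..u, l v) * X ≤
      V₀ + ∫ v in U..u, Real.exp (∫ w in U..v, l w) * ρ v) :
    X ≤ Real.exp C₀ * (Real.exp (-(κ * (u - U))) * V₀ +
      ∫ v in U..u, Real.exp (-(κ * (u - v))) * ρ v) := by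
  have hEc := (hl.absolutelyContinuousOnInterval_intervalIntegral (c := U)
    (by simp)).exp.continuousOn
  rw [← le_inv_mul_iff₀ (Real.exp_pos _), ← Real.exp_neg, mul_add,
    ← intervalIntegral.integral_const_mul] at h
  refine h.trans ?_
  rw [mul_add, ← intervalIntegral.integral_const_mul]
  refine add_le_add ?_ ?_
  · rw [← mul_assoc, ← Real.exp_add]
    gcongr
    linarith [hlow U ⟨le_rfl, hu⟩]
  · refine intervalIntegral.integral_mono_on hu ((hρ.continuousOn_mul hEc).const_mul _)
      ((hρ.continuousOn_mul (by fun_prop)).const_mul _) fun v hv => ?_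
    rw [← mul_assoc, ← mul_assoc, ← Real.exp_add, ← Real.exp_add]
    refine mul_le_mul_of_nonneg_right (Real.exp_le_exp.2 ?_) (hρ0 v hv)
    have hsub : ∀ p q, U ≤ p → p ≤ q → q ≤ u → IntervalIntegrable l volume p q :=
      fun p q h1 h2 h3 => hl.mono_set (by
        rw [Set.uIcc_of_le h2, Set.uIcc_of_le hu]; exact Set.Icc_subset_Icc h1 h3)
    have := intervalIntegral.integral_add_adjacent_intervals (hsub U v le_rfl hv.1 hv.2)
      (hsub v u hv.1 hv.2 le_rfl)
    linarith [hlow v hv]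

theorem l1Norm_eq_ofReal_tsum {x : ℕ → ℝ} (hx : Summable fun n => |x n|) :
    l1Norm x = ENNReal.ofReal (∑' n, |x n|) :=
  (ENNReal.ofReal_tsum_of_nonneg (fun _ => abs_nonneg _) hx).symm

/-- Scheffé's lemma for probability vectors. -/
theorem tendsto_l1Norm_sub_of_forall_tendsto {N : ℕ∞} {A : ℝ → ℕ → ℝ} {ϖ : ℕ → ℝ}
    (hA : ∀ᶠ t in atTop, A t ∈ probVectors N) (hϖ : ϖ ∈ probVectors N)
    (h : ∀ n, Tendsto (fun t => A t n) atTop (𝓝 (ϖ n))) :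
    Tendsto (fun t => l1Norm (fun n => A t n - ϖ n)) atTop (𝓝 0) := by
  have h1 : Tendsto (fun t => ∑' n, max (ϖ n - A t n) 0) atTop (𝓝 (∑' _ : ℕ, (0 : ℝ))) := by
    refine tendsto_tsum_of_dominated_convergence (bound := ϖ) hϖ.2.1.summable (fun n => ?_) ?_
    · have := ((tendsto_const_nhds (x := ϖ n)).sub (h n)).max (tendsto_const_nhds (x := (0 : ℝ)))
      simpa using this
    · filter_upwards [hA] with t ht n
      rw [Real.norm_of_nonneg (le_max_right _ _)]
      exact max_le (by linarith [ht.1 n]) (hϖ.1 n)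
  rw [tsum_zero] at h1
  have h2 := ENNReal.tendsto_ofReal (h1.const_mul 2)
  rw [mul_zero, ENNReal.ofReal_zero] at h2
  refine h2.congr' ?_
  filter_upwards [hA] with t ht
  have hs : HasSum (fun n => A t n - ϖ n) 0 := by simpa using ht.2.1.sub hϖ.2.1
  have hms : Summable fun n => max (ϖ n - A t n) 0 :=
    Summable.of_nonneg_of_le (fun n => le_max_right _ _)
      (fun n => max_le (by linarith [ht.1 n]) (hϖ.1 n)) hϖ.2.1.summable
  have habs : ∀ n, (A t n - ϖ n) + 2 * max (ϖ n - A t n) 0 = |A t n - ϖ n| := fun n => by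
    rcases le_total (A t n) (ϖ n) with h | h
    · rw [max_eq_left (by linarith), abs_of_nonpos (by linarith)]; ring
    · rw [max_eq_right (by linarith), abs_of_nonneg (by linarith)]; ring
  have hsum := hs.add (hms.hasSum.mul_left 2)
  simp only [habs, zero_add] at hsum
  rw [l1Norm_eq_ofReal_tsum hsum.summable, hsum.tsum_eq]

/-- Cesàro means of a function tending to zero. -/
theorem tendsto_mean_zero {h : ℝ → ℝ}
    (hi : ∀ t, 0 ≤ t → IntervalIntegrable h volume 0 t) (hlim : Tendsto h atTop (𝓝 0)) :
    Tendsto (fun t : ℝ => (1 / t) * ∫ u in (0 : ℝ)..t, h u) atTop (𝓝 0) := by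
  rw [Metric.tendsto_atTop]
  intro ε hε
  obtain ⟨W, hW⟩ := Metric.tendsto_atTop.1 hlim (ε / 4) (by linarith)
  set W' := max W 0
  have hW0 : 0 ≤ W' := le_max_right _ _
  set D := |∫ u in (0 : ℝ)..W', h u|
  refine ⟨max (max W' 1) (4 * D / ε), fun t ht => ?_⟩
  have ht1 : W' ≤ t := (le_max_left _ _).trans ((le_max_left _ _).trans ht)
  have ht2 : 1 ≤ t := (le_max_right _ _).trans ((le_max_left _ _).trans ht)
  have ht3 : 4 * D ≤ t * ε := (div_le_iff₀ hε).1 ((le_max_right _ _).trans ht)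
  have ht0 : 0 < t := by linarith
  have h1 := intervalIntegral.integral_interval_sub_left (hi t ht0.le) (hi W' hW0)
  have h2 := intervalIntegral.norm_integral_le_of_norm_le_const (a := W') (b := t) (f := h)
    (C := ε / 4) fun u hu => by
      rw [Set.uIoc_of_le ht1] at hu
      have := hW u ((le_max_left _ _).trans hu.1.le)
      rw [dist_zero_right] at this
      exact this.le
  rw [Real.norm_eq_abs, abs_of_nonneg (sub_nonneg.2 ht1)] at h2
  have h3 : ε / 4 * (t - W') ≤ ε / 4 * t := by gcongr; linarith
  have h4 : |∫ u in (0 : ℝ)..t, h u| ≤ ε / 2 * t := by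
    have : ∫ u in (0 : ℝ)..t, h u = (∫ u in (0 : ℝ)..W', h u) + ∫ u in W'..t, h u := by
      rw [← h1]; ring
    rw [this]
    refine (abs_add_le _ _).trans ?_
    linarith
  rw [dist_zero_right, Real.norm_eq_abs, abs_mul, abs_of_pos (by positivity), one_div,
    inv_mul_lt_iff₀ ht0]
  nlinarith

theorem partialSum_nonneg {N : ℕ∞} {x : ℕ → ℝ} (hx : x ∈ probVectors N) (k : ℕ) :
    0 ≤ partialSum x k := Finset.sum_nonneg fun i _ => hx.1 i

theorem partialSum_le_one {N : ℕ∞} {x : ℕ → ℝ} (hx : x ∈ probVectors N) (k : ℕ) :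
    partialSum x k ≤ 1 := sum_le_hasSum _ (fun i _ => hx.1 i) hx.2.1

theorem partialSum_eq_one {N : ℕ∞} {x : ℕ → ℝ} (hx : x ∈ probVectors N) {k : ℕ} (hk : N ≤ k) :
    partialSum x k = 1 := by
  refine (hasSum_sum_of_ne_finset_zero fun i hi => hx.2.2 i ?_).unique hx.2.1
  rw [Finset.mem_range, not_lt] at hi
  exact hk.trans_lt (by exact_mod_cast hi)

theorem apply_succ_le_one_sub_partialSum {N : ℕ∞} {x : ℕ → ℝ} (hx : x ∈ probVectors N) (k : ℕ) :
    x (k + 1) ≤ 1 - partialSum x k := by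
  have := partialSum_le_one hx (k + 1)
  rw [partialSum_succ] at this
  linarith

theorem apply_le_one {N : ℕ∞} {x : ℕ → ℝ} (hx : x ∈ probVectors N) (k : ℕ) : x k ≤ 1 :=
  le_hasSum hx.2.1 k fun j _ => hx.1 j

theorem abs_partialSum_sub_le_one {N : ℕ∞} {x y : ℕ → ℝ} (hx : x ∈ probVectors N)
    (hy : y ∈ probVectors N) (k : ℕ) : |partialSum (x - y) k| ≤ 1 := by
  rw [partialSum_sub, abs_le]
  have := partialSum_nonneg hx k
  have := partialSum_nonneg hy k
  have := partialSum_le_one hx k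
  have := partialSum_le_one hy k
  constructor <;> linarith

theorem sum_abs_le_two_mul_sum_abs_partialSum (x : ℕ → ℝ) (n : ℕ) :
    ∑ k ∈ Finset.range n, |x k| ≤ 2 * ∑ k ∈ Finset.range n, |partialSum x k| := by
  have h : ∀ n, ∑ k ∈ Finset.range n, |x k| + shiftDown (fun k => |partialSum x k|) n ≤
      2 * ∑ k ∈ Finset.range n, |partialSum x k| := by
    intro n
    induction n with
    | zero => simp [shiftDown]
    | succ n ih =>
      rw [Finset.sum_range_succ, Finset.sum_range_succ]
      have h1 := shiftDown_partialSum x n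
      have h2 : |x n| ≤ |partialSum x n| + shiftDown (fun k => |partialSum x k|) n := by
        rw [← abs_shiftDown]
        have : x n = partialSum x n - shiftDown (partialSum x) n := by rw [h1]; ring
        nth_rw 1 [this]
        exact abs_sub _ _
      simp only [shiftDown] at *
      linarith
  have h1 := h n
  have h2 : 0 ≤ shiftDown (fun k => |partialSum x k|) n := shiftDown_nonneg (fun _ => abs_nonneg _) n
  linarith

/-- A solution of the forward system consisting of probability vectors on `{0, …, N}`. -/
def IsProbSolution (N : ℕ∞) (lam mu : ℕ → ℝ) (a b : ℝ → ℝ) (s : ℝ) (p : ℝ → ℕ → ℝ) : Prop :=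
  (∀ t, s ≤ t → p t ∈ probVectors N) ∧ IsIntegralSolution lam mu a b s p

section

variable {N : ℕ∞} {lam mu : ℕ → ℝ} {a b l : ℝ → ℝ} {d : ℕ → ℝ} {K κ m₀ s : ℝ}
  {p q : ℝ → ℕ → ℝ}

theorem IsProbSolution.continuousOn (hR : IsBoundedRate lam mu a b K) (hs : 0 ≤ s)
    (hp : IsProbSolution N lam mu a b s p) {t : ℝ} (ht : s ≤ t) (n : ℕ) :
    ContinuousOn (fun u => p u n) (Set.uIcc s t) :=
  (hp.2.isTridiagonalOn hR hs ht).continuousOn n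

theorem IsProbSolution.sum_abs_sub_le (hR : IsBoundedRate lam mu a b K) (hs : 0 ≤ s)
    (hp : IsProbSolution N lam mu a b s p) (hq : IsProbSolution N lam mu a b s q)
    {V₀ : ℝ} (hV : ∀ n, ∑ k ∈ Finset.range n, |p s k - q s k| ≤ V₀) {t : ℝ} (ht : s ≤ t) (n : ℕ) :
    ∑ k ∈ Finset.range n, |p t k - q t k| ≤ V₀ := by
  refine (hp.2.sub hq.2).sum_abs_le hR hs ht hV (C := 1) (fun u hu k => ?_) n
  rw [Pi.sub_apply, abs_le]
  have h1 := (hp.1 u hu.1).1 k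
  have h2 := (hq.1 u hu.1).1 k
  have h3 := apply_le_one (hp.1 u hu.1) k
  have h4 := apply_le_one (hq.1 u hu.1) k
  constructor <;> linarith

theorem IsContractionWeight.sum_partialSum_sub_le (hd : IsContractionWeight N lam mu a b l d κ m₀)
    (hR : IsBoundedRate lam mu a b K) (hs : 0 ≤ s)
    (hp : IsProbSolution N lam mu a b s p) (hq : IsProbSolution N lam mu a b s q)
    {V₀ : ℝ} (hV : ∀ n, ∑ k ∈ Finset.range n, d k * |partialSum (p s - q s) k| ≤ V₀) {t : ℝ}
    (ht : s ≤ t) (n : ℕ) :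
    ∑ k ∈ Finset.range n, d k * |partialSum (p t - q t) k| ≤
      Real.exp (-∫ v in s..t, l v) * V₀ := by
  refine hd.partialSum_le hR (hp.2.sub hq.2) hs ht (fun u hu k hk => ?_) hV (C := 1)
    (fun u hu k => abs_partialSum_sub_le_one (hp.1 u hu.1) (hq.1 u hu.1) k) n
  rw [partialSum_sub, partialSum_eq_one (hp.1 u hu.1) hk, partialSum_eq_one (hq.1 u hu.1) hk,
    sub_self]

/-- Finitely supported approximations of a probability vector. -/
theorem exists_finite_support_approx {x : ℕ → ℝ} (hx : x ∈ probVectors N) {ε : ℝ} (hε : 0 < ε) :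
    ∃ y ∈ probVectors N, (∃ m : ℕ, ∀ k, m ≤ k → partialSum y k = 1) ∧
      ∀ n, ∑ k ∈ Finset.range n, |x k - y k| ≤ ε := by
  have hlim : Tendsto (partialSum x) atTop (𝓝 1) :=
    hx.2.1.tendsto_sum_nat.comp (tendsto_add_atTop_nat 1)
  obtain ⟨m, hm⟩ := (hlim.eventually_const_lt (show 1 - ε / 2 < 1 by linarith)).exists
  set r := 1 - partialSum x m with hr
  have hr0 : 0 ≤ r := sub_nonneg.2 (partialSum_le_one hx m)
  set c : ℕ → ℝ := fun k => if k ∈ Finset.range (m + 1) then x k else 0 with hc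
  have hcs : HasSum c (partialSum x m) := by
    have : HasSum c (∑ k ∈ Finset.range (m + 1), c k) :=
      hasSum_sum_of_ne_finset_zero fun k hk => if_neg hk
    rwa [Finset.sum_congr rfl (fun k hk => if_pos hk)] at this
  have hc0 : ∀ k, 0 ≤ c k := fun k => by
    simp only [hc]; split_ifs
    exacts [hx.1 k, le_rfl]
  have hcx : ∀ k, c k ≤ x k := fun k => by
    simp only [hc]; split_ifs
    exacts [le_rfl, hx.1 k]
  have hrs : HasSum (fun k : ℕ => if k = 0 then r else 0) r := hasSum_ite_eq 0 r
  have hr0' : ∀ k : ℕ, 0 ≤ (if k = 0 then r else 0) := fun k => by split_ifs; exacts [hr0, le_rfl]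
  have hy : (fun k => c k + if k = 0 then r else 0) ∈ probVectors N := by
    refine ⟨fun k => add_nonneg (hc0 k) (hr0' k), ?_, fun k hk => ?_⟩
    · have := hcs.add hrs
      rwa [hr, add_sub_cancel] at this
    · have h1 : c k = 0 := le_antisymm ((hcx k).trans (hx.2.2 k hk).le) (hc0 k)
      have h2 : k ≠ 0 := by
        rintro rfl
        exact not_lt_bot hk
      simp [h1, h2]
  refine ⟨_, hy, ⟨m, fun k hk => ?_⟩, fun n => ?_⟩
  · refine (hasSum_sum_of_ne_finset_zero fun i hi => ?_).unique hy.2.1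
    rw [Finset.mem_range, not_lt] at hi
    have h1 : i ∉ Finset.range (m + 1) := by rw [Finset.mem_range]; omega
    have h2 : i ≠ 0 := by omega
    simp only [hc, if_neg h1, if_neg h2, add_zero]
  · have h1 := (hx.2.1.sub hcs).add hrs
    refine (Finset.sum_le_sum fun k _ => ?_).trans ((sum_le_hasSum (Finset.range n)
      (fun k _ => add_nonneg (sub_nonneg.2 (hcx k)) (hr0' k)) h1).trans (by linarith))
    have : x k - (c k + if k = 0 then r else 0) = (x k - c k) - (if k = 0 then r else 0) := by ring
    rw [this]
    refine (abs_sub _ _).trans ?_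
    rw [abs_of_nonneg (sub_nonneg.2 (hcx k)), abs_of_nonneg (hr0' k)]

theorem IsContractionWeight.eventually_sum_abs_sub_le_of_finite
    (hd : IsContractionWeight N lam mu a b l d κ m₀)
    (hR : IsBoundedRate lam mu a b K) (hl : Tendsto (fun t => ∫ v in (0 : ℝ)..t, l v) atTop atTop)
    (hp : IsProbSolution N lam mu a b 0 p) (hq : IsProbSolution N lam mu a b 0 q)
    (hpm : ∃ m : ℕ, ∀ k, m ≤ k → partialSum (p 0) k = 1)
    (hqm : ∃ m : ℕ, ∀ k, m ≤ k → partialSum (q 0) k = 1) {ε : ℝ} (hε : 0 < ε) :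
    ∀ᶠ t in atTop, ∀ n, ∑ k ∈ Finset.range n, |p t k - q t k| ≤ ε := by
  obtain ⟨m₁, hm₁⟩ := hpm
  obtain ⟨m₂, hm₂⟩ := hqm
  set m := max m₁ m₂
  set V := ∑ k ∈ Finset.range m, d k * |partialSum (p 0 - q 0) k|
  have hV : ∀ n, ∑ k ∈ Finset.range n, d k * |partialSum (p 0 - q 0) k| ≤ V := by
    intro n
    rcases le_total n m with h | h
    · exact Finset.sum_le_sum_of_subset_of_nonneg (Finset.range_mono h)
        fun k _ _ => mul_nonneg (hd.pos k).le (abs_nonneg _)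
    · refine (Finset.sum_subset (Finset.range_mono h) fun k _ hk => ?_).ge
      rw [Finset.mem_range, not_lt] at hk
      rw [partialSum_sub, hm₁ k ((le_max_left _ _).trans hk), hm₂ k ((le_max_right _ _).trans hk)]
      simp
  have hlim : Tendsto (fun t => 2 / m₀ * (Real.exp (-∫ v in (0 : ℝ)..t, l v) * V)) atTop
      (𝓝 (2 / m₀ * (0 * V))) :=
    ((Real.tendsto_exp_neg_atTop_nhds_zero.comp hl).mul_const V).const_mul _
  rw [zero_mul, mul_zero] at hlim
  filter_upwards [hlim.eventually_le_const hε, eventually_ge_atTop 0] with t ht ht0 n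
  refine (sum_abs_le_two_mul_sum_abs_partialSum (p t - q t) n).trans (le_trans ?_ ht)
  have h1 := hd.sum_partialSum_sub_le hR le_rfl hp hq hV ht0 n
  rw [div_mul_eq_mul_div, le_div_iff₀ hd.m_pos, mul_assoc]
  refine mul_le_mul_of_nonneg_left (le_trans ?_ h1) (by norm_num)
  rw [Finset.sum_mul]
  refine Finset.sum_le_sum fun k _ => ?_
  rw [mul_comm]
  exact mul_le_mul_of_nonneg_right (hd.m_le k) (abs_nonneg _)

/-- Any two families of state probabilities merge. -/
theorem IsContractionWeight.eventually_sum_abs_sub_le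
    (hd : IsContractionWeight N lam mu a b l d κ m₀)
    (hR : IsBoundedRate lam mu a b K) (hlam : ∀ k : ℕ, N ≤ k → lam k = 0)
    (hmu : ∀ k : ℕ, N < k → mu k = 0)
    (hl : Tendsto (fun t => ∫ v in (0 : ℝ)..t, l v) atTop atTop)
    (hp : IsProbSolution N lam mu a b 0 p) (hq : IsProbSolution N lam mu a b 0 q)
    {ε : ℝ} (hε : 0 < ε) :
    ∀ᶠ t in atTop, ∀ n, ∑ k ∈ Finset.range n, |p t k - q t k| ≤ ε := by
  have happ : ∀ p, IsProbSolution N lam mu a b 0 p → ∃ x, IsProbSolution N lam mu a b 0 x ∧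
      (∃ m : ℕ, ∀ k, m ≤ k → partialSum (x 0) k = 1) ∧
      ∀ t, 0 ≤ t → ∀ n, ∑ k ∈ Finset.range n, |p t k - x t k| ≤ ε / 3 := by
    intro p hp
    obtain ⟨y, hy, hym, hyle⟩ := exists_finite_support_approx (hp.1 0 le_rfl)
      (show 0 < ε / 3 by linarith)
    obtain ⟨x, hx1, hx2, hx0⟩ := hR.exists_forwardSolution hy hlam hmu
    exact ⟨x, ⟨hx1, hx2⟩, by rwa [hx0], fun t ht n =>
      hp.sum_abs_sub_le hR le_rfl ⟨hx1, hx2⟩ (by rwa [hx0]) ht n⟩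
  obtain ⟨x, hx, hxm, hxle⟩ := happ p hp
  obtain ⟨y, hy, hym, hyle⟩ := happ q hq
  filter_upwards [hd.eventually_sum_abs_sub_le_of_finite hR hl hx hy hxm hym
    (show 0 < ε / 3 by linarith), eventually_ge_atTop 0] with t ht ht0 n
  calc ∑ k ∈ Finset.range n, |p t k - q t k|
      ≤ ∑ k ∈ Finset.range n, (|p t k - x t k| + |x t k - y t k| + |q t k - y t k|) := by
        refine Finset.sum_le_sum fun k _ => ?_
        have : p t k - q t k = (p t k - x t k) + (x t k - y t k) - (q t k - y t k) := by ring
        rw [this]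
        exact (abs_sub _ _).trans (add_le_add (abs_add_le _ _) le_rfl)
    _ ≤ ε / 3 + ε / 3 + ε / 3 := by
        rw [Finset.sum_add_distrib, Finset.sum_add_distrib]
        exact add_le_add (add_le_add (hxle t ht0 n) (ht n)) (hyle t ht0 n)
    _ = ε := by ring

theorem tendsto_l1Norm_zero {x : ℝ → ℕ → ℝ}
    (h : ∀ ε > 0, ∀ᶠ t in atTop, ∀ n, ∑ k ∈ Finset.range n, |x t k| ≤ ε) :
    Tendsto (fun t => l1Norm (x t)) atTop (𝓝 0) := by
  rw [ENNReal.tendsto_nhds_zero]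
  intro ε hε
  rcases eq_or_ne ε ⊤ with rfl | hε'
  · simp
  filter_upwards [h ε.toReal (ENNReal.toReal_pos hε.ne' hε')] with t ht
  rw [l1Norm_eq_ofReal_tsum (summable_of_sum_range_le (fun _ => abs_nonneg _) ht)]
  refine ENNReal.ofReal_le_of_le_toReal ?_
  exact Real.tsum_le_of_sum_range_le (fun _ => abs_nonneg _) ht

/-- Uniform tightness of the state probabilities started at `0`. -/
theorem IsContractionWeight.exists_tail_bound (hd : IsContractionWeight N lam mu a b l d κ m₀)
    (hR : IsBoundedRate lam mu a b K) {κ₀ C₀ Ca : ℝ} (hκ₀ : 0 < κ₀)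
    (hlow : ∀ v u, 0 ≤ v → v ≤ u → κ₀ * (u - v) - C₀ ≤ ∫ w in v..u, l w)
    (ha : ∀ v, 0 ≤ v → ∫ w in v..v + 1, a w ≤ Ca)
    (hp : IsProbSolution N lam mu a b 0 p) (hp0 : ∀ k, partialSum (p 0) k = 1) :
    ∃ M, ∀ u, 0 ≤ u → ∀ n, ∑ k ∈ Finset.range n, d k * (1 - partialSum (p u) k) ≤ M := by
  refine ⟨Real.exp C₀ * (0 + d 0 * lam 0 * Ca / (1 - Real.exp (-κ₀))), fun u hu n => ?_⟩
  have hai : ∀ x y, 0 ≤ x → 0 ≤ y → IntervalIntegrable (fun v => d 0 * lam 0 * a v) volume x y :=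
    fun x y hx hy => (hR.a_int.intervalIntegrable_of_nonneg hx hy).const_mul _
  have hdl : 0 ≤ d 0 * lam 0 := mul_nonneg (hd.pos 0).le (hR.lam_nonneg 0)
  have hρ0 : ∀ v, 0 ≤ v → 0 ≤ d 0 * lam 0 * a v := fun v hv => mul_nonneg hdl (hR.a_nonneg v hv)
  have key := hd.weighted_le (τ := 0) (z := fun k u => 1 - partialSum (p u) k)
    (F := fun k u => -flux lam mu a b p k u)
    (r := fun k u => if k = 0 then lam 0 * a u else 0) (ρ := fun u => d 0 * lam 0 * a u)
    (V₀ := 0) (C := 1) hR le_rfl hu le_rfl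
    (fun k => (hp.2.flux_integrable hR.mu_zero k hu).neg)
    (fun k v hv => by
      rw [intervalIntegral.integral_neg, hp.2.partialSum_eq hR.mu_zero k hv.1]; ring)
    (fun k u => by
      rw [flux_eq]
      cases k with
      | zero => simp only [shiftDown, if_true, zero_add]; ring
      | succ k => simp only [shiftDown, Nat.succ_ne_zero, if_false, zero_add]; ring)
    (hai 0 u le_rfl hu)
    (fun v hv n => by
      have hla : 0 ≤ lam 0 * a v := mul_nonneg (hR.lam_nonneg 0) (hR.a_nonneg v hv.1)
      cases n with
      | zero => simpa using hρ0 v hv.1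
      | succ n =>
        rw [Finset.sum_range_succ']
        simp [abs_of_nonneg (hR.lam_nonneg 0), abs_of_nonneg (hR.a_nonneg v hv.1), mul_assoc])
    (fun v hv k hk => by rw [partialSum_eq_one (hp.1 v hv.1) hk, sub_self])
    (fun n => by simp [hp0])
    (fun v hv k => by
      have := partialSum_nonneg (hp.1 v hv.1) k
      have := partialSum_le_one (hp.1 v hv.1) k
      rw [abs_le]; constructor <;> linarith) n
  simp only [zero_add] at key
  have h1 := le_exp_mul_of_exp_integral_mul_le (κ := κ₀) (C₀ := C₀) (V₀ := 0) hu
    (hd.l_int.intervalIntegrable_of_nonneg le_rfl hu) (hai 0 u le_rfl hu)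
    (fun v hv => hρ0 v hv.1) le_rfl (fun v hv => hlow v u hv.1 hv.2) (by simpa using key)
  have h2 := integral_exp_mul_le (U := 0) (η := d 0 * lam 0 * Ca) hκ₀ hρ0 hai
    (fun v hv => by
      rw [intervalIntegral.integral_const_mul]
      exact mul_le_mul_of_nonneg_left (ha v hv) hdl) hu
  have h3 : ∑ k ∈ Finset.range n, d k * (1 - partialSum (p u) k) =
      ∑ k ∈ Finset.range n, d k * |1 - partialSum (p u) k| :=
    Finset.sum_congr rfl fun k _ => by
      rw [abs_of_nonneg (sub_nonneg.2 (partialSum_le_one (hp.1 u hu) k))]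
  rw [h3]
  refine h1.trans ?_
  rw [mul_zero]
  gcongr

/-- Time translates of a tight solution are close, near infinity, whenever the translates of the
time factors are close. -/
theorem IsContractionWeight.abs_partialSum_translate_sub_le
    (hd : IsContractionWeight N lam mu a b l d κ m₀)
    (hR : IsBoundedRate lam mu a b K) {κ₀ C₀ M : ℝ} (hκ₀ : 0 < κ₀)
    (hlow : ∀ v u, 0 ≤ v → v ≤ u → κ₀ * (u - v) - C₀ ≤ ∫ w in v..u, l w)
    (hp : IsProbSolution N lam mu a b 0 p)
    (hM : ∀ u, 0 ≤ u → ∀ n, ∑ k ∈ Finset.range n, d k * (1 - partialSum (p u) k) ≤ M)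
    {t s U η : ℝ} (ht : 0 ≤ t) (hs : 0 ≤ s) (hU : 0 ≤ U)
    (hη : ∀ v, U ≤ v → ∫ w in v..v + 1, (|a (t + w) - a (s + w)| + |b (t + w) - b (s + w)|) ≤ η)
    {u : ℝ} (hu : U ≤ u) (k : ℕ) :
    m₀ * |partialSum (p (t + u)) k - partialSum (p (s + u)) k| ≤
      Real.exp C₀ * (Real.exp (-(κ₀ * (u - U))) * (2 * M) +
        K * (d 0 + (κ + 1) * M) * η / (1 - Real.exp (-κ₀))) := by
  have hκ : 0 ≤ κ := by
    have h1 := hd.le_succ 0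
    have h2 := hd.pos 0
    have h3 := hd.pos 1
    by_contra h
    have := mul_nonpos_of_nonpos_of_nonneg (not_le.1 h).le h3.le
    rw [zero_add] at h1
    linarith
  have hM0 : 0 ≤ M := by simpa using hM 0 le_rfl 0
  set M₂ := d 0 + (κ + 1) * M with hM₂
  have hM₂0 : 0 ≤ M₂ := add_nonneg (hd.pos 0).le (by positivity)
  have hloc : ∀ f : ℝ → ℝ, LocallyIntegrableOn f (Set.Ici 0) → ∀ c, 0 ≤ c → ∀ x y, U ≤ x → U ≤ y →
      IntervalIntegrable (fun w => f (c + w)) volume x y := fun f hf c hc x y hx hy => by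
    have := (hf.intervalIntegrable_of_nonneg (s := c + x) (t := c + y) (by linarith)
      (by linarith)).comp_add_left c
    simpa using this
  set ρ : ℝ → ℝ := fun w => K * M₂ * (|a (t + w) - a (s + w)| + |b (t + w) - b (s + w)|) with hρ
  have hρi : ∀ x y, U ≤ x → U ≤ y → IntervalIntegrable ρ volume x y := fun x y hx hy =>
    (((hloc a hR.a_int t ht x y hx hy).sub (hloc a hR.a_int s hs x y hx hy)).abs.add
      ((hloc b hR.b_int t ht x y hx hy).sub (hloc b hR.b_int s hs x y hx hy)).abs).const_mul _
  have hKM : 0 ≤ K * M₂ := mul_nonneg hR.K_nonneg hM₂0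
  have hρ0 : ∀ v, 0 ≤ ρ v := fun v => by simp only [hρ]; positivity
  have hfi : ∀ c, 0 ≤ c → ∀ j x y, U ≤ x → x ≤ y →
      IntervalIntegrable (fun w => flux lam mu a b p j (c + w)) volume x y := by
    intro c hc j x y hx hxy
    have h1 := (hp.2.flux_integrable hR.mu_zero j (t := c + y) (by linarith))
    have h2 : IntervalIntegrable (flux lam mu a b p j) volume (c + x) (c + y) := h1.mono_set (by
      rw [Set.uIcc_of_le (by linarith), Set.uIcc_of_le (by linarith)]
      exact Set.Icc_subset_Icc (by linarith) le_rfl)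
    simpa using h2.comp_add_left c
  have hfe : ∀ c, 0 ≤ c → ∀ j y, U ≤ y → partialSum (p (c + y)) j =
      partialSum (p (c + U)) j + ∫ w in U..y, flux lam mu a b p j (c + w) := by
    intro c hc j y hy
    rw [intervalIntegral.integral_comp_add_left (fun w => flux lam mu a b p j w) c,
      hp.2.partialSum_eq hR.mu_zero j (t := c + y) (by linarith),
      hp.2.partialSum_eq hR.mu_zero j (t := c + U) (by linarith), add_assoc]
    congr 1
    rw [← intervalIntegral.integral_interval_sub_left
      (hp.2.flux_integrable hR.mu_zero j (t := c + y) (by linarith))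
      (hp.2.flux_integrable hR.mu_zero j (t := c + U) (by linarith))]
    ring
  have key := hd.weighted_le (τ := t)
    (z := fun j w => partialSum (p (t + w)) j - partialSum (p (s + w)) j)
    (F := fun j w => flux lam mu a b p j (t + w) - flux lam mu a b p j (s + w))
    (r := fun j w => lam j * (a (t + w) - a (s + w)) * -p (s + w) j +
      mu (j + 1) * (b (t + w) - b (s + w)) * p (s + w) (j + 1))
    (ρ := ρ) (V₀ := 2 * M) (C := 1) hR hU hu ht
    (fun j => (hfi t ht j U u le_rfl hu).sub (hfi s hs j U u le_rfl hu))
    (fun j v hv => by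
      rw [intervalIntegral.integral_sub (hfi t ht j U v le_rfl hv.1) (hfi s hs j U v le_rfl hv.1),
        hfe t ht j v hv.1, hfe s hs j v hv.1]
      ring)
    (fun j w => by
      rw [flux_eq, flux_eq, partialSum_succ, partialSum_succ]
      have h2 := shiftDown_partialSum (p (t + w)) j
      have h3 := shiftDown_partialSum (p (s + w)) j
      have h1 : shiftDown (fun j => partialSum (p (t + w)) j - partialSum (p (s + w)) j) j =
          shiftDown (partialSum (p (t + w))) j - shiftDown (partialSum (p (s + w))) j := by
        cases j <;> simp [shiftDown]
      rw [h1, h2, h3]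
      ring)
    (hρi U u le_rfl hu)
    (fun v hv n => by
      have hpv := hp.1 (s + v) (by linarith [hv.1])
      have hMv := hM (s + v) (by linarith [hv.1]) n
      have hs1 : ∑ j ∈ Finset.range n, d j * p (s + v) (j + 1) ≤ M :=
        (Finset.sum_le_sum fun j _ => mul_le_mul_of_nonneg_left
          (apply_succ_le_one_sub_partialSum hpv j) (hd.pos j).le).trans hMv
      have hs2 : ∑ j ∈ Finset.range n, d j * p (s + v) j ≤ d 0 + κ * M := by
        have h1 : ∑ j ∈ Finset.range (n + 1), d j * p (s + v) j ≤ d 0 + κ * M := by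
          rw [Finset.sum_range_succ', add_comm]
          refine add_le_add (mul_le_of_le_one_right (hd.pos 0).le (apply_le_one hpv 0)) ?_
          refine le_trans ?_ (mul_le_mul_of_nonneg_left hs1 hκ)
          rw [Finset.mul_sum]
          refine Finset.sum_le_sum fun j _ => ?_
          rw [← mul_assoc]
          exact mul_le_mul_of_nonneg_right (hd.succ_le j) (hpv.1 _)
        refine le_trans ?_ h1
        exact Finset.sum_le_sum_of_subset_of_nonneg (Finset.range_mono n.le_succ)
          fun j _ _ => mul_nonneg (hd.pos j).le (hpv.1 j)
      calc ∑ j ∈ Finset.range n, d j * |lam j * (a (t + v) - a (s + v)) * -p (s + v) j +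
            mu (j + 1) * (b (t + v) - b (s + v)) * p (s + v) (j + 1)|
          ≤ ∑ j ∈ Finset.range n, (K * |a (t + v) - a (s + v)| * (d j * p (s + v) j) +
            K * |b (t + v) - b (s + v)| * (d j * p (s + v) (j + 1))) := by
            refine Finset.sum_le_sum fun j _ => ?_
            have h1 : |lam j * (a (t + v) - a (s + v)) * -p (s + v) j +
                mu (j + 1) * (b (t + v) - b (s + v)) * p (s + v) (j + 1)| ≤
                K * |a (t + v) - a (s + v)| * p (s + v) j +
                K * |b (t + v) - b (s + v)| * p (s + v) (j + 1) := by
              refine (abs_add_le _ _).trans ?_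
              rw [abs_mul, abs_mul, abs_neg, abs_mul, abs_mul, abs_of_nonneg (hR.lam_nonneg j),
                abs_of_nonneg (hR.mu_nonneg _), abs_of_nonneg (hpv.1 j), abs_of_nonneg (hpv.1 _)]
              have e1 := hR.lam_le j
              have e2 := hR.mu_le (j + 1)
              have e3 := hpv.1 j
              have e4 := hpv.1 (j + 1)
              gcongr
            refine (mul_le_mul_of_nonneg_left h1 (hd.pos j).le).trans_eq ?_
            ring
        _ = K * |a (t + v) - a (s + v)| * ∑ j ∈ Finset.range n, d j * p (s + v) j +
            K * |b (t + v) - b (s + v)| * ∑ j ∈ Finset.range n, d j * p (s + v) (j + 1) := by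
            rw [Finset.sum_add_distrib, Finset.mul_sum, Finset.mul_sum]
        _ ≤ K * |a (t + v) - a (s + v)| * M₂ + K * |b (t + v) - b (s + v)| * M₂ := by
            have e0 := hR.K_nonneg
            have e1 := (hd.pos 0).le
            have e2 : 0 ≤ κ * M := mul_nonneg hκ hM0
            gcongr
            · linarith
            · linarith
        _ = ρ v := by simp only [hρ]; ring)
    (fun v hv j hj => by
      rw [partialSum_eq_one (hp.1 _ (by linarith [hv.1])) hj,
        partialSum_eq_one (hp.1 _ (by linarith [hv.1])) hj, sub_self])
    (fun n => by
      have h1 := hM (t + U) (by linarith) n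
      have h2 := hM (s + U) (by linarith) n
      refine le_trans ?_ (by linarith : (∑ k ∈ Finset.range n, d k * (1 - partialSum (p (t + U)) k)) +
        ∑ k ∈ Finset.range n, d k * (1 - partialSum (p (s + U)) k) ≤ 2 * M)
      rw [← Finset.sum_add_distrib]
      refine Finset.sum_le_sum fun j _ => ?_
      rw [← mul_add]
      refine mul_le_mul_of_nonneg_left ?_ (hd.pos j).le
      have e1 := partialSum_le_one (hp.1 (t + U) (by linarith)) j
      have e2 := partialSum_le_one (hp.1 (s + U) (by linarith)) j
      rw [abs_le]; constructor <;> linarith)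
    (fun v hv j => by
      rw [← partialSum_sub]
      exact abs_partialSum_sub_le_one (hp.1 _ (by linarith [hv.1])) (hp.1 _ (by linarith [hv.1])) j)
    (k + 1)
  have h1 := le_exp_mul_of_exp_integral_mul_le (κ := κ₀) (C₀ := C₀) (V₀ := 2 * M) hu
    (hloc l hd.l_int t ht U u le_rfl hu) (hρi U u le_rfl hu)
    (fun v _ => hρ0 v) (by positivity) (fun v hv => by
      rw [intervalIntegral.integral_comp_add_left]
      have := hlow (t + v) (t + u) (by linarith [hv.1]) (by linarith [hv.2])
      linarith) key
  have h2 := integral_exp_mul_le (U := U) (η := K * M₂ * η) hκ₀ (fun v _ => hρ0 v) hρi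
    (fun v hv => by
      simp only [hρ]
      rw [intervalIntegral.integral_const_mul]
      exact mul_le_mul_of_nonneg_left (hη v hv) hKM) hu
  have h3 : m₀ * |partialSum (p (t + u)) k - partialSum (p (s + u)) k| ≤
      ∑ j ∈ Finset.range (k + 1), d j * |partialSum (p (t + u)) j - partialSum (p (s + u)) j| := by
    refine le_trans ?_ (Finset.single_le_sum
      (f := fun j => d j * |partialSum (p (t + u)) j - partialSum (p (s + u)) j|)
      (fun j _ => mul_nonneg (hd.pos j).le (abs_nonneg _)) (Finset.self_mem_range_succ k))
    exact mul_le_mul_of_nonneg_right (hd.m_le k) (abs_nonneg _)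
  refine h3.trans (h1.trans ?_)
  gcongr

end

section

variable {N : ℕ∞} {lam mu : ℕ → ℝ} {a b l : ℝ → ℝ} {d : ℕ → ℝ} {K κ m₀ : ℝ} {p q : ℝ → ℕ → ℝ}

theorem single_zero_mem_probVectors (N : ℕ∞) : (Pi.single 0 1 : ℕ → ℝ) ∈ probVectors N := by
  refine ⟨fun n => ?_, ?_, fun n hn => ?_⟩
  · rcases eq_or_ne n 0 with rfl | h <;> simp [*]
  · have := hasSum_ite_eq (0 : ℕ) (1 : ℝ)
    convert! this using 2 with n
    simp [Pi.single_apply]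
  · have : n ≠ 0 := by
      rintro rfl
      exact not_lt_bot hn
    simp [this]

theorem IsProbSolution.mean_mem_probVectors (hR : IsBoundedRate lam mu a b K)
    (hp : IsProbSolution N lam mu a b 0 p) {t : ℝ} (ht : 0 < t) :
    (fun n => (1 / t) * ∫ τ in (0 : ℝ)..t, p τ n) ∈ probVectors N := by
  have hIoc : ∀ u ∈ Set.uIoc 0 t, 0 ≤ u := fun u hu => by
    rw [Set.uIoc_of_le ht.le] at hu; exact hu.1.le
  refine ⟨fun n => mul_nonneg (by positivity)
    (intervalIntegral.integral_nonneg ht.le fun u hu => (hp.1 u hu.1).1 n), ?_, fun n hn => ?_⟩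
  · have h := intervalIntegral.hasSum_integral_of_dominated_convergence (a := 0) (b := t)
      (μ := volume) (F := fun n τ => p τ n) (f := fun _ => 1) (fun n τ => p τ n)
      (fun n => ((hp.continuousOn hR le_rfl ht.le n).intervalIntegrable).def'.aestronglyMeasurable)
      (fun n => Eventually.of_forall fun u hu => by
        rw [Real.norm_of_nonneg ((hp.1 u (hIoc u hu)).1 n)])
      (Eventually.of_forall fun u hu => (hp.1 u (hIoc u hu)).2.1.summable)
      ((intervalIntegrable_const (c := (1 : ℝ))).congr fun u hu =>
        ((hp.1 u (hIoc u hu)).2.1.tsum_eq).symm)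
      (Eventually.of_forall fun u hu => (hp.1 u (hIoc u hu)).2.1)
    have h2 := h.mul_left (1 / t)
    rw [intervalIntegral.integral_const, sub_zero, smul_eq_mul, mul_one,
      one_div_mul_cancel ht.ne'] at h2
    exact h2
  · have : ∫ τ in (0 : ℝ)..t, p τ n = ∫ τ in (0 : ℝ)..t, (0 : ℝ) := by
      refine intervalIntegral.integral_congr fun u hu => ?_
      rw [Set.uIcc_of_le ht.le] at hu
      exact (hp.1 u hu.1).2.2 n hn
    simp [this]

theorem partialSum_sub_shiftDown (σ : ℕ → ℝ) (k : ℕ) :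
    partialSum (fun n => σ n - shiftDown σ n) k = σ k := by
  induction k with
  | zero => simp [partialSum, shiftDown]
  | succ k ih => rw [partialSum_succ, ih]; simp [shiftDown]

/-- Convergence of the time averages for a process contracting in the mean whose time factors have
totally bounded translates. -/
theorem IsContractionWeight.exists_mean_limit (hd : IsContractionWeight N lam mu a b l d κ m₀)
    (hR : IsBoundedRate lam mu a b K) (hlam : ∀ k : ℕ, N ≤ k → lam k = 0)
    (hmu : ∀ k : ℕ, N < k → mu k = 0) {κ₀ C₀ Ca : ℝ} (hκ₀ : 0 < κ₀)
    (hlow : ∀ v u, 0 ≤ v → v ≤ u → κ₀ * (u - v) - C₀ ≤ ∫ w in v..u, l w)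
    (ha : ∀ v, 0 ≤ v → ∫ w in v..v + 1, a w ≤ Ca)
    (hl : Tendsto (fun t => ∫ v in (0 : ℝ)..t, l v) atTop atTop)
    (hclose : ∀ ε > 0, ∃ R ≥ 0, ∃ U ≥ 0, ∀ t ≥ 0, ∃ s ∈ Set.Icc 0 R, ∀ v ≥ U,
      ∫ w in v..v + 1, (|a (t + w) - a (s + w)| + |b (t + w) - b (s + w)|) ≤ ε) :
    ∃ ϖ ∈ probVectors N, ∀ p : ℝ → ℕ → ℝ, IsProbSolution N lam mu a b 0 p →
      Tendsto (fun t : ℝ => l1Norm (fun n => (1 / t) * (∫ τ in (0 : ℝ)..t, p τ n) - ϖ n))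
        atTop (𝓝 0) := by
  obtain ⟨P, hP1, hP2, hP0⟩ := hR.exists_forwardSolution (single_zero_mem_probVectors N) hlam hmu
  have hP : IsProbSolution N lam mu a b 0 P := ⟨hP1, hP2⟩
  have hPc : ∀ t, 0 ≤ t → ∀ n, IntervalIntegrable (fun u => P u n) volume 0 t := fun t ht n =>
    (hP.continuousOn hR le_rfl ht n).intervalIntegrable
  obtain ⟨M, hM⟩ := hd.exists_tail_bound hR hκ₀ hlow ha hP fun k => by
    rw [hP0, partialSum, Finset.sum_range_succ']
    simp
  have hm0 := hd.m_pos
  have hM0 : 0 ≤ M := by simpa using hM 0 le_rfl 0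
  have hq1 : 0 < 1 - Real.exp (-κ₀) := by
    have := Real.exp_lt_one_iff.2 (neg_lt_zero.2 hκ₀)
    linarith
  have hSi : ∀ k s t, 0 ≤ s → 0 ≤ t → IntervalIntegrable (fun u => partialSum (P u) k)
      volume s t := fun k s t hs ht => by
    have h1 : ∀ t, 0 ≤ t → IntervalIntegrable (fun u => partialSum (P u) k) volume 0 t :=
      fun t ht => by
        have := IntervalIntegrable.sum (Finset.range (k + 1)) fun i _ => hPc t ht i
        simpa [partialSum, Finset.sum_fn] using this
    exact (h1 s hs).symm.trans (h1 t ht)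
  have hSmean : ∀ k, ∃ σ, Tendsto (fun t : ℝ => (1 / t) * ∫ u in (0 : ℝ)..t, partialSum (P u) k)
      atTop (𝓝 σ) := by
    intro k
    refine exists_tendsto_mean (C := 1) (fun t ht => ?_) (hSi k) fun ε hε => ?_
    · rw [abs_of_nonneg (partialSum_nonneg (hP1 t ht) k)]
      exact partialSum_le_one (hP1 t ht) k
    set c₁ := Real.exp C₀ * (K * (d 0 + (κ + 1) * M) / (1 - Real.exp (-κ₀)))
    have hη : ∃ η > 0, c₁ * η ≤ m₀ * ε / 2 := by
      refine ⟨m₀ * ε / 2 / (|c₁| + 1), by positivity, ?_⟩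
      rw [← mul_div_assoc, div_le_iff₀ (by positivity), mul_comm c₁]
      exact mul_le_mul_of_nonneg_left ((le_abs_self c₁).trans (by linarith)) (by positivity)
    obtain ⟨η, hη0, hηle⟩ := hη
    obtain ⟨R, hR0, U, hU0, hRU⟩ := hclose η hη0
    have hexp : Tendsto (fun u : ℝ => Real.exp C₀ * (Real.exp (-(κ₀ * (u - U))) * (2 * M))) atTop
        (𝓝 (Real.exp C₀ * (0 * (2 * M)))) := by
      refine Tendsto.const_mul _ (Tendsto.mul_const _ ?_)
      refine Real.tendsto_exp_neg_atTop_nhds_zero.comp ?_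
      exact (tendsto_atTop_add_const_right _ (-U) tendsto_id).const_mul_atTop hκ₀
    rw [zero_mul, mul_zero] at hexp
    obtain ⟨W, hW⟩ := eventually_atTop.1
      (hexp.eventually_le_const (show 0 < m₀ * ε / 2 by positivity))
    refine ⟨R, hR0, max U W, hU0.trans (le_max_left _ _), fun t ht => ?_⟩
    obtain ⟨s, hs, hsv⟩ := hRU t ht
    refine ⟨s, hs, fun u hu => ?_⟩
    have h1 := hd.abs_partialSum_translate_sub_le hR hκ₀ hlow hP hM ht hs.1 hU0 hsv
      ((le_max_left _ _).trans hu) k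
    have h2 := hW u ((le_max_right _ _).trans hu)
    have h3 : Real.exp C₀ * (Real.exp (-(κ₀ * (u - U))) * (2 * M) +
        K * (d 0 + (κ + 1) * M) * η / (1 - Real.exp (-κ₀))) =
        Real.exp C₀ * (Real.exp (-(κ₀ * (u - U))) * (2 * M)) + c₁ * η := by ring
    rw [h3] at h1
    exact le_of_mul_le_mul_left (by linarith) hm0
  choose σ hσ using hSmean
  set ϖ : ℕ → ℝ := fun n => σ n - shiftDown σ n with hϖdef
  have hPlim : ∀ n, Tendsto (fun t : ℝ => (1 / t) * ∫ u in (0 : ℝ)..t, P u n) atTop (𝓝 (ϖ n)) := by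
    intro n
    cases n with
    | zero => simpa [hϖdef, shiftDown, partialSum] using hσ 0
    | succ n =>
      refine ((hσ (n + 1)).sub (hσ n)).congr' ?_
      filter_upwards [eventually_ge_atTop 0] with t ht
      rw [← mul_sub, ← intervalIntegral.integral_sub (hSi _ 0 t le_rfl ht) (hSi _ 0 t le_rfl ht)]
      simp only [partialSum_succ, add_sub_cancel_left]
  have hPmean : ∀ᶠ t in atTop, (fun n => (1 / t) * ∫ τ in (0 : ℝ)..t, P τ n) ∈ probVectors N := by
    filter_upwards [eventually_gt_atTop 0] with t ht
    exact hP.mean_mem_probVectors hR ht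
  have hϖ0 : ∀ n, 0 ≤ ϖ n := fun n =>
    ge_of_tendsto (hPlim n) (hPmean.mono fun t ht => ht.1 n)
  have hσle : ∀ k, σ k ≤ 1 := fun k => by
    refine le_of_tendsto (hσ k) ?_
    filter_upwards [eventually_gt_atTop 0] with t ht
    have := intervalIntegral.integral_mono_on ht.le (hSi k 0 t le_rfl ht.le)
      (intervalIntegrable_const (c := (1 : ℝ))) fun u hu => partialSum_le_one (hP1 u hu.1) k
    rw [intervalIntegral.integral_const, sub_zero, smul_eq_mul, mul_one] at this
    rw [one_div, inv_mul_le_iff₀ ht]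
    linarith
  have htail : ∀ u, 0 ≤ u → ∀ k : ℕ, 1 - M / m₀ / (k + 1) ≤ partialSum (P u) k := by
    intro u hu k
    have h1 : ((k : ℝ) + 1) * (m₀ * (1 - partialSum (P u) k)) ≤ M := by
      refine le_trans ?_ (hM u hu (k + 1))
      have h2 : ∑ j ∈ Finset.range (k + 1), m₀ * (1 - partialSum (P u) k) ≤
          ∑ j ∈ Finset.range (k + 1), d j * (1 - partialSum (P u) j) := by
        refine Finset.sum_le_sum fun j hj => ?_
        rw [Finset.mem_range] at hj
        have hmono : partialSum (P u) j ≤ partialSum (P u) k :=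
          Finset.sum_le_sum_of_subset_of_nonneg (Finset.range_mono (by omega))
            fun i _ _ => (hP1 u hu).1 i
        have h3 := partialSum_le_one (hP1 u hu) k
        exact mul_le_mul (hd.m_le j) (by linarith) (by linarith) (hd.pos j).le
      simpa using h2
    have h4 : 1 - partialSum (P u) k ≤ M / m₀ / (k + 1) := by
      rw [le_div_iff₀ (by positivity), le_div_iff₀ hm0]
      linarith
    linarith
  have hσge : ∀ k : ℕ, 1 - M / m₀ / (k + 1) ≤ σ k := fun k => by
    refine ge_of_tendsto (hσ k) ?_
    filter_upwards [eventually_gt_atTop 0] with t ht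
    have := intervalIntegral.integral_mono_on ht.le
      (intervalIntegrable_const (c := 1 - M / m₀ / (k + 1))) (hSi k 0 t le_rfl ht.le)
      fun u hu => htail u hu.1 k
    rw [intervalIntegral.integral_const, sub_zero, smul_eq_mul] at this
    rw [one_div, le_inv_mul_iff₀ ht]
    linarith
  have hσ1 : Tendsto σ atTop (𝓝 1) := by
    have h1 : Tendsto (fun k : ℕ => 1 - M / m₀ / ((k : ℝ) + 1)) atTop (𝓝 (1 - 0)) :=
      tendsto_const_nhds.sub (tendsto_const_nhds.div_atTop
        (tendsto_atTop_add_const_right _ 1 tendsto_natCast_atTop_atTop))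
    rw [sub_zero] at h1
    exact tendsto_of_tendsto_of_tendsto_of_le_of_le h1 tendsto_const_nhds hσge hσle
  have hϖ : ϖ ∈ probVectors N := by
    refine ⟨hϖ0, ?_, fun n hn => ?_⟩
    · rw [hasSum_iff_tendsto_nat_of_nonneg hϖ0, ← tendsto_add_atTop_iff_nat 1]
      refine hσ1.congr fun k => ?_
      exact (partialSum_sub_shiftDown σ k).symm
    · refine tendsto_nhds_unique (hPlim n) (tendsto_const_nhds.congr' ?_)
      filter_upwards [hPmean] with t ht
      exact (ht.2.2 n hn).symm
  refine ⟨ϖ, hϖ, fun p hp => ?_⟩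
  refine tendsto_l1Norm_sub_of_forall_tendsto (N := N)
    (A := fun t n => (1 / t) * ∫ τ in (0 : ℝ)..t, p τ n) ?_ hϖ fun n => ?_
  · filter_upwards [eventually_gt_atTop 0] with t ht
    exact hp.mean_mem_probVectors hR ht
  · have hpc : ∀ t, 0 ≤ t → IntervalIntegrable (fun u => p u n) volume 0 t := fun t ht =>
      (hp.continuousOn hR le_rfl ht n).intervalIntegrable
    have hdiff : Tendsto (fun u => p u n - P u n) atTop (𝓝 0) := by
      rw [Metric.tendsto_atTop']
      intro ε hε
      obtain ⟨W, hW⟩ := eventually_atTop.1 (hd.eventually_sum_abs_sub_le hR hlam hmu hl hp hP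
        (half_pos hε))
      refine ⟨W, fun t ht => ?_⟩
      rw [dist_zero_right, Real.norm_eq_abs]
      refine lt_of_le_of_lt (le_trans ?_ (hW t ht.le (n + 1))) (half_lt_self hε)
      exact Finset.single_le_sum (f := fun k => |p t k - P t k|) (fun j _ => abs_nonneg _)
        (Finset.self_mem_range_succ n)
    have h1 := (tendsto_mean_zero (fun t ht => (hpc t ht).sub (hPc t ht n)) hdiff).add (hPlim n)
    rw [zero_add] at h1
    refine h1.congr' ?_
    filter_upwards [eventually_ge_atTop 0] with t ht
    rw [intervalIntegral.integral_sub (hpc t ht) (hPc t ht n)]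
    ring

end

/-! ### Restriction of the coefficients to the state space -/

section Cutoff

variable {N : ℕ∞} {lam mu : ℕ → ℝ} {lamLim muLim : ℝ} {a b : ℝ → ℝ}

/-- The birth coefficients, set to zero outside `k < N`. -/
noncomputable def cutoffBirth (N : ℕ∞) (lam : ℕ → ℝ) : ℕ → ℝ :=
  Set.indicator {k : ℕ | (k : ℕ∞) < N} lam

/-- The death coefficients, set to zero outside `k ≤ N`. -/
noncomputable def cutoffDeath (N : ℕ∞) (mu : ℕ → ℝ) : ℕ → ℝ :=
  Set.indicator {k : ℕ | (k : ℕ∞) ≤ N} mu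

theorem cutoffBirth_of_lt {k : ℕ} (hk : (k : ℕ∞) < N) : cutoffBirth N lam k = lam k :=
  Set.indicator_of_mem (s := {k : ℕ | (k : ℕ∞) < N}) hk lam

theorem cutoffBirth_of_le {k : ℕ} (hk : N ≤ k) : cutoffBirth N lam k = 0 :=
  Set.indicator_of_notMem (s := {k : ℕ | (k : ℕ∞) < N}) (not_lt.2 hk) lam

theorem cutoffDeath_of_le {k : ℕ} (hk : (k : ℕ∞) ≤ N) : cutoffDeath N mu k = mu k :=
  Set.indicator_of_mem (s := {k : ℕ | (k : ℕ∞) ≤ N}) hk mu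

theorem cutoffDeath_of_lt {k : ℕ} (hk : N < k) : cutoffDeath N mu k = 0 :=
  Set.indicator_of_notMem (s := {k : ℕ | (k : ℕ∞) ≤ N}) (not_le.2 hk) mu

theorem succ_le_of_cast_lt {k : ℕ} (hk : (k : ℕ∞) < N) : ((k + 1 : ℕ) : ℕ∞) ≤ N := by
  rw [Nat.cast_succ]; exact Order.add_one_le_of_lt hk

theorem cast_lt_of_succ_le {k : ℕ} (hk : ((k + 1 : ℕ) : ℕ∞) ≤ N) : (k : ℕ∞) < N :=
  lt_of_lt_of_le (by exact_mod_cast k.lt_succ_self) hk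

theorem IsBirthDeathCoeffs.lam_eq_zero (h : IsBirthDeathCoeffs N lam mu lamLim muLim) {n : ℕ}
    (hn : (n : ℕ∞) = N) : lam n = 0 := (h.finite n hn.symm).1

theorem IsBirthDeathCoeffs.cutoffBirth_eq (h : IsBirthDeathCoeffs N lam mu lamLim muLim) {n : ℕ}
    (hn : (n : ℕ∞) ≤ N) : cutoffBirth N lam n = lam n := by
  rcases hn.lt_or_eq with h1 | h1
  · exact cutoffBirth_of_lt h1
  · rw [cutoffBirth_of_le h1.ge, h.lam_eq_zero h1]

theorem exists_tendsto_of_eventually_zero_or_tendsto {r r' : ℕ → ℝ} {L : ℝ}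
    (h : N = ⊤ → Tendsto r atTop (𝓝 L)) (htop : N = ⊤ → ∀ k, r' k = r k)
    (hfin : ∀ k : ℕ, N < k → r' k = 0) : ∃ L', Tendsto r' atTop (𝓝 L') := by
  rcases eq_or_ne N ⊤ with hN | hN
  · exact ⟨L, (h hN).congr fun k => (htop hN k).symm⟩
  · lift N to ℕ using hN
    refine ⟨0, tendsto_const_nhds.congr' ?_⟩
    filter_upwards [eventually_gt_atTop N] with k hk
    exact (hfin k (by exact_mod_cast hk)).symm

theorem IsBirthDeathCoeffs.exists_isBoundedRate (h : IsBirthDeathCoeffs N lam mu lamLim muLim)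
    (ha_nonneg : ∀ t, 0 ≤ t → 0 ≤ a t) (hb_nonneg : ∀ t, 0 ≤ t → 0 ≤ b t)
    (ha_int : LocallyIntegrableOn a (Set.Ici 0)) (hb_int : LocallyIntegrableOn b (Set.Ici 0)) :
    ∃ K, IsBoundedRate (cutoffBirth N lam) (cutoffDeath N mu) a b K := by
  obtain ⟨L₁, hL₁⟩ := exists_tendsto_of_eventually_zero_or_tendsto
    (r' := cutoffBirth N lam) (fun hN => (h.infinite hN).1)
    (fun hN k => cutoffBirth_of_lt (by rw [hN]; exact ENat.natCast_lt_top k))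
    (fun k hk => cutoffBirth_of_le hk.le)
  obtain ⟨L₂, hL₂⟩ := exists_tendsto_of_eventually_zero_or_tendsto
    (r' := cutoffDeath N mu) (fun hN => (h.infinite hN).2)
    (fun hN k => cutoffDeath_of_le (by rw [hN]; exact le_top)) (fun k hk => cutoffDeath_of_lt hk)
  obtain ⟨K₁, hK₁⟩ := hL₁.bddAbove_range
  obtain ⟨K₂, hK₂⟩ := hL₂.bddAbove_range
  refine ⟨max K₁ K₂, ?_, fun k => (hK₁ ⟨k, rfl⟩).trans (le_max_left _ _), ?_,
    fun k => (hK₂ ⟨k, rfl⟩).trans (le_max_right _ _), ?_, ha_nonneg, hb_nonneg, ha_int, hb_int⟩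
  · exact Set.indicator_nonneg fun k hk => (h.lam_pos k hk).le
  · refine Set.indicator_nonneg fun k hk => ?_
    rcases Nat.eq_zero_or_pos k with rfl | h1
    · exact h.mu_zero.ge
    · exact (h.mu_pos k h1 hk).le
  · rw [cutoffDeath_of_le (by simp), h.mu_zero]

theorem IsBirthDeathCoeffs.forwardRHS_cutoff (h : IsBirthDeathCoeffs N lam mu lamLim muLim)
    {x : ℕ → ℝ} (hx : ∀ n : ℕ, N < n → x n = 0) {n : ℕ} (hn : (n : ℕ∞) ≤ N) (u : ℝ) :
    forwardRHS (fun k => productRate (cutoffBirth N lam) a k u)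
      (fun k => productRate (cutoffDeath N mu) b k u) x n =
    forwardRHS (fun k => productRate lam a k u) (fun k => productRate mu b k u) x n := by
  have h1 : cutoffBirth N lam n = lam n := h.cutoffBirth_eq hn
  have h2 : cutoffDeath N mu n = mu n := cutoffDeath_of_le hn
  have h3 : cutoffDeath N mu (n + 1) * b u * x (n + 1) = mu (n + 1) * b u * x (n + 1) := by
    rcases le_or_gt ((n + 1 : ℕ) : ℕ∞) N with h4 | h4
    · rw [cutoffDeath_of_le h4]
    · rw [hx _ h4]; simp
  cases n with
  | zero => simp only [forwardRHS, shiftDown, productRate, h1, h2, h3]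
  | succ n =>
    have h5 : cutoffBirth N lam n = lam n := cutoffBirth_of_lt (cast_lt_of_succ_le hn)
    simp only [forwardRHS, shiftDown, productRate, h1, h2, h3, h5]

theorem forwardRHS_cutoff_of_lt {x : ℕ → ℝ} {n : ℕ} (hn : N < n) (u : ℝ) :
    forwardRHS (fun k => productRate (cutoffBirth N lam) a k u)
      (fun k => productRate (cutoffDeath N mu) b k u) x n = 0 := by
  have h1 : cutoffBirth N lam n = 0 := cutoffBirth_of_le hn.le
  have h2 : cutoffDeath N mu n = 0 := cutoffDeath_of_lt hn
  have h3 : cutoffDeath N mu (n + 1) = 0 :=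
    cutoffDeath_of_lt (hn.trans (by exact_mod_cast n.lt_succ_self))
  cases n with
  | zero => simp [forwardRHS, shiftDown, productRate, h1, h2, h3]
  | succ n =>
    have h5 : cutoffBirth N lam n = 0 := cutoffBirth_of_le (by
      rw [Nat.cast_succ] at hn
      exact Order.le_of_lt_add_one hn)
    simp [forwardRHS, shiftDown, productRate, h1, h2, h3, h5]

theorem IsBirthDeathCoeffs.isProbSolution (h : IsBirthDeathCoeffs N lam mu lamLim muLim)
    {s : ℝ} {p : ℝ → ℕ → ℝ}
    (hp : IsForwardSolution N (productRate lam a) (productRate mu b) s p) :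
    IsProbSolution N (cutoffBirth N lam) (cutoffDeath N mu) a b s p := by
  refine ⟨hp.1, fun n t ht => ?_⟩
  rcases le_or_gt (n : ℕ∞) N with hn | hn
  · obtain ⟨h1, h2⟩ := hp.2 n hn t ht
    have hcongr : ∀ u ∈ Set.uIcc s t, forwardRHS (fun k => productRate (cutoffBirth N lam) a k u)
        (fun k => productRate (cutoffDeath N mu) b k u) (p u) n =
        forwardRHS (fun k => productRate lam a k u) (fun k => productRate mu b k u) (p u) n := by
      intro u hu
      rw [Set.uIcc_of_le ht] at hu
      exact h.forwardRHS_cutoff (hp.1 u hu.1).2.2 hn u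
    refine ⟨h1.congr fun u hu => (hcongr u (Set.uIoc_subset_uIcc hu)).symm, ?_⟩
    rw [intervalIntegral.integral_congr hcongr]
    exact h2
  · simp only [forwardRHS_cutoff_of_lt hn]
    refine ⟨by simp, ?_⟩
    rw [(hp.1 t ht).2.2 n hn, (hp.1 s le_rfl).2.2 n hn]
    simp

end Cutoff

/-! ### Weights -/

theorem dWeight_zero (δ : ℕ → ℝ) : dWeight δ 0 = 1 := by simp [dWeight]

theorem dWeight_succ (δ : ℕ → ℝ) (k : ℕ) : dWeight δ (k + 1) = dWeight δ k * δ (k + 1) :=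
  Finset.prod_range_succ _ _

theorem exists_dWeight_bounds {δ : ℕ → ℝ} {D : ℝ} (hδ : ∀ k, 0 < δ k) (hD : 0 < D)
    (hlim : Tendsto δ atTop (𝓝 D)) (hone : ∀ᶠ k in atTop, 1 ≤ δ k) :
    ∃ κ m₀, 0 < m₀ ∧ (∀ k, m₀ ≤ dWeight δ k) ∧ (∀ k, dWeight δ (k + 1) ≤ κ * dWeight δ k) ∧
      ∀ k, dWeight δ k ≤ κ * dWeight δ (k + 1) := by
  have hpos : ∀ k, 0 < dWeight δ k := fun k => Finset.prod_pos fun i _ => hδ _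
  obtain ⟨κ₁, hκ₁⟩ := hlim.bddAbove_range
  obtain ⟨κ₂, hκ₂⟩ := (hlim.inv₀ hD.ne').bddAbove_range
  obtain ⟨k₀, hk₀⟩ := eventually_atTop.1 hone
  refine ⟨max κ₁ κ₂, (Finset.range (k₀ + 1)).inf' (Finset.nonempty_range_iff.2 k₀.succ_ne_zero)
    (dWeight δ), ?_, ?_, ?_, ?_⟩
  · rw [Finset.lt_inf'_iff]
    exact fun k _ => hpos k
  · intro k
    rcases le_or_gt k k₀ with h | h
    · exact Finset.inf'_le _ (by rw [Finset.mem_range]; omega)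
    · refine (Finset.inf'_le _ (Finset.self_mem_range_succ k₀)).trans ?_
      induction k, h.le using Nat.le_induction with
      | base => exact le_rfl
      | succ k hk ih =>
        rcases hk.eq_or_lt with rfl | h1
        · rw [dWeight_succ]
          exact le_mul_of_one_le_right (hpos _).le (hk₀ _ (by omega))
        · refine (ih h1).trans ?_
          rw [dWeight_succ]
          exact le_mul_of_one_le_right (hpos _).le (hk₀ _ (by omega))
  · intro k
    rw [dWeight_succ, mul_comm]
    exact mul_le_mul_of_nonneg_right ((hκ₁ ⟨k + 1, rfl⟩).trans (le_max_left _ _)) (hpos k).le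
  · intro k
    rw [dWeight_succ]
    have h1 : (δ (k + 1))⁻¹ ≤ max κ₁ κ₂ := (hκ₂ ⟨k + 1, rfl⟩).trans (le_max_right _ _)
    have h2 := mul_le_mul_of_nonneg_right h1 (mul_pos (hpos k) (hδ (k + 1))).le
    refine le_trans (le_of_eq ?_) h2
    have := (hδ (k + 1)).ne'
    field_simp

theorem gConst_le_two {N : ℕ∞} {δ : ℕ → ℝ} (hpos : ∀ k, 0 < dWeight δ k) : gConst N δ ≤ 2 := by
  refine csInf_le ⟨0, ?_⟩ (Set.mem_insert _ _)
  rintro _ (rfl | ⟨k, _, _, rfl⟩)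
  exacts [by norm_num, (hpos k).le]

theorem gConst_le {N : ℕ∞} {δ : ℕ → ℝ} (hpos : ∀ k, 0 < dWeight δ k) {k : ℕ} (hk : 0 < k)
    (hkN : (k : ℕ∞) < N) : gConst N δ ≤ dWeight δ k := by
  refine csInf_le ⟨0, ?_⟩ (Set.mem_insert_of_mem _ ⟨k, hk, hkN, rfl⟩)
  rintro _ (rfl | ⟨k, _, _, rfl⟩)
  exacts [by norm_num, (hpos k).le]

theorem gConst_pos {N : ℕ∞} {δ : ℕ → ℝ} {m₀ : ℝ} (hm₀ : 0 < m₀) (hm : ∀ k, m₀ ≤ dWeight δ k) :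
    0 < gConst N δ := by
  refine lt_of_lt_of_le (lt_min two_pos hm₀) (le_csInf ⟨2, Set.mem_insert _ _⟩ ?_)
  rintro _ (rfl | ⟨k, _, _, rfl⟩)
  exacts [min_le_left _ _, (min_le_right _ _).trans (hm k)]

/-! ### Norms -/

theorem tsum_tail_eq_neg_partialSum {x : ℕ → ℝ} (hx : HasSum x 0) (k : ℕ) :
    ∑' i, x (k + 1 + i) = -partialSum x k := by
  have h1 := hx.summable.sum_add_tsum_nat_add (k + 1)
  rw [hx.tsum_eq] at h1
  have h2 : ∑' i, x (k + 1 + i) = ∑' i, x (i + (k + 1)) := by simp only [add_comm]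
  rw [h2, partialSum]
  linarith

theorem norm1D_eq {δ : ℕ → ℝ} (hpos : ∀ k, 0 < dWeight δ k) {x : ℕ → ℝ} (hx : HasSum x 0) :
    norm1D δ x = ∑' k, ENNReal.ofReal (dWeight δ k * |partialSum x k|) := by
  refine tsum_congr fun k => ?_
  rw [tsum_tail_eq_neg_partialSum hx, abs_mul, abs_neg, abs_of_pos (hpos k)]

theorem tsum_ofReal_le_of_forall_sum_le {f : ℕ → ℝ} (hf : ∀ k, 0 ≤ f k) {V : ℝ}
    (h : ∀ n, ∑ k ∈ Finset.range n, f k ≤ V) :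
    ∑' k, ENNReal.ofReal (f k) ≤ ENNReal.ofReal V := by
  rw [ENNReal.tsum_eq_iSup_nat]
  refine iSup_le fun n => ?_
  rw [← ENNReal.ofReal_sum_of_nonneg fun k _ => hf k]
  exact ENNReal.ofReal_le_ofReal (h n)

theorem sum_le_toReal_tsum_ofReal {f : ℕ → ℝ} (hf : ∀ k, 0 ≤ f k)
    (h : ∑' k, ENNReal.ofReal (f k) ≠ ⊤) (n : ℕ) :
    ∑ k ∈ Finset.range n, f k ≤ (∑' k, ENNReal.ofReal (f k)).toReal := by
  rw [← ENNReal.ofReal_le_iff_le_toReal h, ENNReal.ofReal_sum_of_nonneg fun k _ => hf k]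
  exact ENNReal.sum_le_tsum _

theorem l1Norm_le_norm1D {N : ℕ∞} {δ : ℕ → ℝ} (hpos : ∀ k, 0 < dWeight δ k)
    (hg : 0 < gConst N δ) {x : ℕ → ℝ} (hx : HasSum x 0)
    (hN : ∀ k : ℕ, N ≤ k → partialSum x k = 0) :
    l1Norm x ≤ ENNReal.ofReal (4 / gConst N δ) * norm1D δ x := by
  have hterm : ∀ k, gConst N δ / 2 * |partialSum x k| ≤ dWeight δ k * |partialSum x k| := by
    intro k
    rcases le_or_gt N (k : ℕ∞) with h | h
    · simp [hN k h]
    · refine mul_le_mul_of_nonneg_right ?_ (abs_nonneg _)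
      rcases Nat.eq_zero_or_pos k with rfl | h0
      · rw [dWeight_zero]; linarith [gConst_le_two (N := N) hpos]
      · linarith [gConst_le hpos h0 h]
  rw [norm1D_eq hpos hx, l1Norm, ENNReal.tsum_eq_iSup_nat]
  refine iSup_le fun n => ?_
  rw [← ENNReal.ofReal_sum_of_nonneg fun k _ => abs_nonneg _]
  calc ENNReal.ofReal (∑ k ∈ Finset.range n, |x k|)
      ≤ ENNReal.ofReal (4 / gConst N δ *
        ∑ k ∈ Finset.range n, dWeight δ k * |partialSum x k|) := by
        refine ENNReal.ofReal_le_ofReal ((sum_abs_le_two_mul_sum_abs_partialSum x n).trans ?_)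
        have := Finset.sum_le_sum fun k (_ : k ∈ Finset.range n) => hterm k
        rw [← Finset.mul_sum] at this
        rw [div_mul_eq_mul_div, le_div_iff₀ hg]
        linarith
    _ = ENNReal.ofReal (4 / gConst N δ) *
        ∑ k ∈ Finset.range n, ENNReal.ofReal (dWeight δ k * |partialSum x k|) := by
        rw [ENNReal.ofReal_mul (by positivity), ENNReal.ofReal_sum_of_nonneg fun k _ =>
          mul_nonneg (hpos k).le (abs_nonneg _)]
    _ ≤ _ := mul_le_mul_right (ENNReal.sum_le_tsum _) _

theorem norm1D_le_tsum_qWeight {δ : ℕ → ℝ} (hpos : ∀ k, 0 < dWeight δ k) {x : ℕ → ℝ}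
    (hx : Summable fun n => |x n|) :
    norm1D δ x ≤ ∑' i, ENNReal.ofReal (qWeight δ i * |x i|) := by
  have h1 : ∀ k, ENNReal.ofReal |dWeight δ k * ∑' i, x (k + 1 + i)| ≤
      ∑' i, if k < i then ENNReal.ofReal (dWeight δ k) * ENNReal.ofReal |x i| else 0 := by
    intro k
    have hinj : Function.Injective fun i => k + 1 + i := add_right_injective (k + 1)
    have hs : Summable fun i => |x (k + 1 + i)| := hx.comp_injective hinj
    rw [abs_mul, abs_of_pos (hpos k), ENNReal.ofReal_mul (hpos k).le]
    calc ENNReal.ofReal (dWeight δ k) * ENNReal.ofReal |∑' i, x (k + 1 + i)|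
        ≤ ENNReal.ofReal (dWeight δ k) * ∑' i, ENNReal.ofReal |x (k + 1 + i)| := by
          refine mul_le_mul_right ?_ _
          rw [← ENNReal.ofReal_tsum_of_nonneg (fun i => abs_nonneg _) hs]
          refine ENNReal.ofReal_le_ofReal ?_
          have := norm_tsum_le_tsum_norm (f := fun i => x (k + 1 + i)) (by simpa using hs)
          simpa using this
      _ = ∑' i, (fun j => if k < j then ENNReal.ofReal (dWeight δ k) * ENNReal.ofReal |x j| else 0)
            (k + 1 + i) := by
          rw [← ENNReal.tsum_mul_left]
          refine tsum_congr fun i => ?_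
          exact (if_pos (by omega)).symm
      _ ≤ _ := ENNReal.tsum_comp_le_tsum_of_injective hinj _
  refine (ENNReal.tsum_le_tsum h1).trans ?_
  rw [ENNReal.tsum_comm]
  refine ENNReal.tsum_le_tsum fun i => le_of_eq ?_
  rw [tsum_eq_sum (s := Finset.range i) fun k hk => if_neg (by simpa using hk), qWeight,
    ENNReal.ofReal_mul (Finset.sum_nonneg fun k _ => (hpos k).le),
    ENNReal.ofReal_sum_of_nonneg fun k _ => (hpos k).le, Finset.sum_mul]
  exact Finset.sum_congr rfl fun k hk => if_pos (Finset.mem_range.1 hk)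

/-- The contraction estimate in the norm `‖·‖_{1D}`. -/
theorem IsContractionWeight.norm1D_sub_le {N : ℕ∞} {lam mu : ℕ → ℝ} {a b l : ℝ → ℝ} {δ : ℕ → ℝ}
    {κ m₀ K s t : ℝ} {p q : ℝ → ℕ → ℝ}
    (hd : IsContractionWeight N lam mu a b l (dWeight δ) κ m₀)
    (hR : IsBoundedRate lam mu a b K) (hs : 0 ≤ s)
    (hp : IsProbSolution N lam mu a b s p) (hq : IsProbSolution N lam mu a b s q) (ht : s ≤ t) :
    norm1D δ (p t - q t) ≤ ENNReal.ofReal (Real.exp (-∫ u in s..t, l u)) *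
      norm1D δ (p s - q s) := by
  have hsum : ∀ u, s ≤ u → HasSum (p u - q u) 0 := fun u hu => by
    have := (hp.1 u hu).2.1.sub (hq.1 u hu).2.1
    rw [sub_self] at this
    exact this
  have hf : ∀ u k, 0 ≤ dWeight δ k * |partialSum (p u - q u) k| := fun u k =>
    mul_nonneg (hd.pos k).le (abs_nonneg _)
  rw [norm1D_eq hd.pos (hsum t ht), norm1D_eq hd.pos (hsum s le_rfl)]
  rcases eq_or_ne (∑' k, ENNReal.ofReal (dWeight δ k * |partialSum (p s - q s) k|)) ⊤ with h | h
  · rw [h, ENNReal.mul_top (ENNReal.ofReal_pos.2 (Real.exp_pos _)).ne']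
    exact le_top
  · rw [← ENNReal.ofReal_toReal h, ← ENNReal.ofReal_mul (Real.exp_pos _).le]
    exact tsum_ofReal_le_of_forall_sum_le (hf t) fun n => hd.sum_partialSum_sub_le hR hs hp hq
      (sum_le_toReal_tsum_ofReal (hf s) h) ht n

/-! ### The choice of the weights -/

theorem quadratic_le_zero_of_le_root {Q P R c f : ℝ} (hQ : 0 < Q) (hc : 0 < c)
    (hf : f = (P + √(P ^ 2 + 4 * Q * R)) / (2 * Q)) (hR : 0 ≤ R) (hcf : c ≤ f) :
    Q * c ^ 2 - P * c - R ≤ 0 := by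
  rw [hf, le_div_iff₀ (by positivity)] at hcf
  rcases le_or_gt (c * (2 * Q) - P) 0 with h | h
  · nlinarith [mul_pos hc hQ]
  · have h1 : c * (2 * Q) - P ≤ √(P ^ 2 + 4 * Q * R) := by linarith
    have h2 := pow_le_pow_left₀ h.le h1 2
    rw [Real.sq_sqrt (by positivity)] at h2
    nlinarith

/-- `δ_k = (λ_{k-1} + c Δ λ) / λ_k` for `1 ≤ k < N`, and `1` elsewhere. -/
noncomputable def deltaSeq (N : ℕ∞) (lam : ℕ → ℝ) (e : ℝ) : ℕ → ℝ := by
  classical exact fun k => if 0 < k ∧ (k : ℕ∞) < N then (lam (k - 1) + e) / lam k else 1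

section DeltaSeq

variable {N : ℕ∞} {lam mu : ℕ → ℝ} {lamLim muLim e : ℝ}

theorem deltaSeq_succ {k : ℕ} (hk : ((k + 1 : ℕ) : ℕ∞) < N) :
    deltaSeq N lam e (k + 1) = (lam k + e) / lam (k + 1) :=
  if_pos ⟨k.succ_pos, hk⟩

theorem IsBirthDeathCoeffs.deltaSeq_pos (h : IsBirthDeathCoeffs N lam mu lamLim muLim) (he : 0 < e)
    (k : ℕ) : 0 < deltaSeq N lam e k := by
  by_cases hk : 0 < k ∧ (k : ℕ∞) < N
  · have h1 : 0 < lam (k - 1) := h.lam_pos _ (lt_of_le_of_lt (by simp) hk.2)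
    rw [deltaSeq, if_pos hk]
    exact div_pos (by linarith) (h.lam_pos k hk.2)
  · rw [deltaSeq, if_neg hk]; exact one_pos

theorem IsBirthDeathCoeffs.tendsto_deltaSeq_top (h : IsBirthDeathCoeffs N lam mu lamLim muLim)
    (hN : N = ⊤) : Tendsto (deltaSeq N lam e) atTop (𝓝 ((lamLim + e) / lamLim)) := by
  obtain ⟨h1, _⟩ := h.infinite hN
  rw [← tendsto_add_atTop_iff_nat 1]
  refine ((h1.add_const e).div (h1.comp (tendsto_add_atTop_nat 1)) h.lamLim_pos.ne').congr
    fun k => ?_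
  rw [deltaSeq_succ (by rw [hN]; exact ENat.natCast_lt_top _)]
  rfl

theorem IsBirthDeathCoeffs.one_lt_limit (h : IsBirthDeathCoeffs N lam mu lamLim muLim)
    (he : 0 < e) : 1 < (lamLim + e) / lamLim := by
  rw [lt_div_iff₀ h.lamLim_pos]; linarith

theorem IsBirthDeathCoeffs.exists_dWeight_deltaSeq_bounds
    (h : IsBirthDeathCoeffs N lam mu lamLim muLim) (he : 0 < e) :
    ∃ κ m₀, 0 < m₀ ∧ (∀ k, m₀ ≤ dWeight (deltaSeq N lam e) k) ∧
      (∀ k, dWeight (deltaSeq N lam e) (k + 1) ≤ κ * dWeight (deltaSeq N lam e) k) ∧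
      ∀ k, dWeight (deltaSeq N lam e) k ≤ κ * dWeight (deltaSeq N lam e) (k + 1) := by
  rcases eq_or_ne N ⊤ with hN | hN
  · have hlim := h.tendsto_deltaSeq_top (e := e) hN
    have h1 := h.one_lt_limit he
    exact exists_dWeight_bounds (h.deltaSeq_pos he) (by linarith) hlim
      ((hlim.eventually_const_lt h1).mono fun k hk => hk.le)
  · lift N to ℕ using hN
    have hev : ∀ᶠ k in atTop, deltaSeq (N : ℕ∞) lam e k = 1 := by
      filter_upwards [eventually_ge_atTop N] with k hk
      refine if_neg fun h2 => ?_
      have : k < N := by exact_mod_cast h2.2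
      omega
    exact exists_dWeight_bounds (h.deltaSeq_pos he) one_pos
      (tendsto_const_nhds.congr' (hev.mono fun k hk => hk.symm)) (hev.mono fun k hk => hk.ge)

/-- The lower bound for `α_k`. -/
theorem IsBirthDeathCoeffs.le_alphaCoeff (h : IsBirthDeathCoeffs N lam mu lamLim muLim)
    {Δ c : ℝ} (hΔ : 0 < Δ) (hc : 0 < c)
    (hcross : ∀ k : ℕ, (k : ℕ∞) < N → 0 ≤ shiftDown lam k * mu (k + 1) - lam k * mu k)
    (hc_mu : ∀ k : ℕ, (k : ℕ∞) < N → c < mu (k + 1) / muLim)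
    (hc_f : ∀ k : ℕ, (k : ℕ∞) < N → c ≤ fCoeff lam mu lamLim muLim Δ k)
    {a b : ℝ → ℝ} {t : ℝ} (ha : 0 ≤ a t) (hb : 0 ≤ b t) {k : ℕ} (hk : (k : ℕ∞) < N) :
    c * (muLim * b t - Δ * lamLim * a t) ≤ alphaCoeff (productRate lam a) (productRate mu b)
      (deltaSeq N lam (c * Δ * lamLim)) k t := by
  set e := c * Δ * lamLim with he
  have hl := h.lamLim_pos
  have hm := h.muLim_pos
  have he0 : 0 < e := by positivity
  have hcm : c * muLim < mu (k + 1) := (lt_div_iff₀ hm).1 (hc_mu k hk)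
  have h1 : 0 ≤ lam k + e - deltaSeq N lam e (k + 1) * lam (k + 1) := by
    rcases lt_or_eq_of_le (succ_le_of_cast_lt hk) with h2 | h2
    · rw [deltaSeq_succ h2, div_mul_cancel₀ _ (h.lam_pos _ h2).ne', sub_self]
    · rw [h.lam_eq_zero h2]
      linarith [h.lam_pos k hk]
  have h2 : 0 ≤ mu (k + 1) - c * muLim - (deltaSeq N lam e k)⁻¹ * mu k := by
    cases k with
    | zero => rw [h.mu_zero]; linarith
    | succ j =>
      have hj : (j : ℕ∞) < N := lt_of_le_of_lt (by exact_mod_cast j.le_succ) hk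
      have hlj := h.lam_pos j hj
      have hq := quadratic_le_zero_of_le_root (Q := Δ * lamLim * muLim)
        (P := Δ * lamLim * mu (j + 1 + 1) - lam j * muLim)
        (R := lam j * mu (j + 1 + 1) - lam (j + 1) * mu (j + 1)) (by positivity) hc
        (by simp only [fCoeff, shiftDown]; ring_nf) (hcross (j + 1) hk) (hc_f (j + 1) hk)
      rw [deltaSeq_succ hk, inv_div, sub_nonneg, div_mul_eq_mul_div, div_le_iff₀ (by linarith)]
      rw [he]
      nlinarith
  have h3 := mul_nonneg h1 ha
  have h4 := mul_nonneg h2 hb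
  simp only [alphaCoeff, productRate]
  rw [he] at h3
  linarith

theorem IsBirthDeathCoeffs.column_le (h : IsBirthDeathCoeffs N lam mu lamLim muLim)
    {δ : ℕ → ℝ} (hδ : ∀ k, 0 < δ k) {a b : ℝ → ℝ} {l t : ℝ} {k : ℕ} (hk : (k : ℕ∞) < N)
    (hα : l ≤ alphaCoeff (productRate lam a) (productRate mu b) δ k t) :
    cutoffBirth N lam (k + 1) * a t * dWeight δ (k + 1) +
      shiftDown (fun j => cutoffDeath N mu (j + 1) * b t * dWeight δ j) k -
      (cutoffBirth N lam k * a t + cutoffDeath N mu (k + 1) * b t) * dWeight δ k ≤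
      -l * dWeight δ k := by
  have hk1 := succ_le_of_cast_lt hk
  have hdk : 0 < dWeight δ k := Finset.prod_pos fun i _ => hδ _
  rw [h.cutoffBirth_eq hk1, h.cutoffBirth_eq hk.le, cutoffDeath_of_le hk1, dWeight_succ]
  have h1 : shiftDown (fun j => cutoffDeath N mu (j + 1) * b t * dWeight δ j) k =
      (δ k)⁻¹ * (mu k * b t) * dWeight δ k := by
    cases k with
    | zero => simp [shiftDown, h.mu_zero]
    | succ j =>
      have := (hδ (j + 1)).ne'
      simp only [shiftDown]
      rw [cutoffDeath_of_le hk.le, dWeight_succ]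
      field_simp
  rw [h1]
  have h2 := mul_le_mul_of_nonneg_right hα hdk.le
  simp only [alphaCoeff, productRate] at h2
  linarith

end DeltaSeq

theorem theorem1 (N : ℕ∞) (lam mu : ℕ → ℝ) (lamLim muLim : ℝ)
    (hrates : IsBirthDeathCoeffs N lam mu lamLim muLim)
    (a a₁ a₂ b b₁ b₂ : ℝ → ℝ) (T₁ T₂ : ℝ)
    (ha_nonneg : ∀ t, 0 ≤ t → 0 ≤ a t) (hb_nonneg : ∀ t, 0 ≤ t → 0 ≤ b t)
    (ha_int : LocallyIntegrableOn a (Set.Ici 0)) (hb_int : LocallyIntegrableOn b (Set.Ici 0))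
    (ha_per : IsAsymptoticallyPeriodic a a₁ a₂ T₁)
    (hb_per : IsAsymptoticallyPeriodic b b₁ b₂ T₂)
    (Δ : ℝ) (hΔ : 1 < Δ)
    (hcross : ∀ k : ℕ, (k : ℕ∞) < N → 0 ≤ shiftDown lam k * mu (k + 1) - lam k * mu k)
    (hmean : 0 < muLim * periodMean b₁ T₂ - Δ * lamLim * periodMean a₁ T₁)
    (f : ℝ)
    (hf : IsGLB {r : ℝ | ∃ k : ℕ, (k : ℕ∞) < N ∧ r = fCoeff lam mu lamLim muLim Δ k} f)
    (hf_pos : 0 < f)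
    (c : ℝ) (hc_pos : 0 < c) (hc_lt_one : c < 1)
    (hc_mu : ∀ k : ℕ, (k : ℕ∞) < N → c < mu (k + 1) / muLim) (hc_f : c ≤ f) :
    ∃ δ : ℕ → ℝ,
      (∀ k : ℕ, (k : ℕ∞) < N → 0 < δ k) ∧
      (N = ⊤ → 1 < liminf (fun k => (δ k : EReal)) atTop) ∧
      (∀ t, 0 ≤ t → ∀ k : ℕ, (k : ℕ∞) < N →
        c * (muLim * b t - Δ * lamLim * a t) ≤
          alphaCoeff (productRate lam a) (productRate mu b) δ k t) ∧
      0 < gConst N δ ∧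
      (∀ s, 0 ≤ s → ∀ p q : ℝ → ℕ → ℝ,
        IsForwardSolution N (productRate lam a) (productRate mu b) s p →
        IsForwardSolution N (productRate lam a) (productRate mu b) s q →
        ∀ t, s ≤ t →
          norm1D δ (p t - q t) ≤
            ENNReal.ofReal
              (Real.exp (-∫ u in s..t, c * (muLim * b u - Δ * lamLim * a u))) *
            norm1D δ (p s - q s) ∧
          l1Norm (p t - q t) ≤
            ENNReal.ofReal
              (4 / gConst N δ *
                Real.exp (-∫ u in s..t, c * (muLim * b u - Δ * lamLim * a u))) *
            ∑' i, ENNReal.ofReal (qWeight δ i * |p s i - q s i|)) ∧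
      BDWeaklyErgodic N (productRate lam a) (productRate mu b) ∧
      BDQuasiErgodic N (productRate lam a) (productRate mu b) := by
  have hΔ0 : 0 < Δ := by linarith
  have hlam0 := hrates.lamLim_pos
  have hmu0 := hrates.muLim_pos
  set e := c * Δ * lamLim with he
  have he0 : 0 < e := by positivity
  set l : ℝ → ℝ := fun u => c * (muLim * b u - Δ * lamLim * a u) with hl
  obtain ⟨κ, m₀, hm₀, hm, hκ₁, hκ₂⟩ := hrates.exists_dWeight_deltaSeq_bounds he0
  obtain ⟨K, hR⟩ := hrates.exists_isBoundedRate ha_nonneg hb_nonneg ha_int hb_int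
  set δ := deltaSeq N lam e
  have hδ : ∀ k, 0 < δ k := hrates.deltaSeq_pos he0
  have hα : ∀ t, 0 ≤ t → ∀ k : ℕ, (k : ℕ∞) < N → c * (muLim * b t - Δ * lamLim * a t) ≤
      alphaCoeff (productRate lam a) (productRate mu b) δ k t := fun t ht k hk =>
    hrates.le_alphaCoeff hΔ0 hc_pos hcross hc_mu (fun k hk => hc_f.trans (hf.1 ⟨k, hk, rfl⟩))
      (ha_nonneg t ht) (hb_nonneg t ht) hk
  have hd : IsContractionWeight N (cutoffBirth N lam) (cutoffDeath N mu) a b l (dWeight δ) κ m₀ :=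
    { m_pos := hm₀
      m_le := hm
      succ_le := hκ₁
      le_succ := hκ₂
      l_int := fun x hx => (((hb_int x hx).smul muLim).sub ((ha_int x hx).smul (Δ * lamLim))).smul c
      column := fun k hk u hu => hrates.column_le hδ hk (hα u hu k hk) }
  have hg := gConst_pos (N := N) hm₀ hm
  obtain ⟨α, hαp, hαi, hαl, hαm⟩ := ha_per.exists_periodic ha_int
  obtain ⟨β, hβp, hβi, hβl, hβm⟩ := hb_per.exists_periodic hb_int
  rw [hαm, hβm] at hmean
  set am := 1 / T₁ * ∫ u in (0 : ℝ)..T₁, α u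
  set bm := 1 / T₂ * ∫ u in (0 : ℝ)..T₂, β u
  set θ := muLim * bm - Δ * lamLim * am with hθ
  set ε := θ / (2 * (muLim + Δ * lamLim)) with hε
  have hε0 : 0 < ε := by positivity
  have hεθ : (muLim + Δ * lamLim) * ε = θ / 2 := by rw [hε]; field_simp
  obtain ⟨Ca, hCa⟩ := exists_abs_integral_sub_mean_le ha_per.period_pos ha_int hαp hαi hαl hε0
  obtain ⟨Cb, hCb⟩ := exists_abs_integral_sub_mean_le hb_per.period_pos hb_int hβp hβi hβl hε0
  have hlow : ∀ v u, 0 ≤ v → v ≤ u →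
      c * θ / 2 * (u - v) - c * (muLim * Cb + Δ * lamLim * Ca) ≤ ∫ w in v..u, l w := by
    intro v u hv hvu
    have hai := ha_int.intervalIntegrable_of_nonneg hv (hv.trans hvu)
    have hbi := hb_int.intervalIntegrable_of_nonneg hv (hv.trans hvu)
    rw [hl, intervalIntegral.integral_const_mul, intervalIntegral.integral_sub
      (hbi.const_mul _) (hai.const_mul _), intervalIntegral.integral_const_mul,
      intervalIntegral.integral_const_mul]
    have h1 := mul_le_mul_of_nonneg_left (abs_le.1 (hCa v u hv hvu)).2
      (mul_pos hΔ0 hlam0).le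
    have h2 := mul_le_mul_of_nonneg_left (abs_le.1 (hCb v u hv hvu)).1 hmu0.le
    have h3 : (muLim + Δ * lamLim) * ε * (u - v) = θ / 2 * (u - v) := by rw [hεθ]
    have h4 : θ / 2 * (u - v) - (muLim * Cb + Δ * lamLim * Ca) ≤
        muLim * (∫ w in v..u, b w) - Δ * lamLim * ∫ w in v..u, a w := by
      have h5 : θ * (u - v) = muLim * (bm * (u - v)) - Δ * lamLim * (am * (u - v)) := by
        rw [hθ]; ring
      linarith
    have h6 := mul_le_mul_of_nonneg_left h4 hc_pos.le
    linarith
  have hκ₀ : 0 < c * θ / 2 := by positivity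
  have hl_top : Tendsto (fun t => ∫ v in (0 : ℝ)..t, l v) atTop atTop := by
    have h1 : Tendsto (fun t : ℝ => c * θ / 2 * t - c * (muLim * Cb + Δ * lamLim * Ca))
        atTop atTop :=
      tendsto_atTop_add_const_right _ _ (tendsto_id.const_mul_atTop hκ₀)
    refine tendsto_atTop_mono' _ ?_ h1
    filter_upwards [eventually_ge_atTop 0] with t ht
    simpa using hlow 0 t le_rfl ht
  refine ⟨δ, fun k _ => hδ k, fun hN => ?_, hα, hg, ?_, ?_, ?_⟩
  · have hlim := hrates.tendsto_deltaSeq_top (e := e) hN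
    have hlim' : Tendsto (fun k => (δ k : EReal)) atTop (𝓝 (((lamLim + e) / lamLim : ℝ) : EReal)) :=
      (continuous_coe_real_ereal.tendsto _).comp hlim
    rw [hlim'.liminf_eq]
    exact_mod_cast hrates.one_lt_limit he0
  · intro s hs p q hp hq t hst
    have hp' := hrates.isProbSolution hp
    have hq' := hrates.isProbSolution hq
    have h1 := hd.norm1D_sub_le hR hs hp' hq' hst
    refine ⟨h1, ?_⟩
    have hsum : HasSum (p t - q t) 0 := by
      have := (hp.1 t hst).2.1.sub (hq.1 t hst).2.1
      rw [sub_self] at this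
      exact this
    have h2 := l1Norm_le_norm1D hd.pos hg hsum fun k hk => by
      rw [partialSum_sub, partialSum_eq_one (hp.1 t hst) hk, partialSum_eq_one (hq.1 t hst) hk,
        sub_self]
    have h3 := norm1D_le_tsum_qWeight hd.pos (x := p s - q s)
      ((hp.1 s le_rfl).2.1.summable.sub (hq.1 s le_rfl).2.1.summable).abs
    rw [ENNReal.ofReal_mul (by positivity), mul_assoc]
    refine h2.trans (mul_le_mul_right (h1.trans (mul_le_mul_right h3 _)) _)
  · intro p q hp hq
    exact tendsto_l1Norm_zero fun ε hε => hd.eventually_sum_abs_sub_le hR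
      (fun k hk => cutoffBirth_of_le hk) (fun k hk => cutoffDeath_of_lt hk) hl_top
      (hrates.isProbSolution hp) (hrates.isProbSolution hq) hε
  · obtain ⟨ϖ, hϖ, hmeanlim⟩ := hd.exists_mean_limit hR
      (fun k hk => cutoffBirth_of_le hk) (fun k hk => cutoffDeath_of_lt hk) hκ₀ hlow
      (Ca := am + (ε + Ca)) (fun v hv => by
        have := (abs_le.1 (hCa v (v + 1) hv (by linarith))).2
        rw [add_sub_cancel_left, mul_one, mul_one] at this
        linarith) hl_top
      fun ε hε => exists_translate_close ha_per.period_pos hb_per.period_pos ha_int hb_int hαp hβp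
        hβi hαl hβl hε
    exact ⟨ϖ, hϖ, fun p hp => hmeanlim p (hrates.isProbSolution hp)⟩
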